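/- An $O(N)^3$-invariant graph is a finite graph obtained as follows. Take finitely many tetrahedral bubbles, each being a copy of the complete graph on the vertices $0,1,2,3$ with edges properly coloured by $1,2,3$: colour $1$ on $\{0,1\},\{2,3\}$, colour $2$ on $\{0,2\},\{1,3\}$, colour $3$ on $\{0,3\},\{1,2\}$. Then join all the vertices of the bubbles in pairs by edges of colour $0$. Isomorphisms preserve all four colours. A face of colour $i\in\{1,2,3\}$ is a bicoloured cycle of colours $\{0,i\}$, and its length is its number of edges of colour $0$. The jacket $J_i$ is the $3$-coloured graph obtained by deleting the edges of colour $i$. It encodes a closed surface whose faces are its bicoloured cycles (one family for each pair of its colours); its genus $g_i\in\frac12\mathbb Z$ is given by $2-2g_i=V-E(J_i)+F(J_i)$, where $V$, $E(J_i)$, $F(J_i)$ are its numbers of vertices, edges and faces. The degree of a connected graph is $\omega=g_1+g_2+g_3$. A graph is 2PI if no removal of two edges of colour $0$ disconnects it, and dipole-free if no face of length $2$ passes through two distinct bubbles. **Theorem.** Up to isomorphism, there is a unique connected, 2PI, dipole-free $O(N)^3$-invariant graph of degree $3/2$. It has five bubbles, $b_*$ and $b_0,b_1,b_2,b_3$,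 and the following edges of colour $0$: for each $s\in\{0,1,2,3\}$, the vertex $s$ of $b_*$ is joined to the vertex $0$ of $b_s$; and for each $t\in\{1,2,3\}$ and each pair $\{s,s'\}$ of vertices joined by an edge of colour $t$ in the tetrahedral bubble, the vertex $t$ of $b_s$ is joined to the vertex $t$ of $b_{s'}$. Each of its three jackets has genus $1/2$ and the surface that it encodes is homeomorphic to the real projective plane. For each colour $i\in\{1,2,3\}$ it has exactly three faces of colour $i$, two of length $3$ and one of length $4$. -/

import Mathlib

/-- A (multi)graph on the vertex set `V`, properly edge-coloured by `C`, in which every vertex has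
exactly one incident edge of each colour. `nbr c v` is the other end of the edge of colour `c`
at `v`. Parallel edges of different colours are allowed. -/
structure ColoredGraph (C V : Type*) where
  nbr : C → V → V
  nbr_involutive : ∀ c, Function.Involutive (nbr c)
  nbr_ne : ∀ c v, nbr c v ≠ v

namespace ColoredGraph

variable {C V W : Type*}

/-- The edges of colour `c`, each given by its pair of ends. -/
def edges (G : ColoredGraph C V) (c : C) : Set (Sym2 V) :=
  Set.range fun v => s(v, G.nbr c v)

/-- The adjacency relation of `G` after the edges of colour `c` that belong to `E` are removed. -/
def remove (G : ColoredGraph C V) (c : C) (E : Set (Sym2 V)) : SimpleGraph V where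
  Adj v w := ∃ a, G.nbr a v = w ∧ ¬ (a = c ∧ s(v, w) ∈ E)
  symm := ⟨by
    rintro v w ⟨a, rfl, h⟩
    exact ⟨a, G.nbr_involutive a v, by rwa [Sym2.eq_swap]⟩⟩
  loopless := ⟨by
    rintro v ⟨a, h, -⟩
    exact G.nbr_ne a v h⟩

/-- The adjacency relation given by the edges with a colour in `S`. -/
def restrict (G : ColoredGraph C V) (S : Set C) : SimpleGraph V where
  Adj v w := ∃ a ∈ S, G.nbr a v = w
  symm := ⟨by
    rintro v w ⟨a, ha, rfl⟩
    exact ⟨a, ha, G.nbr_involutive a v⟩⟩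
  loopless := ⟨by
    rintro v ⟨a, -, h⟩
    exact G.nbr_ne a v h⟩

/-- `G` is connected (in particular, it has a vertex). -/
def IsConnected (G : ColoredGraph C V) : Prop :=
  (G.restrict Set.univ).Connected

/-- The bicoloured cycles of colours `a ≠ b`: the connected components of the graph formed by the
edges of these two colours. -/
abbrev BicoloredCycle (G : ColoredGraph C V) (a b : C) : Type _ :=
  (G.restrict {a, b}).ConnectedComponent

/-- Isomorphism of coloured graphs: a bijection of the vertices that maps the edges of each colour
to the edges of the same colour. -/
def IsIsomorphic (G : ColoredGraph C V) (H : ColoredGraph C W) : Prop :=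
  ∃ e : V ≃ W, ∀ c v, e (G.nbr c v) = H.nbr c (e v)

/-- Delete all edges of colour `i`. -/
def deleteColor (G : ColoredGraph C V) (i : C) : ColoredGraph {c : C // c ≠ i} V where
  nbr c := G.nbr c
  nbr_involutive c := G.nbr_involutive c
  nbr_ne c := G.nbr_ne c

/-- Euler characteristic of the surface encoded by a 3-coloured graph: the vertices and the edges
are those of the graph, the faces are the bicoloured cycles, one family for each pair of colours. -/
noncomputable def eulerChar [Fintype C] [LinearOrder C] (H : ColoredGraph C V) : ℤ :=
  (Nat.card V : ℤ) - ∑ c : C, ((H.edges c).ncard : ℤ)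
    + ∑ p : C × C with p.1 < p.2, (Nat.card (H.BicoloredCycle p.1 p.2) : ℤ)

/-- The (possibly half-integral) genus `g` of the surface, `χ = 2 - 2 g`. -/
noncomputable def genus [Fintype C] [LinearOrder C] (H : ColoredGraph C V) : ℚ :=
  (2 - (H.eulerChar : ℚ)) / 2

/-- The surface encoded by a 3-coloured graph, as a topological space. Take one triangle for each
vertex of the graph, with its three corners labelled by the colours, and for every edge of colour
`c` glue the sides opposite to the corners `c` of the two triangles, respecting the labels. The
corners of label `c` are then identified along the bicoloured cycles of the other two colours. -/
abbrev Surface [Fintype C] (H : ColoredGraph C V) : Type _ :=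
  Quot fun p q : (Σ _ : V, stdSimplex ℝ C) =>
    ∃ c, q.1 = H.nbr c p.1 ∧ q.2 = p.2 ∧ (p.2 : C → ℝ) c = 0

end ColoredGraph

/-- The real projective plane: the unit sphere of `ℝ³` with antipodal points identified. -/
abbrev RealProjectivePlane : Type :=
  Quot fun x y : Metric.sphere (0 : EuclideanSpace ℝ (Fin 3)) 1 => y = -x

/-- The tetrahedral bubble `ψ_abc ψ_ade ψ_fbe ψ_fdc`. Its vertices are the four tensors, numbered
`0, 1, 2, 3` from left to right, and an edge of colour `c ∈ {1, 2, 3}` joins two tensors whose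
`c`-th indices are contracted. `tetrahedron c s` is the `c`-neighbour of `s`
(row `0` is not used). -/
def tetrahedron : Fin 4 → Fin 4 → Fin 4 :=
  ![![0, 1, 2, 3], ![1, 0, 3, 2], ![2, 3, 0, 1], ![3, 2, 1, 0]]

theorem tetrahedron_tetrahedron : ∀ c s, tetrahedron c (tetrahedron c s) = s := by decide

theorem tetrahedron_ne : ∀ c s, c ≠ 0 → tetrahedron c s ≠ s := by decide

/-- An `O(N)³`-invariant (vacuum Feynman) graph with set of tetrahedral bubbles `B`. Its vertices
are the pairs `(b, s)` of a bubble and one of its four vertices; the propagators (edges of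
colour `0`) pair the vertices. -/
structure ONGraph (B : Type*) where
  propagator : B × Fin 4 → B × Fin 4
  propagator_involutive : Function.Involutive propagator
  propagator_ne : ∀ v, propagator v ≠ v

namespace ONGraph

variable {B : Type*}

/-- The underlying 4-coloured graph. -/
def graph (G : ONGraph B) : ColoredGraph (Fin 4) (B × Fin 4) where
  nbr c v := if c = 0 then G.propagator v else (v.1, tetrahedron c v.2)
  nbr_involutive c v := by
    by_cases hc : c = 0
    · simp only [hc, if_true]
      exact G.propagator_involutive v
    · simp only [hc, if_false]
      rw [tetrahedron_tetrahedron]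
  nbr_ne c v := by
    by_cases hc : c = 0
    · simp only [hc, if_true]
      exact G.propagator_ne v
    · simp only [hc, if_false]
      intro h
      exact tetrahedron_ne c v.2 hc (congrArg Prod.snd h)

/-- The faces of colour `i ∈ {1, 2, 3}`: the bicoloured cycles of colours `0` and `i`. -/
abbrev Face (G : ONGraph B) (i : Fin 4) : Type _ :=
  G.graph.BicoloredCycle 0 i

/-- The length of a face: its number of edges of colour `0`. -/
noncomputable def faceLength (G : ONGraph B) {i : Fin 4} (f : G.Face i) : ℕ :=
  ((fun v => s(v, G.graph.nbr 0 v)) '' f.supp).ncard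

/-- The jacket `J_i`, for `i ∈ {1, 2, 3}`. -/
def jacket (G : ONGraph B) (i : Fin 4) : ColoredGraph {c : Fin 4 // c ≠ i} (B × Fin 4) :=
  G.graph.deleteColor i

/-- The degree: the sum of the genera of the three jackets. -/
noncomputable def degree (G : ONGraph B) : ℚ :=
  (G.jacket 1).genus + (G.jacket 2).genus + (G.jacket 3).genus

/-- 2-particle-irreducible: there is no 2-edge-cut, i.e. the removal of two edges of colour `0`
never disconnects the graph. -/
def IsTwoPI (G : ONGraph B) : Prop :=
  ∀ e ∈ G.graph.edges 0, ∀ e' ∈ G.graph.edges 0, e ≠ e' →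
    (G.graph.remove 0 {e, e'}).Connected

/-- No dipole of any colour. A dipole of colour `i` consists of two distinct bubbles connected by
two edges of colour `0` that close a face of colour `i` and length two. -/
def IsDipoleFree (G : ONGraph B) : Prop :=
  ¬ ∃ i : Fin 4, i ≠ 0 ∧ ∃ f : G.Face i, G.faceLength f = 2 ∧
    ∃ v ∈ f.supp, ∃ w ∈ f.supp, v.1 ≠ w.1

/-- A connected, 2PI, dipole-free graph of degree `3/2`. -/
def IsTwoPIDipoleFreeOfDegreeThreeHalves (G : ONGraph B) : Prop :=
  G.graph.IsConnected ∧ G.IsTwoPI ∧ G.IsDipoleFree ∧ G.degree = 3 / 2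

end ONGraph

/-- The propagators of the explicit graph on five bubbles, a central one (`none`) and four outer
ones (`some s`, one for each vertex `s` of the central bubble). The vertex `s` of the central
bubble is joined to the vertex `0` of the outer bubble `s`, and for `t ∈ {1, 2, 3}` the vertex `t`
of the outer bubble `s` is joined to the vertex `t` of the outer bubble `tetrahedron t s`. -/
def fiveBubblePropagator : Option (Fin 4) × Fin 4 → Option (Fin 4) × Fin 4
  | (none, s) => (some s, 0)
  | (some s, t) => if t = 0 then (none, s) else (some (tetrahedron t s), t)

/-- The explicit graph of degree `3/2`. -/
def fiveBubbleGraph : ONGraph (Option (Fin 4)) where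
  propagator := fiveBubblePropagator
  propagator_involutive := by unfold Function.Involutive; decide
  propagator_ne := by decide

/-!
Let `{i, j, k} = {1, 2, 3}`. The bubbles and the propagators form a 4-regular graph drawn on the
surface of the jacket `J_i`. Its regions are the faces of colours `j` and `k`, and the faces of
colour `i` are the closed curves that go straight through every bubble. Hence the homology modulo
two of the surface, with its intersection form, controls how the faces of colour `i` cross.

No jacket is a sphere: on a sphere closed curves cross evenly, and the degree makes the number of
bubbles odd, one face of colour `i` a hexagon and the others squares. As two distinct faces share an
even number of bubbles, some face crosses itself, which only the hexagon can do. Together with a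
square that crosses it twice, it then fills the connected graph, which has more faces than that.
Since the genera are half-integers of sum `3 / 2`, every jacket has genus `1 / 2`.

On a projective plane two closed curves cross oddly if and only if both have odd self-intersection.
Thus any two faces of colour `i` of odd length cross, while a face of even length crosses every
other face evenly. The defects `4 - ℓ` of the faces of colour `i`, where `ℓ` is the length, add up
to `2`, hence there is a face of length three; as it meets every other odd face at a bubble of its
own, there are at most four odd faces. Four lead to a contradiction, so there are two triangles of
colour `i`, and all other faces of colour `i` have length four. At the bubble where the two
triangles cross, the faces of the other two colours are triangles as well, and this determines the
graph.

The triangles of the surface of a jacket of the graph on five bubbles divide the four octants of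
`ℝ³` modulo `±1` into five cones each.
-/

namespace ColoredGraph

variable {C V : Type*} (G : ColoredGraph C V)

@[simp] theorem nbr_nbr (c : C) (v : V) : G.nbr c (G.nbr c v) = v :=
  G.nbr_involutive c v

theorem two_mul_ncard_image_edge [Finite V] (c : C) (S : Set V) (hS : ∀ v ∈ S, G.nbr c v ∈ S) :
    2 * ((fun v => s(v, G.nbr c v)) '' S).ncard = S.ncard := by
  classical
  have := Fintype.ofFinite V
  have fiber_card : ∀ e ∈ S.toFinset.image (fun v => s(v, G.nbr c v)),
      (S.toFinset.filter fun v => s(v, G.nbr c v) = e).card = 2 := by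
    intro e he
    obtain ⟨v, hv, rfl⟩ := Finset.mem_image.1 he
    rw [Set.mem_toFinset] at hv
    refine Finset.card_eq_two.2 ⟨v, G.nbr c v, (G.nbr_ne c v).symm, ?_⟩
    ext w
    simp only [Finset.mem_filter, Set.mem_toFinset, Sym2.eq_iff, Finset.mem_insert,
      Finset.mem_singleton]
    constructor
    · rintro ⟨-, ⟨h, -⟩ | ⟨h, -⟩⟩
      exacts [Or.inl h, Or.inr h]
    · rintro (rfl | rfl)
      exacts [⟨hv, Or.inl ⟨rfl, rfl⟩⟩, ⟨hS _ hv, Or.inr ⟨rfl, G.nbr_nbr c v⟩⟩]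
  rw [Set.ncard_eq_toFinset_card' S, Set.ncard_eq_toFinset_card', Set.toFinset_image,
    Finset.card_eq_sum_card_image (fun v => s(v, G.nbr c v)) S.toFinset,
    Finset.sum_const_nat fiber_card, mul_comm]

theorem two_mul_ncard_edges [Finite V] (c : C) : 2 * (G.edges c).ncard = Nat.card V := by
  rw [edges, ← Set.image_univ, two_mul_ncard_image_edge G c Set.univ (fun _ _ => Set.mem_univ _),
    Set.ncard_univ]

variable {G} in
theorem apply_eq_of_reachable {α : Type*} {S : Set C} {f : V → α}
    (hf : ∀ c ∈ S, ∀ v, f (G.nbr c v) = f v) {v w : V} (h : (G.restrict S).Reachable v w) :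
    f v = f w := by
  obtain ⟨q⟩ := h
  induction q with
  | nil => rfl
  | cons hadj _ ih =>
    obtain ⟨a, ha, rfl⟩ := hadj
    rw [← ih, hf a ha]

theorem deleteColor_restrict (i : C) (a b : {c : C // c ≠ i}) :
    (G.deleteColor i).restrict {a, b} = G.restrict {a.1, b.1} := by
  ext v w
  simp [restrict, deleteColor]

variable (a b : C)

/-- The bicoloured cycle of colours `a` and `b` through `v`. -/
def cycle (v : V) : G.BicoloredCycle a b :=
  (G.restrict {a, b}).connectedComponentMk v

@[simp] theorem cycle_nbr_left (v : V) : G.cycle a b (G.nbr a v) = G.cycle a b v :=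
  SimpleGraph.ConnectedComponent.sound
    (SimpleGraph.Adj.reachable ⟨a, Set.mem_insert _ _, G.nbr_nbr a v⟩)

@[simp] theorem cycle_nbr_right (v : V) : G.cycle a b (G.nbr b v) = G.cycle a b v :=
  SimpleGraph.ConnectedComponent.sound
    (SimpleGraph.Adj.reachable ⟨b, Set.mem_insert_of_mem _ rfl, G.nbr_nbr b v⟩)

variable {G a b} in
theorem apply_eq_of_cycle_eq {α : Type*} {f : V → α} (ha : ∀ v, f (G.nbr a v) = f v)
    (hb : ∀ v, f (G.nbr b v) = f v) {v w : V} (h : G.cycle a b v = G.cycle a b w) : f v = f w :=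
  apply_eq_of_reachable (S := {a, b}) (by rintro c (rfl | rfl); exacts [ha, hb])
    (SimpleGraph.ConnectedComponent.exact h)

/-- Two edges further along the bicoloured cycle of colours `a` and `b`, the first one of
colour `a`. -/
def stride (v : V) : V := G.nbr b (G.nbr a v)

theorem stride_injective : Function.Injective (G.stride a b) :=
  (G.nbr_involutive b).injective.comp (G.nbr_involutive a).injective

@[simp] theorem cycle_iterate_stride (m : ℕ) (v : V) :
    G.cycle a b ((G.stride a b)^[m] v) = G.cycle a b v := by
  induction m with
  | zero => rfl
  | succ m ih => rw [Function.iterate_succ_apply', stride, cycle_nbr_right, cycle_nbr_left, ih]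

-- Peeling off the first and the last stride shortens a counterexample by two.
theorem iterate_stride_ne_nbr_left (m : ℕ) (v : V) : (G.stride a b)^[m] v ≠ G.nbr a v := by
  induction m using Nat.strong_induction_on generalizing v with
  | _ m ih =>
    match m with
    | 0 => exact (G.nbr_ne a v).symm
    | 1 => exact G.nbr_ne b _
    | m + 2 =>
      intro h
      apply ih m (by omega) (G.stride a b v)
      apply G.stride_injective a b
      rw [← Function.iterate_succ_apply' (G.stride a b) m, ← Function.iterate_succ_apply, h]
      simp only [stride, nbr_nbr]

theorem iterate_stride_ne_nbr_left_iterate (l m : ℕ) (v : V) :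
    (G.stride a b)^[l] v ≠ G.nbr a ((G.stride a b)^[m] v) := by
  intro h
  rcases le_total m l with hml | hlm
  · obtain ⟨d, rfl⟩ := Nat.exists_eq_add_of_le' hml
    rw [Function.iterate_add_apply] at h
    exact G.iterate_stride_ne_nbr_left a b _ _ h
  · obtain ⟨d, rfl⟩ := Nat.exists_eq_add_of_le' hlm
    rw [Function.iterate_add_apply] at h
    apply G.iterate_stride_ne_nbr_left a b d ((G.stride a b)^[l] v)
    conv_rhs => rw [h]
    rw [nbr_nbr]

theorem iterate_stride_ne_nbr_right_iterate (l m : ℕ) (v : V) :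
    (G.stride a b)^[l] v ≠ G.nbr b ((G.stride a b)^[m] v) := by
  have not_succ : ∀ l m, (G.stride a b)^[l + 1] v ≠ G.nbr b ((G.stride a b)^[m] v) := by
    intro l m h
    rw [Function.iterate_succ_apply', stride] at h
    exact G.iterate_stride_ne_nbr_left_iterate a b m l v
      ((G.nbr_involutive b).injective h).symm
  match l, m with
  | l + 1, m => exact not_succ l m
  | 0, m + 1 =>
    intro h
    apply not_succ m 0
    rw [h, nbr_nbr]
  | 0, 0 => exact (G.nbr_ne b v).symm

section Finite

variable [Finite V]

theorem minimalPeriod_stride_pos (v : V) : 0 < Function.minimalPeriod (G.stride a b) v :=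
  Function.minimalPeriod_pos_of_mem_periodicPts ((G.stride_injective a b).mem_periodicPts v)

variable {G a b} in
theorem exists_iterate_stride_of_cycle_eq {v w : V} (h : G.cycle a b v = G.cycle a b w) :
    ∃ m < Function.minimalPeriod (G.stride a b) v,
      (G.stride a b)^[m] v = w ∨ (G.stride a b)^[m] v = G.nbr a w := by
  have hper : (G.stride a b)^[_] v = v := Function.iterate_minimalPeriod
  have hpos := G.minimalPeriod_stride_pos a b v
  set ℓ := Function.minimalPeriod (G.stride a b) v with hℓ
  let reached : V → Prop := fun w =>
    ∃ m, (G.stride a b)^[m] v = w ∨ (G.stride a b)^[m] v = G.nbr a w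
  have reached_left : ∀ w, reached w → reached (G.nbr a w) := by
    rintro w ⟨m, h | h⟩
    exacts [⟨m, Or.inr (by rw [h, nbr_nbr])⟩, ⟨m, Or.inl h⟩]
  have reached_right : ∀ w, reached w → reached (G.nbr b w) := by
    rintro w ⟨m, h | h⟩
    · refine ⟨m + (ℓ - 1), Or.inr (G.stride_injective a b ?_)⟩
      rw [← Function.iterate_succ_apply' (G.stride a b),
        show (m + (ℓ - 1)).succ = m + ℓ by omega, Function.iterate_add_apply, hper, h]
      simp only [stride, nbr_nbr]
    · refine ⟨m + 1, Or.inl ?_⟩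
      rw [Function.iterate_succ_apply', h, stride, nbr_nbr]
  have reached_iff : reached v = reached w := apply_eq_of_cycle_eq (f := reached)
    (fun w => propext ⟨fun h => by simpa using reached_left _ h, reached_left w⟩)
    (fun w => propext ⟨fun h => by simpa using reached_right _ h, reached_right w⟩) h
  obtain ⟨m, hm⟩ := reached_iff.mp ⟨0, Or.inl rfl⟩
  refine ⟨m % ℓ, Nat.mod_lt _ hpos, ?_⟩
  rwa [hℓ, Function.iterate_mod_minimalPeriod_eq]

theorem ncard_image_edge_cycle (v : V) :
    ((fun w => s(w, G.nbr a w)) '' (G.cycle a b v).supp).ncard =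
      Function.minimalPeriod (G.stride a b) v := by
  set ℓ := Function.minimalPeriod (G.stride a b) v
  have edges_eq : (fun w => s(w, G.nbr a w)) '' (G.cycle a b v).supp =
      (fun l => s((G.stride a b)^[l] v, G.nbr a ((G.stride a b)^[l] v))) '' Set.Iio ℓ := by
    ext e
    constructor
    · rintro ⟨w, hw, rfl⟩
      obtain ⟨m, hm, h⟩ := exists_iterate_stride_of_cycle_eq (Eq.symm hw)
      refine ⟨m, hm, ?_⟩
      rcases h with h | h
      · simp only [h]
      · simp only [h, nbr_nbr, Sym2.eq_swap]
    · rintro ⟨l, -, rfl⟩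
      exact ⟨_, G.cycle_iterate_stride a b l v, rfl⟩
  rw [edges_eq, Set.InjOn.ncard_image, ← Nat.card_coe_set_eq, Nat.card_eq_fintype_card,
    Fintype.card_Iio, Nat.card_Iio]
  intro l hl m hm h
  rcases Sym2.eq_iff.1 h with ⟨h, -⟩ | ⟨h, -⟩
  · exact Function.iterate_injOn_Iio_minimalPeriod hl hm h
  · exact absurd h (G.iterate_stride_ne_nbr_left_iterate a b l m v)

end Finite

end ColoredGraph

/-! ### Faces and bubbles -/

/-- `i, j, k` are the three colours of the bubbles, in some order. -/
def IsColorTriple (i j k : Fin 4) : Prop :=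
  i ≠ 0 ∧ j ≠ 0 ∧ k ≠ 0 ∧ i ≠ j ∧ i ≠ k ∧ j ≠ k

instance (i j k : Fin 4) : Decidable (IsColorTriple i j k) := by
  unfold IsColorTriple; infer_instance

namespace IsColorTriple

variable {i j k : Fin 4}

theorem ne₁ (h : IsColorTriple i j k) : i ≠ 0 := h.1

theorem ne₂ (h : IsColorTriple i j k) : j ≠ 0 := h.2.1

theorem ne₃ (h : IsColorTriple i j k) : k ≠ 0 := h.2.2.1

theorem swap (h : IsColorTriple i j k) : IsColorTriple i k j := by
  unfold IsColorTriple at *; tauto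

theorem rotate (h : IsColorTriple i j k) : IsColorTriple j k i := by
  unfold IsColorTriple at *; tauto

theorem tetrahedron_comp : ∀ {i j k : Fin 4}, IsColorTriple i j k → ∀ s,
    tetrahedron i (tetrahedron j s) = tetrahedron k s := by
  decide

theorem eq_or_eq_tetrahedron : ∀ {i j k : Fin 4}, IsColorTriple i j k → ∀ s s',
    s' = s ∨ s' = tetrahedron i s ∨ s' = tetrahedron j s ∨ s' = tetrahedron k s := by
  decide

theorem color_cases : ∀ {i j k : Fin 4}, IsColorTriple i j k → ∀ c,
    c = 0 ∨ c = i ∨ c = j ∨ c = k := by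
  decide

theorem sum_eq {M : Type*} [AddCommMonoid M] (h : IsColorTriple i j k) (f : Fin 4 → M)
    (s : Fin 4) :
    ∑ x, f x = f s + f (tetrahedron i s) + f (tetrahedron j s) + f (tetrahedron k s) := by
  have univ_eq : ∀ {i j k : Fin 4}, IsColorTriple i j k → ∀ s, (Finset.univ : Finset (Fin 4)) =
      {s, tetrahedron i s, tetrahedron j s, tetrahedron k s} ∧
      s ∉ ({tetrahedron i s, tetrahedron j s, tetrahedron k s} : Finset (Fin 4)) ∧
      tetrahedron i s ∉ ({tetrahedron j s, tetrahedron k s} : Finset (Fin 4)) ∧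
      tetrahedron j s ∉ ({tetrahedron k s} : Finset (Fin 4)) := by decide
  obtain ⟨h1, h2, h3, h4⟩ := univ_eq h s
  rw [h1, Finset.sum_insert h2, Finset.sum_insert h3, Finset.sum_insert h4, Finset.sum_singleton]
  simp only [add_assoc]

theorem sum_jacket_pairs (h : IsColorTriple i j k) (f : Fin 4 → Fin 4 → ℤ)
    (hf : ∀ a b, f a b = f b a) :
    ∑ p : {c // c ≠ i} × {c // c ≠ i} with p.1 < p.2, f p.1.1 p.2.1 =
      f 0 j + f 0 k + f j k := by
  have filter_eq : ∀ {i j k : Fin 4}, IsColorTriple i j k →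
      ((Finset.univ.filter fun p : {c // c ≠ i} × {c // c ≠ i} => p.1 < p.2).map
        ((Function.Embedding.subtype _).prodMap (Function.Embedding.subtype _))) =
      {(0, j), (0, k), (min j k, max j k)} := by decide
  have sum_eq_image : ∑ p : {c // c ≠ i} × {c // c ≠ i} with p.1 < p.2, f p.1.1 p.2.1 =
      ∑ p ∈ {(0, j), (0, k), (min j k, max j k)}, f p.1 p.2 := by
    rw [← filter_eq h, Finset.sum_map]; rfl
  obtain ⟨hj, hk, hjk⟩ : j ≠ 0 ∧ k ≠ 0 ∧ j ≠ k := ⟨h.ne₂, h.ne₃, h.2.2.2.2.2⟩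
  rw [sum_eq_image]
  rcases le_total j k with hle | hle
  · simp [hle, hj.symm, hjk]; ring
  · simp [hle, hk.symm, hjk, hf k j]; ring

end IsColorTriple

theorem tetrahedron_zero : ∀ c, tetrahedron c 0 = c := by decide

theorem exists_isColorTriple : ∀ i : Fin 4, i ≠ 0 → ∃ j k, IsColorTriple i j k := by decide

namespace ONGraph

variable {B : Type*}

/-- The neighbour of `v` inside its bubble, along the edge of colour `c`. -/
def flip (c : Fin 4) (v : B × Fin 4) : B × Fin 4 := (v.1, tetrahedron c v.2)

@[simp] theorem flip_fst (c : Fin 4) (v : B × Fin 4) : (flip c v).1 = v.1 := rfl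

@[simp] theorem flip_flip (c : Fin 4) (v : B × Fin 4) : flip c (flip c v) = v := by
  simp [flip, tetrahedron_tetrahedron]

theorem flip_ne {c : Fin 4} (hc : c ≠ 0) (v : B × Fin 4) : flip c v ≠ v :=
  fun h => tetrahedron_ne c v.2 hc (congrArg Prod.snd h)

section ColorTriple

variable {i j k : Fin 4} (h : IsColorTriple i j k)
include h

theorem flip_comp (v : B × Fin 4) : flip i (flip j v) = flip k v := by
  simp [flip, h.tetrahedron_comp]

theorem flip_ne_flip (v : B × Fin 4) : flip i v ≠ flip j v := by
  intro he
  have := congrArg (flip j) he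
  rw [flip_flip, flip_comp h.rotate.swap] at this
  exact flip_ne h.ne₃ v this

theorem eq_or_eq_flip_of_fst_eq {v w : B × Fin 4} (hvw : w.1 = v.1) :
    w = v ∨ w = flip i v ∨ w = flip j v ∨ w = flip k v := by
  obtain ⟨b, s⟩ := v
  obtain ⟨b', s'⟩ := w
  obtain rfl : b' = b := hvw
  simpa [flip] using h.eq_or_eq_tetrahedron s s'

end ColorTriple

variable (G : ONGraph B)

@[simp] theorem propagator_propagator (v : B × Fin 4) : G.propagator (G.propagator v) = v :=
  G.propagator_involutive v

theorem graph_nbr_zero (v : B × Fin 4) : G.graph.nbr 0 v = G.propagator v := by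
  simp [graph]

theorem graph_nbr {c : Fin 4} (hc : c ≠ 0) (v : B × Fin 4) : G.graph.nbr c v = flip c v := by
  simp [graph, hc, flip]

/-- One step along a face of colour `i`: across a propagator, then across an edge of colour `i`. -/
def step (i : Fin 4) (v : B × Fin 4) : B × Fin 4 := flip i (G.propagator v)

@[simp] theorem step_fst (i : Fin 4) (v : B × Fin 4) :
    (G.step i v).1 = (G.propagator v).1 := rfl

theorem flip_step (i : Fin 4) (v : B × Fin 4) : flip i (G.step i v) = G.propagator v :=
  flip_flip _ _

theorem propagator_flip_step (i : Fin 4) (v : B × Fin 4) :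
    G.propagator (flip i (G.step i v)) = v := by simp [step]

/-- The face of colour `i` through `v`. -/
def face (i : Fin 4) (v : B × Fin 4) : G.Face i := G.graph.cycle 0 i v

theorem face_surjective (i : Fin 4) : Function.Surjective (G.face i) :=
  fun f => f.exists_rep

/-- The faces of colour `i` that visit the bubble `b`; there are one or two of them. -/
def facesAt (i : Fin 4) (b : B) : Set (G.Face i) := Set.range fun s => G.face i (b, s)

theorem face_mem_facesAt (i : Fin 4) (v : B × Fin 4) : G.face i v ∈ G.facesAt i v.1 :=
  ⟨v.2, rfl⟩

theorem mem_supp_iff {i : Fin 4} (f : G.Face i) (v : B × Fin 4) :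
    v ∈ f.supp ↔ G.face i v = f := Iff.rfl

@[simp] theorem face_propagator (i : Fin 4) (v : B × Fin 4) :
    G.face i (G.propagator v) = G.face i v := by
  rw [← graph_nbr_zero, face, ColoredGraph.cycle_nbr_left, face]

instance [Finite B] (i : Fin 4) : Finite (G.Face i) :=
  Finite.of_surjective (G.face i) (G.face_surjective i)

theorem two_mul_faceLength [Finite B] {i : Fin 4} (f : G.Face i) :
    2 * G.faceLength f = {v | G.face i v = f}.ncard := by
  refine G.graph.two_mul_ncard_image_edge 0 f.supp fun v hv => ?_
  rwa [mem_supp_iff, graph_nbr_zero, face_propagator]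

theorem sum_faceLength [Finite B] {i : Fin 4} [Fintype (G.Face i)] :
    ∑ f : G.Face i, G.faceLength f = 2 * Nat.card B := by
  classical
  have := Fintype.ofFinite B
  suffices ∑ f : G.Face i, 2 * G.faceLength f = 4 * Nat.card B by
    rw [← Finset.mul_sum] at this
    omega
  calc ∑ f : G.Face i, 2 * G.faceLength f
      = ∑ f : G.Face i, (Finset.univ.filter fun v => G.face i v = f).card :=
        Finset.sum_congr rfl fun f _ => by
          rw [two_mul_faceLength, ← Set.ncard_coe_finset, Finset.coe_filter_univ]
    _ = (Finset.univ : Finset (B × Fin 4)).card :=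
        (Finset.card_eq_sum_card_fiberwise fun v _ => Finset.mem_univ (G.face i v)).symm
    _ = 4 * Nat.card B := by simp [mul_comm]

section Face

variable {i : Fin 4} (hi : i ≠ 0)
include hi

theorem step_eq_stride : G.step i = G.graph.stride 0 i := by
  funext v
  rw [ColoredGraph.stride, graph_nbr_zero, graph_nbr _ hi, step]

@[simp] theorem face_flip (v : B × Fin 4) : G.face i (flip i v) = G.face i v := by
  rw [← graph_nbr _ hi, face, ColoredGraph.cycle_nbr_right, face]

@[simp] theorem face_step (v : B × Fin 4) : G.face i (G.step i v) = G.face i v := by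
  rw [step, face_flip _ hi, face_propagator]

@[simp] theorem face_iterate (m : ℕ) (v : B × Fin 4) :
    G.face i ((G.step i)^[m] v) = G.face i v := by
  rw [step_eq_stride _ hi, face, ColoredGraph.cycle_iterate_stride, face]

variable {G} in
theorem apply_eq_of_face_eq {α : Type*} {f : B × Fin 4 → α}
    (h0 : ∀ v, f (G.propagator v) = f v) (h1 : ∀ v, f (flip i v) = f v) {v w : B × Fin 4}
    (h : G.face i v = G.face i w) : f v = f w :=
  ColoredGraph.apply_eq_of_cycle_eq (fun v => by rw [graph_nbr_zero, h0])
    (fun v => by rw [graph_nbr _ hi, h1]) h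

theorem iterate_ne_propagator (v : B × Fin 4) (l m : ℕ) :
    (G.step i)^[l] v ≠ G.propagator ((G.step i)^[m] v) := by
  rw [step_eq_stride _ hi, ← graph_nbr_zero]
  exact G.graph.iterate_stride_ne_nbr_left_iterate 0 i l m v

theorem iterate_ne_flip (v : B × Fin 4) (l m : ℕ) :
    (G.step i)^[l] v ≠ flip i ((G.step i)^[m] v) := by
  rw [step_eq_stride _ hi, ← graph_nbr _ hi]
  exact G.graph.iterate_stride_ne_nbr_right_iterate 0 i l m v

variable [Finite B]

theorem faceLength_face (v : B × Fin 4) :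
    G.faceLength (G.face i v) = Function.minimalPeriod (G.step i) v := by
  rw [step_eq_stride _ hi]
  exact G.graph.ncard_image_edge_cycle 0 i v

theorem iterate_faceLength (v : B × Fin 4) :
    (G.step i)^[G.faceLength (G.face i v)] v = v := by
  rw [faceLength_face _ hi, Function.iterate_minimalPeriod]

theorem faceLength_pos (f : G.Face i) : 0 < G.faceLength f := by
  obtain ⟨v, rfl⟩ := G.face_surjective i f
  rw [faceLength_face _ hi, step_eq_stride _ hi]
  exact G.graph.minimalPeriod_stride_pos 0 i v

variable {G}

theorem faceLength_le_of_iterate {v : B × Fin 4} {m : ℕ} (hm : 0 < m)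
    (h : (G.step i)^[m] v = v) : G.faceLength (G.face i v) ≤ m := by
  rw [faceLength_face _ hi]
  exact Function.IsPeriodicPt.minimalPeriod_le hm h

theorem iterate_step_injOn {v : B × Fin 4} {l m : ℕ} (hl : l < G.faceLength (G.face i v))
    (hm : m < G.faceLength (G.face i v)) (h : (G.step i)^[l] v = (G.step i)^[m] v) : l = m := by
  rw [faceLength_face _ hi] at hl hm
  exact Function.iterate_injOn_Iio_minimalPeriod hl hm h

theorem exists_iterate_eq_or_eq_propagator {v w : B × Fin 4} (h : G.face i v = G.face i w) :
    ∃ m < G.faceLength (G.face i v),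
      (G.step i)^[m] v = w ∨ (G.step i)^[m] v = G.propagator w := by
  rw [faceLength_face _ hi, step_eq_stride _ hi, ← graph_nbr_zero]
  exact ColoredGraph.exists_iterate_stride_of_cycle_eq h

theorem exists_iterate_eq_or_eq_flip {v w : B × Fin 4} (h : G.face i v = G.face i w) :
    ∃ m < G.faceLength (G.face i v),
      (G.step i)^[m] v = w ∨ (G.step i)^[m] v = flip i w := by
  obtain ⟨m, hm, hw | hw⟩ := exists_iterate_eq_or_eq_propagator hi h
  · exact ⟨m, hm, Or.inl hw⟩
  · have hper := G.iterate_faceLength hi v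
    refine ⟨(m + 1) % G.faceLength (G.face i v), Nat.mod_lt _ (G.faceLength_pos hi _), Or.inr ?_⟩
    rw [Function.IsPeriodicPt.iterate_mod_apply hper, Function.iterate_succ_apply', hw, step,
      propagator_propagator]

theorem exists_iterate_of_mem_facesAt {v : B × Fin 4} {b : B} (h : G.face i v ∈ G.facesAt i b) :
    ∃ m < G.faceLength (G.face i v), ((G.step i)^[m] v).1 = b := by
  obtain ⟨s, hs⟩ := h
  obtain ⟨m, hm, hw | hw⟩ := exists_iterate_eq_or_eq_flip hi hs.symm
  · exact ⟨m, hm, congrArg Prod.fst hw⟩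
  · exact ⟨m, hm, congrArg Prod.fst hw⟩

end Face

section Jacket

variable {i j k : Fin 4} (h : IsColorTriple i j k)
include h

theorem facesAt_eq (v : B × Fin 4) :
    G.facesAt i v.1 = {G.face i v, G.face i (flip j v)} := by
  have face_flip_third : G.face i (flip k v) = G.face i (flip j v) := by
    rw [← flip_comp h, face_flip _ h.ne₁]
  refine Set.Subset.antisymm ?_ ?_
  · rintro _ ⟨s, rfl⟩
    obtain hw | hw | hw | hw := eq_or_eq_flip_of_fst_eq h (v := v) (w := (v.1, s)) rfl <;>
      simp [hw, h.ne₁, face_flip_third]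
  · rintro _ (rfl | rfl)
    · exact G.face_mem_facesAt i v
    · exact G.face_mem_facesAt i (flip j v)

theorem card_bicoloredCycle_eq_card_bubble :
    Nat.card (G.graph.BicoloredCycle j k) = Nat.card B := by
  refine Nat.card_congr
    ⟨Quot.lift Prod.fst ?_, fun b => G.graph.cycle j k (b, 0), ?_, fun b => rfl⟩
  · refine fun v w hvw => ColoredGraph.apply_eq_of_reachable (f := Prod.fst) ?_ hvw
    rintro c (rfl | rfl) v
    · rw [graph_nbr _ h.ne₂, flip_fst]
    · rw [graph_nbr _ h.ne₃, flip_fst]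
  · intro f
    obtain ⟨v, rfl⟩ := f.exists_rep
    have cycle_flip_left : ∀ w, G.graph.cycle j k (flip j w) = G.graph.cycle j k w := fun w => by
      rw [← graph_nbr _ h.ne₂, ColoredGraph.cycle_nbr_left]
    have cycle_flip_right : ∀ w, G.graph.cycle j k (flip k w) = G.graph.cycle j k w := fun w => by
      rw [← graph_nbr _ h.ne₃, ColoredGraph.cycle_nbr_right]
    suffices ∀ w : B × Fin 4, w.1 = v.1 → G.graph.cycle j k w = G.graph.cycle j k v from
      this (v.1, 0) rfl
    intro w hw
    rcases eq_or_eq_flip_of_fst_eq h hw with rfl | rfl | rfl | rfl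
    · rfl
    · rw [← flip_comp h.rotate, cycle_flip_left, cycle_flip_right]
    · rw [cycle_flip_left]
    · rw [cycle_flip_right]

theorem jacket_eulerChar [Finite B] :
    (G.jacket i).eulerChar = (Nat.card (G.Face j) : ℤ) + Nat.card (G.Face k) - Nat.card B := by
  have card_vertices : (Nat.card (B × Fin 4) : ℤ) = 4 * Nat.card B := by simp [mul_comm]
  have card_edges : ∀ c, (((G.jacket i).edges c).ncard : ℤ) = 2 * Nat.card B := by
    intro c
    have := (G.jacket i).two_mul_ncard_edges c
    zify at this
    linarith
  have card_colors : ∀ i : Fin 4, Fintype.card {c : Fin 4 // c ≠ i} = 3 := by decide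
  have card_cycle_deleteColor : ∀ a b, (Nat.card ((G.jacket i).BicoloredCycle a b) : ℤ) =
      Nat.card (G.graph.BicoloredCycle a.1 b.1) := by
    intro a b
    rw [jacket, ColoredGraph.BicoloredCycle, ColoredGraph.deleteColor_restrict]
  have card_cycle_comm : ∀ a b, (Nat.card (G.graph.BicoloredCycle a b) : ℤ) =
      Nat.card (G.graph.BicoloredCycle b a) := by
    intro a b
    rw [ColoredGraph.BicoloredCycle, ColoredGraph.BicoloredCycle, Set.pair_comm]
  rw [ColoredGraph.eulerChar, card_vertices, Finset.sum_congr rfl fun c _ => card_edges c,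
    Finset.sum_const, Finset.card_univ, card_colors i,
    Finset.sum_congr rfl fun p _ => card_cycle_deleteColor p.1 p.2,
    h.sum_jacket_pairs (fun a b => (Nat.card (G.graph.BicoloredCycle a b) : ℤ)) card_cycle_comm,
    G.card_bicoloredCycle_eq_card_bubble h, nsmul_eq_mul]
  push_cast
  ring

theorem jacket_genus [Finite B] :
    (G.jacket i).genus =
      (2 - ((Nat.card (G.Face j) : ℚ) + Nat.card (G.Face k) - Nat.card B)) / 2 := by
  rw [ColoredGraph.genus, jacket_eulerChar G h]
  push_cast
  ring

theorem degree_eq [Finite B] :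
    G.degree = 3 + 3 * (Nat.card B : ℚ) / 2 -
      (Nat.card (G.Face i) + Nat.card (G.Face j) + Nat.card (G.Face k)) := by
  have sum_eq : ∀ f : Fin 4 → ℚ, f 1 + f 2 + f 3 = f i + f j + f k := by
    intro f
    have := h.sum_eq f 0
    simp only [Fin.sum_univ_four, tetrahedron_zero, add_assoc, add_right_inj] at this
    simpa only [add_assoc] using this
  rw [degree, sum_eq fun c => (G.jacket c).genus, jacket_genus G h, jacket_genus G h.rotate,
    jacket_genus G h.rotate.rotate]
  ring

theorem degree_eq_three_halves_iff [Finite B] :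
    G.degree = 3 / 2 ↔ 2 * (Nat.card (G.Face i) + Nat.card (G.Face j) + Nat.card (G.Face k)) =
      3 * Nat.card B + 3 := by
  rw [G.degree_eq h, ← Nat.cast_inj (R := ℚ)]
  push_cast
  constructor <;> intro h <;> linarith

end Jacket

end ONGraph

/-! ### Homology modulo two of a jacket -/

/-- The functions that are invariant under the map `σ`. -/
def invariantFunctions {V : Type*} (σ : V → V) : Submodule (ZMod 2) (V → ZMod 2) where
  carrier := {z | ∀ v, z (σ v) = z v}
  add_mem' hx hy v := by simp [hx v, hy v]
  zero_mem' _ := rfl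
  smul_mem' a x hx v := by simp [hx v]

namespace ONGraph

variable {B : Type*} (G : ONGraph B)

/-- The functions modulo two on the propagators, each seen as a function on the vertices that takes
the same value at the two ends of every propagator. -/
def edgeSpace : Submodule (ZMod 2) (B × Fin 4 → ZMod 2) := invariantFunctions G.propagator

/-- The boundary of a function on the propagators, in the 4-regular graph whose vertices are the
bubbles and whose edges are the propagators. -/
def boundary : (B × Fin 4 → ZMod 2) →ₗ[ZMod 2] (B → ZMod 2) where
  toFun z b := ∑ s, z (b, s)
  map_add' x y := by ext b; simp [Finset.sum_add_distrib]
  map_smul' a x := by ext b; simp [Finset.mul_sum]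

/-- The cycle space of the 4-regular graph whose vertices are the bubbles. -/
def cycleSpace : Submodule (ZMod 2) (B × Fin 4 → ZMod 2) :=
  G.edgeSpace ⊓ LinearMap.ker (boundary (B := B))

/-- The span of the faces of colour `i`. -/
def faceSpace (i : Fin 4) : Submodule (ZMod 2) (B × Fin 4 → ZMod 2) :=
  G.edgeSpace ⊓ invariantFunctions (flip i)

theorem boundary_apply (z : B × Fin 4 → ZMod 2) (b : B) : boundary z b = ∑ s, z (b, s) := rfl

open Classical in
theorem boundary_single (v : B × Fin 4) :
    boundary (Pi.single v 1 : B × Fin 4 → ZMod 2) = Pi.single v.1 1 := by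
  ext b
  simp only [boundary_apply, Pi.single_apply, Prod.ext_iff]
  by_cases hb : b = v.1 <;> simp [hb]

open Classical in
/-- The indicator function of the propagator at `v`. -/
noncomputable def edgeVec (v : B × Fin 4) : B × Fin 4 → ZMod 2 :=
  Pi.single v 1 + Pi.single (G.propagator v) 1

open Classical in
theorem edgeVec_apply (v w : B × Fin 4) :
    G.edgeVec v w = if w = v ∨ w = G.propagator v then 1 else 0 := by
  rw [edgeVec, Pi.add_apply, Pi.single_apply, Pi.single_apply]
  by_cases hv : w = v
  · rw [if_pos hv, if_neg, if_pos (Or.inl hv), add_zero]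
    exact fun h => G.propagator_ne v (h.symm.trans hv)
  · simp only [hv, if_false, false_or, zero_add]

theorem edgeVec_mem (v : B × Fin 4) : G.edgeVec v ∈ G.edgeSpace := by
  intro w
  have h1 : G.propagator w = v ↔ w = G.propagator v := G.propagator_involutive.eq_iff
  have h2 : G.propagator w = G.propagator v ↔ w = v := G.propagator_involutive.injective.eq_iff
  classical
  simp only [edgeVec_apply, h1, h2, or_comm]

open Classical in
theorem boundary_edgeVec (v : B × Fin 4) :
    boundary (G.edgeVec v) = Pi.single v.1 1 + Pi.single (G.propagator v).1 1 := by
  rw [edgeVec, map_add, boundary_single, boundary_single]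

section ColorTriple

variable {i j k : Fin 4} (h : IsColorTriple i j k)
include h

theorem boundary_eq (z : B × Fin 4 → ZMod 2) (v : B × Fin 4) :
    boundary z v.1 = z v + z (flip i v) + z (flip j v) + z (flip k v) :=
  h.sum_eq (fun s => z (v.1, s)) v.2

theorem boundary_eq_zero_of_flip {z : B × Fin 4 → ZMod 2} {b : B}
    (hz : ∀ s, z (flip i (b, s)) = z (b, s)) : boundary z b = 0 := by
  have hz0 := hz 0
  have hzj := hz (tetrahedron j 0)
  rw [show (b, tetrahedron j 0) = flip j (b, 0) from rfl, flip_comp h] at hzj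
  rw [boundary_eq h z (b, 0), hz0, hzj, add_assoc, ZModModule.add_self, ZModModule.add_self,
    zero_add]

end ColorTriple

theorem faceSpace_le_cycleSpace {i : Fin 4} (hi : i ≠ 0) : G.faceSpace i ≤ G.cycleSpace := by
  obtain ⟨j, k, h⟩ := exists_isColorTriple i hi
  rintro z ⟨hprop, hflip⟩
  refine ⟨hprop, funext fun b => ?_⟩
  exact boundary_eq_zero_of_flip h fun s => hflip _

theorem sup_faceSpace_le {i j k : Fin 4} (h : IsColorTriple i j k) :
    G.faceSpace j ⊔ G.faceSpace k ≤ G.cycleSpace :=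
  sup_le (G.faceSpace_le_cycleSpace h.ne₂) (G.faceSpace_le_cycleSpace h.ne₃)

/-- The functions on the faces of colour `i`, seen as functions on the vertices. -/
def faceSpaceEquiv {i : Fin 4} (hi : i ≠ 0) :
    (G.Face i → ZMod 2) ≃ₗ[ZMod 2] G.faceSpace i where
  toFun x := ⟨fun v => x (G.face i v), fun v => by simp, fun v => by simp [hi]⟩
  map_add' _ _ := rfl
  map_smul' _ _ := rfl
  invFun z := Quot.lift z.1 fun _ _ h => apply_eq_of_face_eq hi z.2.1 z.2.2 (Quot.sound h)
  left_inv x := by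
    ext f
    obtain ⟨v, rfl⟩ := G.face_surjective i f
    rfl
  right_inv _ := rfl

theorem finrank_faceSpace [Finite B] {i : Fin 4} (hi : i ≠ 0) :
    Module.finrank (ZMod 2) (G.faceSpace i) = Nat.card (G.Face i) := by
  have := Fintype.ofFinite (G.Face i)
  rw [← (G.faceSpaceEquiv hi).finrank_eq, Module.finrank_pi, Nat.card_eq_fintype_card]

theorem finrank_edgeSpace_le [Finite B] :
    Module.finrank (ZMod 2) G.edgeSpace ≤ 2 * Nat.card B := by
  let E := G.graph.edges 0
  have := Fintype.ofFinite B
  have := Fintype.ofFinite E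
  have card_E : Nat.card E = 2 * Nat.card B := by
    have := G.graph.two_mul_ncard_edges 0
    rw [Nat.card_prod, Nat.card_eq_fintype_card (α := Fin 4), Fintype.card_fin] at this
    rw [Nat.card_coe_set_eq E]
    simp only [E]
    omega
  let pullback : (E → ZMod 2) →ₗ[ZMod 2] (B × Fin 4 → ZMod 2) :=
    LinearMap.funLeft _ _ fun v => (⟨s(v, G.graph.nbr 0 v), v, rfl⟩ : E)
  have edgeSpace_le : G.edgeSpace ≤ LinearMap.range pullback := by
    intro z hz
    refine ⟨fun e => z (Classical.choose e.2), funext fun v => ?_⟩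
    have chosen_end := Classical.choose_spec (⟨v, rfl⟩ : s(v, G.graph.nbr 0 v) ∈ E)
    simp only [pullback, LinearMap.funLeft_apply]
    simp only [graph_nbr_zero] at chosen_end ⊢
    rcases Sym2.eq_iff.1 chosen_end with ⟨hv, -⟩ | ⟨hv, -⟩
    · rw [hv]
    · rw [hv, hz]
  calc _ ≤ _ := Submodule.finrank_mono edgeSpace_le
    _ ≤ _ := LinearMap.finrank_range_le pullback
    _ = _ := by rw [Module.finrank_pi, ← Nat.card_eq_fintype_card, card_E]

section Connected

variable {G} (hG : G.graph.IsConnected)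
include hG

theorem apply_eq_of_connected {α : Type*} {f : B × Fin 4 → α}
    (h0 : ∀ v, f (G.propagator v) = f v) (h1 : ∀ c, c ≠ 0 → ∀ v, f (flip c v) = f v)
    (v w : B × Fin 4) : f v = f w := by
  refine ColoredGraph.apply_eq_of_reachable (S := Set.univ) ?_ (hG.preconnected v w)
  rintro c - v
  by_cases hc : c = 0
  · subst hc; rw [graph_nbr_zero, h0]
  · rw [graph_nbr _ hc, h1 c hc]

theorem forall_of_connected {Q : B → Prop}
    (hQ : ∀ v : B × Fin 4, Q v.1 → Q (G.propagator v).1) {b : B} (hb : Q b) (b' : B) : Q b' := by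
  have Q_iff := apply_eq_of_connected hG (f := fun v => Q v.1)
    (fun v => propext ⟨fun h => by simpa using hQ _ h, hQ v⟩) (fun _ _ _ => rfl) (b, 0) (b', 0)
  exact Q_iff.mp hb

open Classical in
theorem single_mem_map_boundary_sup_span (b₀ b : B) : (Pi.single b 1 : B → ZMod 2) ∈
    G.edgeSpace.map boundary ⊔ Submodule.span (ZMod 2) {Pi.single b₀ 1} := by
  refine forall_of_connected hG (Q := fun b => (Pi.single b 1 : B → ZMod 2) ∈
    G.edgeSpace.map boundary ⊔ Submodule.span (ZMod 2) {Pi.single b₀ 1}) (fun v hv => ?_)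
    (Submodule.mem_sup_right (Submodule.mem_span_singleton_self _)) b
  have edge_mem := Submodule.mem_map_of_mem (f := boundary) (G.edgeVec_mem v)
  have sum_mem := add_mem hv (Submodule.mem_sup_left edge_mem)
  rwa [boundary_edgeVec, ← add_assoc, ZModModule.add_self, zero_add] at sum_mem

variable [Finite B]

theorem finrank_faceSpace_inf {i j k : Fin 4} (h : IsColorTriple i j k) :
    Module.finrank (ZMod 2) (G.faceSpace j ⊓ G.faceSpace k : Submodule _ _) ≤ 1 := by
  obtain ⟨v₀⟩ := hG.nonempty
  rw [finrank_le_one_iff]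
  refine ⟨⟨fun _ => 1, ⟨fun _ => rfl, fun _ => rfl⟩, ⟨fun _ => rfl, fun _ => rfl⟩⟩, ?_⟩
  rintro ⟨z, ⟨h0, hj⟩, ⟨-, hk⟩⟩
  refine ⟨z v₀, Subtype.ext (funext fun v => ?_)⟩
  have z_const : z v₀ = z v := by
    refine apply_eq_of_connected hG h0 (fun c hc v => ?_) _ _
    rcases h.color_cases c with rfl | rfl | rfl | rfl
    · exact absurd rfl hc
    · rw [← flip_comp h.rotate, hj, hk]
    · exact hj v
    · exact hk v
  simp [z_const]

theorem card_le_finrank_map_boundary :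
    Nat.card B ≤ Module.finrank (ZMod 2) (G.edgeSpace.map boundary) + 1 := by
  classical
  have := Fintype.ofFinite B
  obtain ⟨v₀⟩ := hG.nonempty
  have top_le : (⊤ : Submodule (ZMod 2) (B → ZMod 2)) ≤
      G.edgeSpace.map boundary ⊔ Submodule.span _ {Pi.single v₀.1 1} := by
    rw [← (Pi.basisFun (ZMod 2) B).span_eq, Submodule.span_le]
    rintro _ ⟨b, rfl⟩
    rw [Pi.basisFun_apply]
    exact single_mem_map_boundary_sup_span hG v₀.1 b
  calc Nat.card B = Module.finrank (ZMod 2) (⊤ : Submodule (ZMod 2) (B → ZMod 2)) := by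
        rw [finrank_top, Module.finrank_pi, Nat.card_eq_fintype_card]
    _ ≤ _ := Submodule.finrank_mono top_le
    _ ≤ _ := Submodule.finrank_add_le_finrank_add_finrank _ _
    _ ≤ _ := by gcongr; exact (finrank_span_le_card _).trans (by simp)

theorem finrank_cycleSpace_le : Module.finrank (ZMod 2) G.cycleSpace ≤ Nat.card B + 1 := by
  have rank_nullity := LinearMap.finrank_range_add_finrank_ker (boundary.domRestrict G.edgeSpace)
  have ker_eq : Module.finrank (ZMod 2) (LinearMap.ker (boundary.domRestrict G.edgeSpace)) =
      Module.finrank (ZMod 2) G.cycleSpace := by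
    rw [LinearMap.ker_domRestrict, cycleSpace, ← Submodule.map_comap_subtype]
    exact LinearEquiv.finrank_eq
      (Submodule.equivMapOfInjective _ (Submodule.subtype_injective _) _)
  rw [LinearMap.range_domRestrict, ker_eq] at rank_nullity
  have edge_le := G.finrank_edgeSpace_le
  have card_le := card_le_finrank_map_boundary hG
  omega

variable {i j k : Fin 4} (h : IsColorTriple i j k)
include h

theorem card_face_add_le_finrank :
    Nat.card (G.Face j) + Nat.card (G.Face k) ≤
      Module.finrank (ZMod 2) (G.faceSpace j ⊔ G.faceSpace k : Submodule _ _) + 1 := by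
  have sup_inf := Submodule.finrank_sup_add_finrank_inf_eq (G.faceSpace j) (G.faceSpace k)
  have inf_le := finrank_faceSpace_inf hG h
  rw [finrank_faceSpace _ h.ne₂, finrank_faceSpace _ h.ne₃] at sup_inf
  omega

theorem card_face_add_le :
    Nat.card (G.Face j) + Nat.card (G.Face k) ≤ Nat.card B + 2 := by
  have faces_le := card_face_add_le_finrank hG h
  have cycles_le := finrank_cycleSpace_le hG
  have mono := Submodule.finrank_mono (G.sup_faceSpace_le h)
  omega

theorem sup_faceSpace_eq_of_planar
    (hF : Nat.card (G.Face j) + Nat.card (G.Face k) = Nat.card B + 2) :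
    G.faceSpace j ⊔ G.faceSpace k = G.cycleSpace := by
  have faces_le := card_face_add_le_finrank hG h
  have cycles_le := finrank_cycleSpace_le hG
  exact Submodule.eq_of_le_of_finrank_le (G.sup_faceSpace_le h) (by omega)

-- The bounding cycles have codimension at most one, so two cycles that do not bound are homologous.
theorem add_mem_of_projective
    (hF : Nat.card (G.Face j) + Nat.card (G.Face k) = Nat.card B + 1)
    {x y : B × Fin 4 → ZMod 2} (hx : x ∈ G.cycleSpace) (hy : y ∈ G.cycleSpace)
    (hx' : x ∉ G.faceSpace j ⊔ G.faceSpace k) (hy' : y ∉ G.faceSpace j ⊔ G.faceSpace k) :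
    x + y ∈ G.faceSpace j ⊔ G.faceSpace k := by
  have faces_le := card_face_add_le_finrank hG h
  have cycles_le := finrank_cycleSpace_le hG
  set P := G.faceSpace j ⊔ G.faceSpace k
  have lt_sup : P < P ⊔ Submodule.span _ {x} := by
    simpa only [left_lt_sup, Submodule.span_singleton_le_iff_mem] using hx'
  have sup_eq : P ⊔ Submodule.span _ {x} = G.cycleSpace := by
    refine Submodule.eq_of_le_of_finrank_le
      (sup_le (G.sup_faceSpace_le h) ((Submodule.span_singleton_le_iff_mem _ _).2 hx)) ?_
    have := Submodule.finrank_lt_finrank_of_lt lt_sup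
    omega
  rw [← sup_eq] at hy
  obtain ⟨q, hq, r, hr, rfl⟩ := Submodule.mem_sup.1 hy
  obtain ⟨a, rfl⟩ := Submodule.mem_span_singleton.1 hr
  have zero_or_one : ∀ a : ZMod 2, a = 0 ∨ a = 1 := by decide
  rcases zero_or_one a with rfl | rfl
  · exact absurd (by simpa using hq) hy'
  · rw [one_smul, add_left_comm, ZModModule.add_self, add_zero]
    exact hq

end Connected

end ONGraph

/-! ### The intersection form of a jacket -/

namespace ONGraph

variable {B : Type*} (G : ONGraph B)

/-- The crossings modulo two of `y` at each bubble with a curve that separates the two edges of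
colour `k` of the bubble. The definition reads them off at one of these edges; for a cycle `y` the
other one gives the same result. -/
def cross (k : Fin 4) : (B × Fin 4 → ZMod 2) →ₗ[ZMod 2] (B → ZMod 2) where
  toFun y b := y (b, 0) + y (b, k)
  map_add' x y := by ext b; simp only [Pi.add_apply]; ring
  map_smul' a x := by ext b; simp [mul_add]

theorem cross_apply (k : Fin 4) (y : B × Fin 4 → ZMod 2) (b : B) :
    cross k y b = y (b, 0) + y (b, k) := rfl

/-- The intersection form modulo two of the jacket that contains the colours `0, j, k`: the first
cycle is pushed to the side of the faces of colour `j`. -/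
noncomputable def inter (j k : Fin 4) (x y : B × Fin 4 → ZMod 2) : ZMod 2 :=
  ∑ᶠ b, cross j x b * cross k y b

theorem inter_eq_sum [Fintype B] (j k : Fin 4) (x y : B × Fin 4 → ZMod 2) :
    inter j k x y = ∑ b, cross j x b * cross k y b :=
  finsum_eq_sum_of_fintype _

theorem inter_add_left [Finite B] (j k : Fin 4) (x x' y : B × Fin 4 → ZMod 2) :
    inter j k (x + x') y = inter j k x y + inter j k x' y := by
  have := Fintype.ofFinite B
  simp [inter_eq_sum, add_mul, Finset.sum_add_distrib]

theorem sum_mul_eq_zero [Fintype B] {x y : B × Fin 4 → ZMod 2} (hx : x ∈ G.edgeSpace)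
    (hy : y ∈ G.edgeSpace) : ∑ v, x v * y v = 0 := by
  refine Finset.sum_involution (fun v _ => G.propagator v) ?_ ?_ ?_ ?_
  · intro v _
    rw [hx v, hy v, ZModModule.add_self]
  · intro v _ _
    exact G.propagator_ne v
  · simp
  · simp

section ColorTriple

variable {G} {i j k : Fin 4} (h : IsColorTriple i j k)
include h

theorem cross_eq_of_boundary {x : B × Fin 4 → ZMod 2} {v : B × Fin 4}
    (hx : boundary x v.1 = 0) : cross k x v.1 = x v + x (flip k v) := by
  have sum_zero : ∀ a b c d : ZMod 2, a + b + c + d = 0 → a + d = b + c := by decide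
  have pairs_eq := boundary_eq h x (v.1, 0)
  rw [hx] at pairs_eq
  replace pairs_eq := sum_zero _ _ _ _ pairs_eq.symm
  have cross_zero : cross k x v.1 = x (v.1, 0) + x (flip k (v.1, 0)) := by
    rw [cross_apply, flip, tetrahedron_zero]
  rw [cross_zero]
  have same_bubble := eq_or_eq_flip_of_fst_eq h (v := (v.1, 0)) (w := v) rfl
  generalize ((v.1, 0) : B × Fin 4) = w at same_bubble pairs_eq ⊢
  rcases same_bubble with hv | hv | hv | hv
  · rw [hv]
  · rw [pairs_eq, hv, flip_comp h.rotate.rotate]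
  · rw [pairs_eq, hv, flip_comp h.rotate.rotate.swap, add_comm]
  · rw [hv, flip_flip, add_comm]

theorem cross_eq {x : B × Fin 4 → ZMod 2} (hx : x ∈ G.cycleSpace) (v : B × Fin 4) :
    cross k x v.1 = x v + x (flip k v) :=
  cross_eq_of_boundary h (congrFun hx.2 v.1)

theorem cross_eq_zero_of_flip {x : B × Fin 4 → ZMod 2} {b : B}
    (hx : ∀ s, x (flip k (b, s)) = x (b, s)) : cross k x b = 0 := by
  rw [cross_eq_of_boundary h (v := (b, 0)) (boundary_eq_zero_of_flip h.rotate.rotate hx), hx,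
    ZModModule.add_self]

-- At a bubble, the two ways of pushing the curves apart differ by the common propagators.
theorem cross_mul_cross_add {x y : B × Fin 4 → ZMod 2} {b : B} (hx : boundary x b = 0)
    (hy : boundary y b = 0) :
    cross j x b * cross k y b + cross j y b * cross k x b = ∑ s, x (b, s) * y (b, s) := by
  have identity : ∀ x₀ x₁ x₂ x₃ y₀ y₁ y₂ y₃ : ZMod 2,
      x₀ + x₁ + x₂ + x₃ = 0 → y₀ + y₁ + y₂ + y₃ = 0 →
      (x₀ + x₂) * (y₀ + y₃) + (y₀ + y₂) * (x₀ + x₃) =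
        x₀ * y₀ + x₁ * y₁ + x₂ * y₂ + x₃ * y₃ := by decide
  rw [boundary_apply, h.sum_eq _ 0] at hx hy
  rw [h.sum_eq _ 0]
  simp only [tetrahedron_zero] at hx hy ⊢
  exact identity _ _ _ _ _ _ _ _ hx hy

variable [Finite B] {x y : B × Fin 4 → ZMod 2}

theorem inter_comm (hx : x ∈ G.cycleSpace) (hy : y ∈ G.cycleSpace) :
    inter j k x y = inter j k y x := by
  have := Fintype.ofFinite B
  rw [← CharTwo.add_eq_zero, ← G.sum_mul_eq_zero hx.1 hy.1, Fintype.sum_prod_type,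
    inter_eq_sum, inter_eq_sum, ← Finset.sum_add_distrib]
  exact Finset.sum_congr rfl fun b _ =>
    cross_mul_cross_add h (congrFun hx.2 b) (congrFun hy.2 b)

theorem inter_eq_zero_of_mem (hx : x ∈ G.faceSpace j ⊔ G.faceSpace k)
    (hy : y ∈ G.cycleSpace) : inter j k x y = 0 := by
  obtain ⟨u, hu, w, hw, rfl⟩ := Submodule.mem_sup.1 hx
  rw [inter_add_left, inter_comm h (G.faceSpace_le_cycleSpace h.ne₃ hw) hy]
  have inter_left : inter j k u y = 0 := by
    refine finsum_eq_zero_of_forall_eq_zero fun b => ?_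
    rw [cross_eq_zero_of_flip h.swap (fun s => hu.2 _), zero_mul]
  have inter_right : inter j k y w = 0 := by
    refine finsum_eq_zero_of_forall_eq_zero fun b => ?_
    rw [cross_eq_zero_of_flip h (fun s => hw.2 _), mul_zero]
  rw [inter_left, inter_right, add_zero]

variable (hG : G.graph.IsConnected)
include hG

theorem inter_eq_zero_of_planar
    (hF : Nat.card (G.Face j) + Nat.card (G.Face k) = Nat.card B + 2)
    (hx : x ∈ G.cycleSpace) (hy : y ∈ G.cycleSpace) : inter j k x y = 0 :=
  inter_eq_zero_of_mem h (sup_faceSpace_eq_of_planar hG h hF ▸ hx) hy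

variable (hF : Nat.card (G.Face j) + Nat.card (G.Face k) = Nat.card B + 1)
include hF

theorem inter_eq_inter_self_of_projective (hx : x ∈ G.cycleSpace) (hy : y ∈ G.cycleSpace)
    (hx' : x ∉ G.faceSpace j ⊔ G.faceSpace k) (hy' : y ∉ G.faceSpace j ⊔ G.faceSpace k) :
    inter j k x y = inter j k x x := by
  have bounds := inter_eq_zero_of_mem h (add_mem_of_projective hG h hF hx hy hx' hy') hx
  rw [inter_add_left, CharTwo.add_eq_zero] at bounds
  rw [bounds, inter_comm h hx hy]

theorem inter_eq_mul_of_projective (hx : x ∈ G.cycleSpace) (hy : y ∈ G.cycleSpace) :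
    inter j k x y = inter j k x x * inter j k y y := by
  by_cases hx' : x ∈ G.faceSpace j ⊔ G.faceSpace k
  · rw [inter_eq_zero_of_mem h hx' hy, inter_eq_zero_of_mem h hx' hx, zero_mul]
  by_cases hy' : y ∈ G.faceSpace j ⊔ G.faceSpace k
  · rw [inter_comm h hx hy, inter_eq_zero_of_mem h hy' hx, inter_eq_zero_of_mem h hy' hy, mul_zero]
  have mul_self : ∀ a : ZMod 2, a = a * a := by decide
  rw [← inter_eq_inter_self_of_projective h hG hF hy hx hy' hx', inter_comm h hy hx,
    ← inter_eq_inter_self_of_projective h hG hF hx hy hx' hy']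
  exact mul_self _

-- A cycle of odd self-intersection spans the homology, on which the intersection form is faithful.
theorem mem_of_inter_self_eq_zero (hx : x ∈ G.cycleSpace) (hxx : inter j k x x = 1)
    (hy : y ∈ G.cycleSpace) (hyy : inter j k y y = 0) : y ∈ G.faceSpace j ⊔ G.faceSpace k := by
  by_contra hy'
  have hx' : x ∉ G.faceSpace j ⊔ G.faceSpace k := fun hx' =>
    zero_ne_one ((inter_eq_zero_of_mem h hx' hx).symm.trans hxx)
  refine one_ne_zero (α := ZMod 2) ?_
  rw [← hxx, ← hyy, ← inter_eq_inter_self_of_projective h hG hF hx hy hx' hy',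
    inter_comm h hx hy, inter_eq_inter_self_of_projective h hG hF hy hx hy' hx']

end ColorTriple

/-- The sum of the first `m` propagators of the face of colour `i` that starts at `v`. -/
noncomputable def arc (i : Fin 4) (v : B × Fin 4) (m : ℕ) : B × Fin 4 → ZMod 2 :=
  ∑ l ∈ Finset.range m, G.edgeVec ((G.step i)^[l] v)

theorem arc_succ (i : Fin 4) (v : B × Fin 4) (m : ℕ) :
    G.arc i v (m + 1) = G.arc i v m + G.edgeVec ((G.step i)^[m] v) :=
  Finset.sum_range_succ _ _

theorem arc_mem (i : Fin 4) (v : B × Fin 4) (m : ℕ) : G.arc i v m ∈ G.edgeSpace :=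
  sum_mem fun _ _ => G.edgeVec_mem _

open Classical in
theorem boundary_arc (i : Fin 4) (v : B × Fin 4) (m : ℕ) :
    boundary (G.arc i v m) = Pi.single v.1 1 + Pi.single ((G.step i)^[m] v).1 1 := by
  induction m with
  | zero =>
    rw [arc, Finset.sum_range_zero, map_zero]
    exact (ZModModule.add_self _).symm
  | succ m ih =>
    rw [arc_succ, map_add, ih, boundary_edgeVec, Function.iterate_succ_apply', step_fst,
      ZModModule.add_add_add_cancel]

theorem arc_add_arc_mem {i : Fin 4} {a b : B × Fin 4} {m l : ℕ}
    (hab : (a.1 = b.1 ∧ ((G.step i)^[m] a).1 = ((G.step i)^[l] b).1) ∨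
      (a.1 = ((G.step i)^[l] b).1 ∧ b.1 = ((G.step i)^[m] a).1)) :
    G.arc i a m + G.arc i b l ∈ G.cycleSpace := by
  classical
  refine ⟨add_mem (G.arc_mem i a m) (G.arc_mem i b l), LinearMap.mem_ker.2 ?_⟩
  rw [map_add, boundary_arc, boundary_arc]
  rcases hab with ⟨hstart, hend⟩ | ⟨hstart, hend⟩
  · rw [hstart, hend, ZModModule.add_self]
  · rw [hstart, hend, add_comm (Pi.single ((G.step i)^[m] a).1 1), ZModModule.add_self]

open Classical in
/-- The crossings with `y` at the end `v` of a propagator, in the intersection form of the jacket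
that contains the colours `0, j, k`. -/
noncomputable def halfCross (j k : Fin 4) (y : B × Fin 4 → ZMod 2) (v : B × Fin 4) : ZMod 2 :=
  if v.2 = 0 ∨ v.2 = j then cross k y v.1 else 0

theorem halfCross_eq_zero {j k : Fin 4} {y : B × Fin 4 → ZMod 2} {v : B × Fin 4}
    (h : cross k y v.1 = 0) : halfCross j k y v = 0 := by
  rw [halfCross, h, ite_self]

theorem halfCross_flip {i j k : Fin 4} (h : IsColorTriple i j k) (y : B × Fin 4 → ZMod 2)
    (v : B × Fin 4) : halfCross j k y (flip i v) = halfCross j k y v + cross k y v.1 := by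
  have other_pair : ∀ {i j k : Fin 4}, IsColorTriple i j k → ∀ s : Fin 4,
      (tetrahedron i s = 0 ∨ tetrahedron i s = j) ↔ ¬ (s = 0 ∨ s = j) := by decide
  simp only [halfCross, flip, other_pair h]
  by_cases hs : v.2 = 0 ∨ v.2 = j
  · rw [if_neg (not_not_intro hs), if_pos hs, ZModModule.add_self]
  · rw [if_pos hs, if_neg hs, zero_add]

/-- Every cycle that crosses `d` evenly crosses every cycle evenly. This is so for `d = 0` on the
sphere, and on the projective plane for a cycle `d` of odd self-intersection. -/
def ControlsIntersection (j k : Fin 4) (d : B × Fin 4 → ZMod 2) : Prop :=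
  ∀ x ∈ G.cycleSpace, inter j k x d = 0 → ∀ y ∈ G.cycleSpace, inter j k x y = 0

open Classical in
theorem inter_single {j : Fin 4} (hj : j ≠ 0) (k : Fin 4) (y : B × Fin 4 → ZMod 2)
    (v : B × Fin 4) : inter j k (Pi.single v 1) y = halfCross j k y v := by
  obtain ⟨b, s⟩ := v
  have cross_single : ∀ b', cross j (Pi.single (b, s) 1 : B × Fin 4 → ZMod 2) b' =
      if b' = b then if s = 0 ∨ s = j then 1 else 0 else 0 := by
    intro b'
    simp only [cross_apply, Pi.single_apply, Prod.mk.injEq]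
    by_cases hb : b' = b <;> by_cases h0 : s = 0 <;> by_cases h1 : s = j <;>
      simp_all [eq_comm]
  rw [inter, finsum_eq_single _ b fun b' hb => by simp [cross_single, hb]]
  simp [cross_single, halfCross]

theorem inter_edgeVec [Finite B] {j : Fin 4} (hj : j ≠ 0) (k : Fin 4) (y : B × Fin 4 → ZMod 2)
    (v : B × Fin 4) :
    inter j k (G.edgeVec v) y = halfCross j k y v + halfCross j k y (G.propagator v) := by
  rw [edgeVec, inter_add_left, inter_single hj, inter_single hj]

section ColorTriple

variable [Finite B] {i j k : Fin 4} (h : IsColorTriple i j k)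
include h

theorem inter_arc (y : B × Fin 4 → ZMod 2) (v : B × Fin 4) (m : ℕ) :
    inter j k (G.arc i v m) y = halfCross j k y v + halfCross j k y ((G.step i)^[m] v) +
      ∑ l ∈ Finset.range m, cross k y ((G.step i)^[l + 1] v).1 := by
  induction m with
  | zero => simp [arc, inter, ZModModule.add_self]
  | succ m ih =>
    rw [arc_succ, inter_add_left, ih, inter_edgeVec _ h.ne₂, Finset.sum_range_succ,
      Function.iterate_succ_apply']
    set w := (G.step i)^[m] v
    rw [← flip_step G i w, halfCross_flip h]
    linear_combination ZModModule.add_self (halfCross j k y w)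

theorem inter_arc_of_cross_eq_zero {y : B × Fin 4 → ZMod 2} {v : B × Fin 4} {m : ℕ}
    (hstart : cross k y v.1 = 0) (hend : cross k y ((G.step i)^[m] v).1 = 0) :
    inter j k (G.arc i v m) y = ∑ l ∈ Finset.range m, cross k y ((G.step i)^[l + 1] v).1 := by
  rw [inter_arc _ h, halfCross_eq_zero hstart, halfCross_eq_zero hend, add_zero, zero_add]

variable {G} in
-- The two arcs form a cycle whose intersection with `y` is the sum of the crossings.
theorem sum_cross_eq_zero {d : B × Fin 4 → ZMod 2} (H : G.ControlsIntersection j k d)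
    {a b : B × Fin 4} {m l : ℕ}
    (hab : (a.1 = b.1 ∧ ((G.step i)^[m] a).1 = ((G.step i)^[l] b).1) ∨
      (a.1 = ((G.step i)^[l] b).1 ∧ b.1 = ((G.step i)^[m] a).1))
    (hda : ∀ t ≤ m, cross k d ((G.step i)^[t] a).1 = 0)
    (hdb : ∀ t ≤ l, cross k d ((G.step i)^[t] b).1 = 0)
    {y : B × Fin 4 → ZMod 2} (hy : y ∈ G.cycleSpace)
    (hya : cross k y a.1 = 0) (hya' : cross k y ((G.step i)^[m] a).1 = 0) :
    ∑ t ∈ Finset.range m, cross k y ((G.step i)^[t + 1] a).1 +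
      ∑ t ∈ Finset.range l, cross k y ((G.step i)^[t + 1] b).1 = 0 := by
  have hyb : cross k y b.1 = 0 ∧ cross k y ((G.step i)^[l] b).1 = 0 := by
    rcases hab with ⟨hstart, hend⟩ | ⟨hstart, hend⟩
    · rw [← hstart, ← hend]; exact ⟨hya, hya'⟩
    · rw [← hstart, hend]; exact ⟨hya', hya⟩
  have inter_d : inter j k (G.arc i a m + G.arc i b l) d = 0 := by
    rw [inter_add_left, inter_arc_of_cross_eq_zero _ h (v := a) (hda 0 m.zero_le) (hda m le_rfl),
      inter_arc_of_cross_eq_zero _ h (v := b) (hdb 0 l.zero_le) (hdb l le_rfl),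
      Finset.sum_eq_zero fun t ht => hda _ (Finset.mem_range.1 ht),
      Finset.sum_eq_zero fun t ht => hdb _ (Finset.mem_range.1 ht), add_zero]
  have inter_y := H _ (G.arc_add_arc_mem hab) inter_d y hy
  rwa [inter_add_left, inter_arc_of_cross_eq_zero _ h hya hya',
    inter_arc_of_cross_eq_zero _ h hyb.1 hyb.2] at inter_y

end ColorTriple

open Classical in
/-- The indicator function of a face. -/
noncomputable def faceVec {i : Fin 4} (f : G.Face i) (v : B × Fin 4) : ZMod 2 :=
  if G.face i v = f then 1 else 0

theorem faceVec_mem {i : Fin 4} (hi : i ≠ 0) (f : G.Face i) : G.faceVec f ∈ G.faceSpace i :=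
  ⟨fun v => by rw [faceVec, faceVec, face_propagator],
    fun v => by rw [faceVec, faceVec, face_flip _ hi]⟩

theorem faceVec_mem_cycleSpace {i : Fin 4} (hi : i ≠ 0) (f : G.Face i) :
    G.faceVec f ∈ G.cycleSpace :=
  G.faceSpace_le_cycleSpace hi (G.faceVec_mem hi f)

open Classical in
theorem edgeVec_iterate_apply_iterate [Finite B] {i : Fin 4} (hi : i ≠ 0) {v : B × Fin 4}
    {l m : ℕ} (hl : l < G.faceLength (G.face i v)) (hm : m < G.faceLength (G.face i v)) :
    G.edgeVec ((G.step i)^[l] v) ((G.step i)^[m] v) = if l = m then 1 else 0 := by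
  rw [edgeVec_apply]
  refine if_congr ⟨?_, fun h => Or.inl (by rw [h])⟩ rfl rfl
  rintro (h | h)
  · exact (iterate_step_injOn hi hm hl h).symm
  · exact absurd h (G.iterate_ne_propagator hi v m l)

open Classical in
theorem faceVec_face [Finite B] {i : Fin 4} (hi : i ≠ 0) (v : B × Fin 4) :
    G.faceVec (G.face i v) = G.arc i v (G.faceLength (G.face i v)) := by
  ext w
  rw [arc, Finset.sum_apply]
  by_cases hw : G.face i w = G.face i v
  · obtain ⟨m, hm, hmw⟩ := exists_iterate_eq_or_eq_propagator hi hw.symm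
    have edgeVec_eq : ∀ x, G.edgeVec x w = G.edgeVec x ((G.step i)^[m] v) := by
      intro x
      rcases hmw with h | h <;> rw [h]
      exact (G.edgeVec_mem x w).symm
    rw [faceVec, if_pos hw, Finset.sum_congr rfl fun l hl => (edgeVec_eq _).trans
      (G.edgeVec_iterate_apply_iterate hi (Finset.mem_range.1 hl) hm), Finset.sum_ite_eq',
      if_pos (Finset.mem_range.2 hm)]
  · rw [faceVec, if_neg hw, Finset.sum_eq_zero]
    intro l _
    rw [edgeVec_apply, if_neg]
    rintro (rfl | rfl) <;> exact hw (by simp [hi])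

section ColorTriple

variable {i j k : Fin 4} (h : IsColorTriple i j k)
include h

theorem cross_faceVec (f : G.Face i) (v : B × Fin 4) :
    cross k (G.faceVec f) v.1 = G.faceVec f v + G.faceVec f (flip j v) := by
  rw [cross_eq h (G.faceVec_mem_cycleSpace h.ne₁ f), ← flip_comp h,
    (G.faceVec_mem h.ne₁ f).2]

theorem cross_faceVec_swap (f : G.Face i) (b : B) :
    cross j (G.faceVec f) b = cross k (G.faceVec f) b := by
  rw [G.cross_faceVec h f (b, 0), cross_eq h.swap (G.faceVec_mem_cycleSpace h.ne₁ f) (b, 0)]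

variable {G} in
theorem cross_faceVec_eq_zero {f : G.Face i} {b : B} (hf : f ∉ G.facesAt i b) :
    cross k (G.faceVec f) b = 0 := by
  rw [show b = ((b, 0) : B × Fin 4).1 from rfl, G.facesAt_eq h, Set.mem_insert_iff,
    Set.mem_singleton_iff, not_or] at hf
  rw [G.cross_faceVec h f (b, 0), faceVec, faceVec, if_neg (Ne.symm hf.1), if_neg (Ne.symm hf.2),
    add_zero]

variable {G} in
theorem cross_faceVec_eq_one {f : G.Face i} {v : B × Fin 4} (h1 : G.face i v ≠ f)
    (h2 : G.face i (flip j v) = f) : cross k (G.faceVec f) v.1 = 1 := by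
  rw [G.cross_faceVec h]
  simp [faceVec, h1, h2]

section Finite

variable [Finite B]

theorem inter_faceVec_face (v : B × Fin 4) (y : B × Fin 4 → ZMod 2) :
    inter j k (G.faceVec (G.face i v)) y =
      ∑ l ∈ Finset.range (G.faceLength (G.face i v)), cross k y ((G.step i)^[l] v).1 := by
  have hper := G.iterate_faceLength h.ne₁ v
  rw [faceVec_face _ h.ne₁, inter_arc _ h]
  set ℓ := G.faceLength (G.face i v)
  have sum_shift := Finset.sum_range_succ' (fun l => cross k y ((G.step i)^[l] v).1) ℓ
  rw [Finset.sum_range_succ, hper] at sum_shift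
  rw [hper, ZModModule.add_self, zero_add]
  exact (add_right_cancel sum_shift).symm

end Finite

open Classical in
theorem faceLength_eq_sum [Fintype B] (f : G.Face i) :
    G.faceLength f = ∑ b : B, ((if G.face i (b, 0) = f then 1 else 0) +
      (if G.face i (flip j (b, 0)) = f then 1 else 0)) := by
  apply mul_left_cancel₀ two_ne_zero
  rw [two_mul_faceLength, Set.ncard_eq_toFinset_card', Set.toFinset_ofPred, Finset.card_filter,
    Fintype.sum_prod_type, Finset.mul_sum]
  refine Finset.sum_congr rfl fun b _ => ?_
  rw [h.sum_eq _ 0]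
  have face_left : G.face i (b, tetrahedron i 0) = G.face i (b, 0) :=
    G.face_flip h.ne₁ (b, 0)
  have face_right : G.face i (b, tetrahedron k 0) = G.face i (flip j (b, 0)) := by
    rw [← G.face_flip h.ne₁ (flip j (b, 0)), flip_comp h, flip]
  rw [face_left, face_right, flip]
  ring

variable [Finite B]

theorem inter_self_faceVec (f : G.Face i) :
    inter j k (G.faceVec f) (G.faceVec f) = G.faceLength f := by
  classical
  have mul_self : ∀ a : ZMod 2, a * a = a := by decide
  have := Fintype.ofFinite B
  rw [G.faceLength_eq_sum h, inter_eq_sum, Nat.cast_sum]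
  refine Finset.sum_congr rfl fun b _ => ?_
  rw [G.cross_faceVec_swap h, mul_self, G.cross_faceVec h f (b, 0)]
  push_cast
  rfl

theorem faceLength_odd_iff (f : G.Face i) :
    Odd (G.faceLength f) ↔ inter j k (G.faceVec f) (G.faceVec f) = 1 := by
  rw [inter_self_faceVec _ h, ZMod.natCast_eq_one_iff_odd]

theorem faceLength_even_iff (f : G.Face i) :
    Even (G.faceLength f) ↔ inter j k (G.faceVec f) (G.faceVec f) = 0 := by
  rw [inter_self_faceVec _ h, ZMod.natCast_eq_zero_iff_even]

end ColorTriple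

end ONGraph

/-! ### Edge cuts and simplicity -/

namespace ONGraph

variable {B : Type*} {G : ONGraph B}

theorem IsTwoPI.forall_of_cut (hG : G.IsTwoPI) {v₁ v₂ : B × Fin 4} (hne : v₁ ≠ v₂)
    (hne' : v₁ ≠ G.propagator v₂) {Q : B → Prop}
    (hQ : ∀ v, v ≠ v₁ → v ≠ G.propagator v₁ → v ≠ v₂ → v ≠ G.propagator v₂ → Q v.1 →
      Q (G.propagator v).1) {b : B} (hb : Q b) (b' : B) : Q b' := by
  have edge_mem : ∀ v, s(v, G.propagator v) ∈ G.graph.edges 0 := fun v =>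
    ⟨v, by simp only [graph_nbr_zero]⟩
  have edges_ne : s(v₁, G.propagator v₁) ≠ s(v₂, G.propagator v₂) := by
    rw [Ne, Sym2.eq_iff]
    rintro (⟨he, -⟩ | ⟨he, -⟩)
    exacts [hne he, hne' he]
  have walk_preserves : ∀ {v w : B × Fin 4}, (G.graph.remove 0 {s(v₁, G.propagator v₁),
      s(v₂, G.propagator v₂)}).Walk v w → Q v.1 → Q w.1 := by
    intro v w p
    induction p with
    | nil => exact id
    | @cons v w _ hadj _ ih =>
      intro hv
      apply ih
      obtain ⟨c, rfl, hc⟩ := hadj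
      by_cases h0 : c = 0
      · subst h0
        simp only [graph_nbr_zero, true_and, Set.mem_insert_iff, Set.mem_singleton_iff,
          Sym2.eq_iff] at hc ⊢
        refine hQ v ?_ ?_ ?_ ?_ hv
        all_goals rintro rfl; simp at hc
      · rw [graph_nbr _ h0]; exact hv
  obtain ⟨p⟩ := (hG _ (edge_mem v₁) _ (edge_mem v₂) edges_ne).preconnected (b, 0) (b', 0)
  exact walk_preserves p hb

theorem exists_eq_flip_of_fst_eq {v w : B × Fin 4} (hne : w ≠ v) (hvw : w.1 = v.1) :
    ∃ c, c ≠ 0 ∧ w = flip c v := by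
  have h : IsColorTriple 1 2 3 := by decide
  rcases eq_or_eq_flip_of_fst_eq h hvw with hw | hw | hw | hw
  exacts [absurd hw hne, ⟨1, h.ne₁, hw⟩, ⟨2, h.ne₂, hw⟩, ⟨3, h.ne₃, hw⟩]

theorem IsTwoPI.eq_of_loop (hG : G.IsTwoPI) (hc : G.graph.IsConnected) {v : B × Fin 4}
    (hv : (G.propagator v).1 = v.1) (b : B) : b = v.1 := by
  obtain ⟨a, ha, hav⟩ := exists_eq_flip_of_fst_eq (G.propagator_ne v) hv
  obtain ⟨j, k, h⟩ := exists_isColorTriple a ha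
  have hav' : G.propagator (flip a v) = v := by rw [← hav, propagator_propagator]
  by_cases hjk : flip j v = G.propagator (flip k v)
  · have hkj : G.propagator (flip j v) = flip k v := by rw [hjk, propagator_propagator]
    refine forall_of_connected hc (Q := fun b => b = v.1) (fun w hw => ?_) rfl b
    rcases eq_or_eq_flip_of_fst_eq h hw with rfl | rfl | rfl | rfl
    · rw [hav, flip_fst]
    · rw [hav']
    · rw [hkj, flip_fst]
    · rw [← hjk, flip_fst]
  · refine hG.forall_of_cut (flip_ne_flip h.rotate v) hjk (Q := fun b => b = v.1)
      (fun w hj _ hk _ hw => ?_) rfl b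
    rcases eq_or_eq_flip_of_fst_eq h hw with rfl | rfl | rfl | rfl
    · rw [hav, flip_fst]
    · rw [hav']
    · exact absurd rfl hj
    · exact absurd rfl hk

namespace IsTwoPIDipoleFreeOfDegreeThreeHalves

variable [Finite B] (hG : G.IsTwoPIDipoleFreeOfDegreeThreeHalves)
include hG

theorem propagator_fst_ne (v : B × Fin 4) : (G.propagator v).1 ≠ v.1 := by
  intro hv
  obtain ⟨hc, h2, -, hd⟩ := hG
  have card_eq_one : Nat.card B = 1 :=
    Nat.card_eq_one_iff_exists.2 ⟨v.1, h2.eq_of_loop hc hv⟩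
  obtain ⟨a, ha, hav⟩ := exists_eq_flip_of_fst_eq (G.propagator_ne v) hv
  obtain ⟨j, k, h⟩ := exists_isColorTriple a ha
  have card_face_pos : ∀ c, 0 < Nat.card (G.Face c) := fun c =>
    have : Nonempty (G.Face c) := ⟨G.face c v⟩
    Nat.card_pos
  rw [degree_eq_three_halves_iff _ h, card_eq_one] at hd
  have card_face_eq_one : Nat.card (G.Face a) = 1 := by
    have := card_face_pos a
    have := card_face_pos j
    have := card_face_pos k
    omega
  have := Fintype.ofFinite (G.Face a)
  have length_eq_two := G.sum_faceLength (i := a)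
  have := (Nat.card_eq_one_iff_unique.1 card_face_eq_one).1
  rw [Fintype.sum_subsingleton _ (G.face a v), card_eq_one] at length_eq_two
  have length_le_one : G.faceLength (G.face a v) ≤ 1 :=
    faceLength_le_of_iterate ha one_pos (by simp [step, hav])
  omega

theorem three_le_faceLength {i : Fin 4} (hi : i ≠ 0) (f : G.Face i) : 3 ≤ G.faceLength f := by
  obtain ⟨v, rfl⟩ := G.face_surjective i f
  have length_pos := G.faceLength_pos hi (G.face i v)
  have closed := G.iterate_faceLength hi v
  by_contra hlt
  obtain h1 | h2 : G.faceLength (G.face i v) = 1 ∨ G.faceLength (G.face i v) = 2 := by omega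
  · rw [h1] at closed
    have loop : (G.step i v).1 = v.1 := congrArg Prod.fst closed
    exact hG.propagator_fst_ne v loop
  · exact hG.2.2.1 ⟨i, hi, _, h2, v, rfl, G.propagator v, G.face_propagator i v,
      (hG.propagator_fst_ne v).symm⟩

end IsTwoPIDipoleFreeOfDegreeThreeHalves

/-- Two bubbles are joined by at most one propagator, and there are no loops. -/
def IsSimple (G : ONGraph B) : Prop :=
  (∀ v, (G.propagator v).1 ≠ v.1) ∧
    ∀ v w, v.1 = w.1 → (G.propagator v).1 = (G.propagator w).1 → v = w

/-- In the jacket that contains the colours `0, j, k`, every cycle of even self-intersection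
bounds. This is so for the sphere and for the projective plane. -/
def EvenCyclesBound (G : ONGraph B) (j k : Fin 4) : Prop :=
  ∀ x ∈ G.cycleSpace, inter j k x x = 0 → x ∈ G.faceSpace j ⊔ G.faceSpace k

theorem EvenCyclesBound.swap {j k : Fin 4} (h : G.EvenCyclesBound j k) :
    G.EvenCyclesBound k j := by
  intro x hx hxx
  rw [sup_comm]
  refine h x hx ?_
  rw [← hxx]
  exact finsum_congr fun b => mul_comm _ _

theorem mem_cycleSpace_of_flip {x : B × Fin 4 → ZMod 2} (hx : x ∈ G.edgeSpace)
    (hflip : ∀ b, ∃ c, c ≠ 0 ∧ ∀ s, x (flip c (b, s)) = x (b, s)) : x ∈ G.cycleSpace := by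
  refine ⟨hx, LinearMap.mem_ker.2 (funext fun b => ?_)⟩
  obtain ⟨c, hc, hb⟩ := hflip b
  obtain ⟨j, k, h⟩ := exists_isColorTriple c hc
  exact boundary_eq_zero_of_flip h hb

section ColorTriple

variable {i j k : Fin 4} (h : IsColorTriple i j k)
include h

theorem apply_eq_apply_zero_of_flip {α : Type*} {x : B × Fin 4 → α} {b : B}
    (hj : ∀ s, x (flip j (b, s)) = x (b, s)) (hk : ∀ s, x (flip k (b, s)) = x (b, s))
    (s : Fin 4) : x (b, s) = x (b, 0) := by
  rcases eq_or_eq_flip_of_fst_eq h (v := (b, 0)) (w := (b, s)) rfl with hs | hs | hs | hs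
  · rw [hs]
  · rw [hs, ← flip_comp h.rotate]
    exact (hj _).trans (hk 0)
  · rw [hs, hj]
  · rw [hs, hk]

-- Writing the bounding cycle as `u + w`, with `u` constant around the faces of colour `j` and `w`
-- around those of colour `k`, the function `q` is `w` on the bubbles in `P` and `u` on the others.
theorem exists_forall_add_eq_of_turning {P : B → Prop} [DecidablePred P]
    {x : B × Fin 4 → ZMod 2} (hx : x ∈ G.faceSpace j ⊔ G.faceSpace k)
    (hj : ∀ b, P b → ∀ s, x (flip j (b, s)) = x (b, s))
    (hk : ∀ b, ¬P b → ∀ s, x (flip k (b, s)) = x (b, s)) :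
    ∃ q : B → ZMod 2, ∀ v,
      q v.1 + q (G.propagator v).1 = if P v.1 ↔ P (G.propagator v).1 then 0 else x v := by
  obtain ⟨u, hu, w, hw, rfl⟩ := Submodule.mem_sup.1 hx
  have w_eq : ∀ v : B × Fin 4, P v.1 → w v = w (v.1, 0) := fun v hv =>
    apply_eq_apply_zero_of_flip h
      (fun s => add_left_cancel (a := u (v.1, s)) (by simpa [hu.2 _] using hj v.1 hv s))
      (fun s => hw.2 _) v.2
  have u_eq : ∀ v : B × Fin 4, ¬P v.1 → u v = u (v.1, 0) := fun v hv =>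
    apply_eq_apply_zero_of_flip h (fun s => hu.2 _)
      (fun s => add_right_cancel (b := w (v.1, s)) (by simpa [hw.2 _] using hk v.1 hv s)) v.2
  let q : B → ZMod 2 := fun b => if P b then w (b, 0) else u (b, 0)
  have q_eq : ∀ v : B × Fin 4, q v.1 = if P v.1 then w v else u v := by
    intro v
    by_cases hv : P v.1
    · simp only [q, if_pos hv, w_eq v hv]
    · simp only [q, if_neg hv, u_eq v hv]
  refine ⟨q, fun v => ?_⟩
  rw [q_eq, q_eq, hu.1, hw.1, Pi.add_apply]
  by_cases hv : P v.1 <;> by_cases hv' : P (G.propagator v).1 <;>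
    simp [hv, hv', ZModModule.add_self, add_comm]

-- Otherwise the two propagators of the cycle at the bubble of `v` form a cut.
theorem IsTwoPI.eq_zero_of_turning (hG : G.IsTwoPI) {x : B × Fin 4 → ZMod 2} {v : B × Fin 4}
    (hx : x ∈ G.faceSpace j ⊔ G.faceSpace k)
    (hj : ∀ s, x (flip j (v.1, s)) = x (v.1, s))
    (hk : ∀ b, b ≠ v.1 → ∀ s, x (flip k (b, s)) = x (b, s))
    (hkv : x (flip k v) = 0) (hv : (G.propagator v).1 ≠ v.1) : x v = 0 := by
  classical
  obtain ⟨q, hq⟩ := exists_forall_add_eq_of_turning h (P := (· = v.1)) hx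
    (fun b hb => hb ▸ hj) hk
  have x_propagator : ∀ w, x (G.propagator w) = x w := (G.sup_faceSpace_le h hx).1
  have support : ∀ w : B × Fin 4, w.1 = v.1 → w ≠ v → w ≠ flip j v → x w = 0 := by
    intro w hw hne hne'
    rcases eq_or_eq_flip_of_fst_eq h hw with rfl | rfl | rfl | rfl
    · exact absurd rfl hne
    · rw [← flip_comp h.rotate]
      exact (hj _).trans hkv
    · exact absurd rfl hne'
    · exact hkv
  have q_const : ∀ b, q b = q v.1 := by
    refine hG.forall_of_cut (flip_ne h.ne₂ v).symm (fun he => hv ?_) ?_ rfl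
    · conv_lhs => rw [he, propagator_propagator, flip_fst]
    intro w h1 h2 h3 h4 hw
    rw [← hw, eq_comm, ← CharTwo.add_eq_zero, hq]
    split_ifs with hends
    · rfl
    by_cases hwv : w.1 = v.1
    · exact support w hwv h1 h3
    · rw [← x_propagator]
      refine support _ (by tauto) (fun he => h2 ?_) (fun he => h4 ?_) <;>
        rw [← he, propagator_propagator]
  have := hq v
  rwa [q_const (G.propagator v).1, ZModModule.add_self, if_neg (by tauto), eq_comm] at this

end ColorTriple

/-- The ends of the first `m + 1` propagators of the face of colour `k` that starts at `a`. -/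
def stretch (G : ONGraph B) (k : Fin 4) (a : B × Fin 4) (m : ℕ) : Set (B × Fin 4) :=
  {v | ∃ l ≤ m, v = (G.step k)^[l] a ∨ v = G.propagator ((G.step k)^[l] a)}

section Stretch

variable {k : Fin 4} {a : B × Fin 4} {m : ℕ}

theorem propagator_mem_stretch {v : B × Fin 4} (hv : v ∈ G.stretch k a m) :
    G.propagator v ∈ G.stretch k a m := by
  obtain ⟨l, hl, rfl | rfl⟩ := hv
  · exact ⟨l, hl, Or.inr rfl⟩
  · exact ⟨l, hl, Or.inl (propagator_propagator _ _)⟩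

variable {c : Fin 4} (hm : G.step c ((G.step k)^[m] a) = a)
include hm

theorem flip_mem_stretch_of_fst_ne {v : B × Fin 4} (hv : v ∈ G.stretch k a m) (hva : v.1 ≠ a.1) :
    flip k v ∈ G.stretch k a m := by
  obtain ⟨l, hl, rfl | rfl⟩ := hv
  · rcases l with - | l
    · exact absurd rfl hva
    · rw [Function.iterate_succ_apply', flip_step]
      exact ⟨l, Nat.le_of_succ_le hl, Or.inr rfl⟩
  · rcases hl.eq_or_lt with rfl | hlt
    · rw [← G.flip_step c, hm] at hva
      exact absurd rfl hva
    · exact ⟨l + 1, hlt, Or.inl (Function.iterate_succ_apply' (G.step k) l a).symm⟩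

theorem mem_stretch_iff_of_fst_eq (hne : ∀ l, 0 < l → l ≤ m → ((G.step k)^[l] a).1 ≠ a.1)
    {v : B × Fin 4} (hva : v.1 = a.1) : v ∈ G.stretch k a m ↔ v = a ∨ v = flip c a := by
  have flip_a : flip c a = G.propagator ((G.step k)^[m] a) := by rw [← flip_step, hm]
  constructor
  · rintro ⟨l, hl, rfl | rfl⟩
    · rcases l.eq_zero_or_pos with rfl | hl0
      · exact Or.inl rfl
      · exact absurd hva (hne l hl0 hl)
    · rcases hl.eq_or_lt with rfl | hlt
      · exact Or.inr flip_a.symm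
      · refine absurd ?_ (hne (l + 1) l.succ_pos hlt)
        rwa [Function.iterate_succ_apply', step_fst]
  · rintro (rfl | rfl)
    exacts [⟨0, m.zero_le, Or.inl rfl⟩, ⟨m, le_rfl, Or.inr flip_a⟩]

-- The cycle follows the face of colour `k` from `a` and is closed by an edge of colour `c`.
theorem exists_cycle_of_step_iterate_eq
    (hne : ∀ l, 0 < l → l ≤ m → ((G.step k)^[l] a).1 ≠ a.1) :
    ∃ x ∈ G.edgeSpace, (∀ s, x (flip c (a.1, s)) = x (a.1, s)) ∧
      (∀ b, b ≠ a.1 → ∀ s, x (flip k (b, s)) = x (b, s)) ∧ x a = 1 ∧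
      ∀ v, v.1 = a.1 → v ≠ a → v ≠ flip c a → x v = 0 := by
  classical
  have mem_iff {v : B × Fin 4} (hva : v.1 = a.1) := mem_stretch_iff_of_fst_eq hm hne hva
  have indicator_congr : ∀ {v w : B × Fin 4}, (v ∈ G.stretch k a m ↔ w ∈ G.stretch k a m) →
      (G.stretch k a m).indicator (1 : B × Fin 4 → ZMod 2) v =
        (G.stretch k a m).indicator 1 w := by
    intro v w hvw
    simp only [Set.indicator_apply, hvw, Pi.one_apply]
  refine ⟨(G.stretch k a m).indicator 1, fun v => indicator_congr ?_,
    fun s => indicator_congr ?_, fun b hb s => indicator_congr ?_,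
    Set.indicator_of_mem ((mem_iff rfl).2 (Or.inl rfl)) _,
    fun v hva h1 h2 => Set.indicator_of_notMem (fun hv => ?_) _⟩
  · exact ⟨fun hv => by simpa using propagator_mem_stretch hv, propagator_mem_stretch⟩
  · have flip_involutive : Function.Involutive (flip (B := B) c) := flip_flip c
    rw [mem_iff (v := flip c (a.1, s)) rfl, mem_iff (v := (a.1, s)) rfl, flip_involutive.eq_iff,
      flip_involutive.injective.eq_iff, or_comm]
  · exact ⟨fun hv => by simpa using flip_mem_stretch_of_fst_ne hm hv hb,
      fun hv => flip_mem_stretch_of_fst_ne hm hv hb⟩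
  · exact ((mem_iff hva).1 hv).elim h1 h2

end Stretch

section ColorTriple

variable {i j k : Fin 4} (h : IsColorTriple i j k)
include h

theorem IsTwoPI.step_step_iterate_ne (hG : G.IsTwoPI) (hb : G.EvenCyclesBound j k)
    {a : B × Fin 4} {m : ℕ} (hne : ∀ l, 0 < l → l ≤ m → ((G.step k)^[l] a).1 ≠ a.1)
    (ha : (G.propagator a).1 ≠ a.1) : G.step j ((G.step k)^[m] a) ≠ a := by
  classical
  intro hm
  obtain ⟨x, hx, hj, hk, hxa, hx0⟩ := exists_cycle_of_step_iterate_eq hm hne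
  have x_mem : x ∈ G.cycleSpace := mem_cycleSpace_of_flip hx fun b =>
    if hba : b = a.1 then ⟨j, h.ne₂, hba ▸ hj⟩ else ⟨k, h.ne₃, hk b hba⟩
  have self_inter : inter j k x x = 0 := by
    refine finsum_eq_zero_of_forall_eq_zero fun b => ?_
    by_cases hba : b = a.1
    · rw [hba, cross_eq_zero_of_flip h.swap hj, zero_mul]
    · rw [cross_eq_zero_of_flip h (hk b hba), mul_zero]
  have xa_eq_zero := hG.eq_zero_of_turning h (hb x x_mem self_inter) hj hk
    (hx0 (flip k a) rfl (flip_ne h.ne₃ a) (flip_ne_flip h.rotate a).symm) ha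
  exact zero_ne_one (xa_eq_zero.symm.trans hxa)

theorem step_step_iterate_ne_of_planar [Finite B] (hG : G.graph.IsConnected)
    (hF : Nat.card (G.Face j) + Nat.card (G.Face k) = Nat.card B + 2)
    {a : B × Fin 4} {m : ℕ} (hne : ∀ l, 0 < l → l ≤ m → ((G.step k)^[l] a).1 ≠ a.1) :
    G.step i ((G.step k)^[m] a) ≠ a := by
  classical
  intro hm
  obtain ⟨x, hx, hi, hk, hxa, hx0⟩ := exists_cycle_of_step_iterate_eq hm hne
  have x_mem : x ∈ G.cycleSpace := mem_cycleSpace_of_flip hx fun b =>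
    if hba : b = a.1 then ⟨i, h.ne₁, hba ▸ hi⟩ else ⟨k, h.ne₃, hk b hba⟩
  have self_inter : inter j k x x = 1 := by
    rw [inter, finsum_eq_single _ a.1 fun b hba => by
      rw [cross_eq_zero_of_flip h (hk b hba), mul_zero]]
    rw [cross_eq h x_mem, cross_eq h.swap x_mem, hxa,
      hx0 (flip k a) rfl (flip_ne h.ne₃ a) (flip_ne_flip h.swap a).symm,
      hx0 (flip j a) rfl (flip_ne h.ne₂ a) (flip_ne_flip h a).symm, add_zero, mul_one]
  rw [inter_eq_zero_of_planar h hG hF x_mem x_mem] at self_inter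
  exact zero_ne_one self_inter

end ColorTriple

section Simple

variable [Finite B] (hG : G.IsTwoPIDipoleFreeOfDegreeThreeHalves)
include hG

namespace IsTwoPIDipoleFreeOfDegreeThreeHalves

theorem isSimple_of_step_step_ne
    (H : ∀ i j k, IsColorTriple i j k → ∀ v, G.step j (G.step k v) ≠ v) : G.IsSimple := by
  refine ⟨hG.propagator_fst_ne, fun v w hvw hpvw => ?_⟩
  by_contra hne
  obtain ⟨a, ha, rfl⟩ := exists_eq_flip_of_fst_eq (Ne.symm hne) hvw.symm
  obtain ⟨a', ha', hpa⟩ := exists_eq_flip_of_fst_eq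
    (fun he => hne (G.propagator_involutive.injective he.symm)) hpvw.symm
  have closed : G.step a (G.step a' v) = v := by
    rw [step, step, ← hpa, propagator_propagator, flip_flip]
  by_cases haa : a = a'
  · subst haa
    have length_le := faceLength_le_of_iterate ha (m := 2) two_pos closed
    have length_ge := hG.three_le_faceLength ha (G.face a v)
    omega
  · have exists_third : ∀ a a' : Fin 4, a ≠ 0 → a' ≠ 0 → a ≠ a' → ∃ i, IsColorTriple i a a' := by
      decide
    obtain ⟨i, h⟩ := exists_third a a' ha ha' haa
    exact H i a a' h v closed

theorem step_step_ne {i j k : Fin 4} (h : IsColorTriple i j k) (hb : G.EvenCyclesBound j k)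
    (v : B × Fin 4) : G.step j (G.step k v) ≠ v :=
  hG.2.1.step_step_iterate_ne h hb (m := 1)
    (fun l _ _ => by
      obtain rfl : l = 1 := by omega
      exact hG.propagator_fst_ne v)
    (hG.propagator_fst_ne v)

theorem step_step_ne_of_planar {i j k : Fin 4} (h : IsColorTriple i j k)
    (hF : Nat.card (G.Face j) + Nat.card (G.Face k) = Nat.card B + 2) (v : B × Fin 4) :
    G.step i (G.step k v) ≠ v :=
  step_step_iterate_ne_of_planar h hG.1 hF (m := 1) fun l _ _ => by
    obtain rfl : l = 1 := by omega
    exact hG.propagator_fst_ne v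

theorem isSimple_of_evenCyclesBound
    (hb : ∀ i j k, IsColorTriple i j k → G.EvenCyclesBound j k) : G.IsSimple :=
  hG.isSimple_of_step_step_ne fun i j k h => hG.step_step_ne h (hb i j k h)

theorem isSimple_of_planar {i j k : Fin 4} (h : IsColorTriple i j k)
    (hF : Nat.card (G.Face j) + Nat.card (G.Face k) = Nat.card B + 2) : G.IsSimple := by
  have bound : G.EvenCyclesBound j k := fun x hx _ => sup_faceSpace_eq_of_planar hG.1 h hF ▸ hx
  have hF' : Nat.card (G.Face k) + Nat.card (G.Face j) = Nat.card B + 2 := by omega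
  have reverse : ∀ {c c' : Fin 4}, (∀ v, G.step c (G.step c' v) ≠ v) →
      ∀ v, G.step c' (G.step c v) ≠ v := fun {c c'} hne v he =>
    hne (G.step c v) (congrArg (G.step c) he)
  have pairs : ∀ {i j k : Fin 4}, IsColorTriple i j k → ∀ a c c', IsColorTriple a c c' →
      (c = j ∧ c' = k) ∨ (c = k ∧ c' = j) ∨ (c = i ∧ c' = k) ∨ (c = i ∧ c' = j) ∨
      (c = j ∧ c' = i) ∨ (c = k ∧ c' = i) := by decide
  refine hG.isSimple_of_step_step_ne fun a c c' ht => ?_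
  rcases pairs h a c c' ht with
    ⟨rfl, rfl⟩ | ⟨rfl, rfl⟩ | ⟨rfl, rfl⟩ | ⟨rfl, rfl⟩ | ⟨rfl, rfl⟩ | ⟨rfl, rfl⟩
  · exact hG.step_step_ne h bound
  · exact hG.step_step_ne h.swap bound.swap
  · exact hG.step_step_ne_of_planar h hF
  · exact hG.step_step_ne_of_planar h.swap hF'
  · exact reverse (hG.step_step_ne_of_planar h.swap hF')
  · exact reverse (hG.step_step_ne_of_planar h hF)

end IsTwoPIDipoleFreeOfDegreeThreeHalves

end Simple

theorem IsSimple.step_fst_ne (hs : G.IsSimple) (i : Fin 4) (v : B × Fin 4) :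
    (G.step i v).1 ≠ v.1 := hs.1 v

theorem IsSimple.step_step_fst_ne (hs : G.IsSimple) {i : Fin 4} (hi : i ≠ 0) (v : B × Fin 4) :
    (G.step i (G.step i v)).1 ≠ v.1 := by
  intro he
  refine flip_ne hi (G.step i v) (hs.2 _ _ rfl ?_)
  rw [propagator_flip_step, ← he, step_fst]

theorem IsSimple.iterate_fst_ne (hs : G.IsSimple) {i : Fin 4} (hi : i ≠ 0) (v : B × Fin 4)
    {l : ℕ} (hl : 0 < l) (hl2 : l ≤ 2) : ((G.step i)^[l] v).1 ≠ v.1 := by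
  obtain rfl | rfl : l = 1 ∨ l = 2 := by omega
  · exact hs.step_fst_ne i v
  · exact hs.step_step_fst_ne hi v

theorem IsTwoPI.step_iterate_three_eq (hG : G.IsTwoPI) (hs : G.IsSimple)
    {i j k : Fin 4} (h : IsColorTriple i j k) (hb : G.EvenCyclesBound j k) {a g : B × Fin 4}
    (hg : g.1 = (G.propagator a).1) (hpg : (G.propagator g).1 = (G.propagator (flip j a)).1)
    (h1 : G.face i g ≠ G.face i a) (h2 : G.face i g ≠ G.face i (flip j a)) :
    (G.step j)^[3] a = a := by
  have turn : ∀ {u w : B × Fin 4}, u.1 = w.1 → G.face i u ≠ G.face i w →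
      u = flip j w ∨ u = flip k w := by
    intro u w huw hne
    rcases eq_or_eq_flip_of_fst_eq h huw with rfl | rfl | hu | hu
    · exact absurd rfl hne
    · exact absurd (G.face_flip h.ne₁ w) hne
    · exact Or.inl hu
    · exact Or.inr hu
  have closed : ∀ c', G.propagator g = flip c' (G.propagator (flip j a)) →
      G.step j (G.step c' g) = a := by
    intro c' hc'
    rw [step, step, hc', flip_flip, propagator_propagator, flip_flip]
  rcases turn hg (by rwa [face_propagator]) with rfl | rfl <;>
    rcases turn hpg (by rwa [face_propagator, face_propagator]) with hc | hc
  · exact closed j hc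
  · refine absurd ?_ (hG.step_step_iterate_ne h.swap hb.swap
      (a := G.step k (G.step j a)) (m := 2) (fun l => hs.iterate_fst_ne h.ne₂ _) (hs.1 _))
    exact congrArg (fun v => G.step k (G.step j v)) (closed k hc)
  · refine absurd ?_ (hG.step_step_iterate_ne h.swap hb.swap
      (a := G.step k a) (m := 2) (fun l => hs.iterate_fst_ne h.ne₂ _) (hs.1 _))
    exact congrArg (G.step k) (closed j hc)
  · exact absurd (closed k hc) (hG.step_step_iterate_ne h hb (m := 2)
      (fun l => hs.iterate_fst_ne h.ne₃ _) (hs.1 _))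

end ONGraph

namespace ONGraph

variable {B : Type*} {G : ONGraph B}

theorem mem_of_facesAt_subset (hG : G.graph.IsConnected) {i : Fin 4} {S : Set (G.Face i)}
    (hS : ∀ v, G.face i v ∈ S → G.facesAt i v.1 ⊆ S) {f : G.Face i} (hf : f ∈ S) (g : G.Face i) :
    g ∈ S := by
  obtain ⟨v, rfl⟩ := G.face_surjective i f
  obtain ⟨w, rfl⟩ := G.face_surjective i g
  refine forall_of_connected hG (Q := fun b => G.facesAt i b ⊆ S) (fun u hu => ?_) (hS v hf) w.1
    (G.face_mem_facesAt i w)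
  refine hS _ ?_
  rw [face_propagator]
  exact hu (G.face_mem_facesAt i u)

namespace IsSimple

variable (hs : G.IsSimple) {i j k : Fin 4}
include hs

theorem iterate_iterate_fst_ne (hi : i ≠ 0) (v : B × Fin 4) {l m : ℕ} (hlm : l < m)
    (hml : m ≤ l + 2) : ((G.step i)^[m] v).1 ≠ ((G.step i)^[l] v).1 := by
  rw [← Nat.sub_add_cancel hlm.le, Function.iterate_add_apply]
  exact hs.iterate_fst_ne hi _ (by omega) (by omega)

variable [Finite B] (h : IsColorTriple i j k) {v : B × Fin 4}
include h

theorem exists_iterate_of_face_flip_eq (hv : G.face i (flip j v) = G.face i v) :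
    ∃ m, 3 ≤ m ∧ m + 3 ≤ G.faceLength (G.face i v) ∧ ((G.step i)^[m] v).1 = v.1 := by
  obtain ⟨m, hm, hmv⟩ := exists_iterate_eq_or_eq_flip h.ne₁ hv.symm
  have hfst : ((G.step i)^[m] v).1 = v.1 := by rcases hmv with hmv | hmv <;> rw [hmv] <;> rfl
  have hper := G.iterate_faceLength h.ne₁ v
  have zero_ne : m ≠ 0 := by
    rintro rfl
    rcases hmv with hmv | hmv
    · exact flip_ne h.ne₂ v hmv.symm
    · rw [flip_comp h] at hmv
      exact flip_ne h.ne₃ v hmv.symm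
  refine ⟨m, ?_, ?_, hfst⟩
  · by_contra! hlt
    exact hs.iterate_fst_ne h.ne₁ v (by omega) (by omega) hfst
  · by_contra! hlt
    refine hs.iterate_iterate_fst_ne h.ne₁ v hm (by omega) ?_
    rw [hper, hfst]

theorem face_flip_ne (hv : G.faceLength (G.face i v) ≤ 5) :
    G.face i (flip j v) ≠ G.face i v := by
  intro he
  obtain ⟨m, hm, hm', -⟩ := hs.exists_iterate_of_face_flip_eq h he
  omega

end IsSimple

/-- The face of colour `i` through `flip j v` has length four and crosses the face of colour `i`
through `v` at the two consecutive bubbles `v.1` and `(G.step i v).1`. -/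
structure IsSquareCrossing (G : ONGraph B) (i j : Fin 4) (v : B × Fin 4) : Prop where
  face_flip_step : G.face i (flip j (G.step i v)) = G.face i (flip j v)
  length_eq : G.faceLength (G.face i (flip j v)) = 4
  face_ne : G.face i (flip j v) ≠ G.face i v

namespace IsSquareCrossing

variable {i j k : Fin 4} {v : B × Fin 4} (hv : G.IsSquareCrossing i j v)
include hv

section Finite

variable (h : IsColorTriple i j k)
include h

theorem facesAt_eq : G.facesAt i v.1 = {G.face i v, G.face i (flip j v)} ∧
    G.facesAt i (G.step i v).1 = {G.face i v, G.face i (flip j v)} := by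
  rw [G.facesAt_eq h v, G.facesAt_eq h (G.step i v), face_step _ h.ne₁, hv.face_flip_step]
  exact ⟨rfl, rfl⟩

variable [Finite B]

theorem iterate_four : (G.step i)^[4] (flip j v) = flip j v := by
  have hper := G.iterate_faceLength h.ne₁ (flip j v)
  rwa [hv.length_eq] at hper

variable (hs : G.IsSimple)
include hs

theorem opposite : ((G.step i)^[2] (flip j v)).1 = (G.step i v).1 := by
  have hmem : G.face i (flip j v) ∈ G.facesAt i (G.step i v).1 :=
    hv.face_flip_step ▸ G.face_mem_facesAt i (flip j (G.step i v))
  obtain ⟨m, hm, hfst⟩ := exists_iterate_of_mem_facesAt h.ne₁ hmem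
  rw [hv.length_eq] at hm
  interval_cases m
  · exact absurd hfst.symm (hs.step_fst_ne i v)
  · exact absurd (hs.2 (flip j v) v rfl hfst) (flip_ne h.ne₂ v)
  · exact hfst
  · have hper : (G.step i ((G.step i)^[3] (flip j v))).1 = v.1 :=
      (congrArg Prod.fst (hv.iterate_four h) :)
    have flip_eq : (G.step i)^[3] (flip j v) = flip i (G.step i v) :=
      hs.2 _ _ hfst (by rwa [propagator_flip_step])
    refine absurd ?_ hv.face_ne
    rw [← G.face_iterate h.ne₁ 3, flip_eq, face_flip _ h.ne₁, face_step _ h.ne₁]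

theorem iterate_fst_ne {m : ℕ} (hm : m = 1 ∨ m = 3) :
    ((G.step i)^[m] (flip j v)).1 ≠ v.1 ∧
      ((G.step i)^[m] (flip j v)).1 ≠ (G.step i v).1 := by
  have hper := congrArg Prod.fst (hv.iterate_four h)
  rw [← hv.opposite h hs]
  rcases hm with rfl | rfl
  · exact ⟨hs.step_fst_ne i _,
      (hs.iterate_iterate_fst_ne h.ne₁ _ one_lt_two (by omega)).symm⟩
  · refine ⟨fun he => hs.iterate_iterate_fst_ne h.ne₁ (flip j v) (l := 3) (m := 4) (by omega)
      (by omega) (hper.trans he.symm), hs.iterate_iterate_fst_ne h.ne₁ _ (by omega) (by omega)⟩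

end Finite

end IsSquareCrossing

section Finite

variable [Finite B] {i j k : Fin 4}

theorem mem_facesAt_of_square (h : IsColorTriple i j k) {d : B × Fin 4 → ZMod 2}
    (H : G.ControlsIntersection j k d) {a b : B × Fin 4}
    (hab : (a.1 = b.1 ∧ (G.step i a).1 = ((G.step i)^[2] b).1) ∨
      (a.1 = ((G.step i)^[2] b).1 ∧ b.1 = (G.step i a).1))
    (ha : cross k d a.1 = 0) (ha' : cross k d (G.step i a).1 = 0)
    (hb : cross k d (G.step i b).1 = 0) (hne : G.face i (flip j (G.step i b)) ≠ G.face i b) :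
    G.face i (flip j (G.step i b)) ∈ G.facesAt i a.1 ∪ G.facesAt i (G.step i a).1 := by
  set g := G.face i (flip j (G.step i b))
  by_contra hmem
  rw [Set.mem_union, not_or] at hmem
  have zero_at_ends : ∀ {x : B × Fin 4 → ZMod 2}, cross k x a.1 = 0 →
      cross k x (G.step i a).1 = 0 → cross k x b.1 = 0 ∧ cross k x ((G.step i)^[2] b).1 = 0 := by
    intro x hx hx'
    rcases hab with ⟨hstart, hend⟩ | ⟨hstart, hend⟩
    · rw [← hstart, ← hend]; exact ⟨hx, hx'⟩
    · rw [← hstart, hend]; exact ⟨hx', hx⟩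
  have hga := cross_faceVec_eq_zero h hmem.1
  have hga' := cross_faceVec_eq_zero h hmem.2
  have hgb : cross k (G.faceVec g) (G.step i b).1 = 1 :=
    cross_faceVec_eq_one h (by rw [face_step _ h.ne₁]; exact hne.symm) rfl
  have sum_zero := sum_cross_eq_zero h H (m := 1) (l := 2) hab
    (fun t ht => by interval_cases t <;> assumption)
    (fun t ht => by
      interval_cases t
      exacts [(zero_at_ends ha ha').1, hb, (zero_at_ends ha ha').2])
    (G.faceVec_mem_cycleSpace h.ne₁ g) hga hga'
  rw [Finset.sum_range_one, Finset.sum_range_succ, Finset.sum_range_one] at sum_zero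
  refine one_ne_zero (α := ZMod 2) ?_
  calc (1 : ZMod 2)
      = cross k (G.faceVec g) (G.step i a).1 + (cross k (G.faceVec g) (G.step i b).1 +
          cross k (G.faceVec g) ((G.step i)^[2] b).1) := by
        rw [hga', hgb, (zero_at_ends hga hga').2, zero_add, add_zero]
    _ = 0 := sum_zero

theorem IsSquareCrossing.face_flip_iterate {v : B × Fin 4} (hv : G.IsSquareCrossing i j v)
    (hs : G.IsSimple) (h : IsColorTriple i j k) {d : B × Fin 4 → ZMod 2}
    (H : G.ControlsIntersection j k d) (hd : cross k d v.1 = 0)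
    (hd' : cross k d (G.step i v).1 = 0) {m : ℕ} (hm : m = 1 ∨ m = 3)
    (hdm : cross k d ((G.step i)^[m] (flip j v)).1 = 0) :
    G.face i (flip j ((G.step i)^[m] (flip j v))) = G.face i v := by
  have face_ne : G.face i (flip j ((G.step i)^[m] (flip j v))) ≠ G.face i (flip j v) := by
    have := hs.face_flip_ne h (v := (G.step i)^[m] (flip j v))
    rw [face_iterate _ h.ne₁, hv.length_eq] at this
    exact this (by omega)
  have opposite := hv.opposite h hs
  suffices G.face i (flip j ((G.step i)^[m] (flip j v))) ∈
      G.facesAt i v.1 ∪ G.facesAt i (G.step i v).1 by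
    rw [(hv.facesAt_eq h).1, (hv.facesAt_eq h).2, Set.union_self] at this
    exact this.resolve_right face_ne
  rcases hm with rfl | rfl
  · exact mem_facesAt_of_square h H (b := flip j v) (Or.inl ⟨rfl, opposite.symm⟩) hd hd' hdm face_ne
  · refine mem_facesAt_of_square h H (b := (G.step i)^[2] (flip j v))
      (Or.inr ⟨?_, opposite⟩) hd hd' hdm (by rw [face_iterate _ h.ne₁]; exact face_ne)
    rw [← Function.iterate_add_apply, hv.iterate_four h, flip_fst]

open Classical in
theorem even_card_of_inter_eq_zero (h : IsColorTriple i j k)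
    (hinter : ∀ f g : G.Face i, inter j k (G.faceVec f) (G.faceVec g) = 0)
    (hself : ∀ v, G.face i (flip j v) ≠ G.face i v) : Even (Nat.card B) := by
  have := Fintype.ofFinite B
  have := Fintype.ofFinite (G.Face i)
  set faces : B → Sym2 (G.Face i) := fun b => s(G.face i (b, 0), G.face i (flip j (b, 0)))
  rw [Nat.card_eq_fintype_card, ← Finset.card_univ,
    Finset.card_eq_sum_card_fiberwise (f := faces) (t := Finset.univ) (by simp)]
  refine Finset.even_sum _ fun e _ => ?_
  induction e with | _ f g
  rcases eq_or_ne f g with rfl | hfg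
  · rw [Finset.filter_false_of_mem]
    · exact Even.zero
    · intro b _ hb
      rcases Sym2.eq_iff.1 hb with ⟨h1, h2⟩ | ⟨h1, h2⟩ <;> exact hself (b, 0) (h2.trans h1.symm)
  · rw [← ZMod.natCast_eq_zero_iff_even, ← hinter f g, Finset.card_filter, Nat.cast_sum,
      inter_eq_sum]
    refine Finset.sum_congr rfl fun b _ => ?_
    rw [G.cross_faceVec_swap h, G.cross_faceVec h f (b, 0), G.cross_faceVec h g (b, 0)]
    have hb := hself (b, 0)
    simp only [faces, faceVec, Sym2.eq_iff, Nat.cast_ite, Nat.cast_one, Nat.cast_zero]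
    grind

end Finite

end ONGraph

/-! ### Exclusion of the sphere -/

namespace ONGraph

variable {B : Type*} [Finite B] {G : ONGraph B}

theorem sum_faceLength_sub {i : Fin 4} [Fintype (G.Face i)] {n : ℕ}
    (hn : ∀ f : G.Face i, n ≤ G.faceLength f) :
    ∑ f : G.Face i, (G.faceLength f - n) + n * Nat.card (G.Face i) = 2 * Nat.card B := by
  rw [← G.sum_faceLength (i := i), Nat.card_eq_fintype_card, mul_comm, ← smul_eq_mul,
    ← Finset.card_univ, ← Finset.sum_const, ← Finset.sum_add_distrib]
  exact Finset.sum_congr rfl fun f _ => Nat.sub_add_cancel (hn f)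

theorem controlsIntersection_zero_of_planar (hG : G.graph.IsConnected) {i j k : Fin 4}
    (h : IsColorTriple i j k) (hF : Nat.card (G.Face j) + Nat.card (G.Face k) = Nat.card B + 2) :
    G.ControlsIntersection j k 0 :=
  fun _ hx _ _ hy => inter_eq_zero_of_planar h hG hF hx hy

namespace IsTwoPIDipoleFreeOfDegreeThreeHalves

variable (hG : G.IsTwoPIDipoleFreeOfDegreeThreeHalves)
include hG

theorem three_mul_card_face_le {i : Fin 4} (hi : i ≠ 0) :
    3 * Nat.card (G.Face i) ≤ 2 * Nat.card B := by
  have := Fintype.ofFinite (G.Face i)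
  rw [← sum_faceLength_sub fun f => hG.three_le_faceLength hi f]
  exact Nat.le_add_left _ _

variable {i j k : Fin 4} (h : IsColorTriple i j k)
  (hF : Nat.card (G.Face j) + Nat.card (G.Face k) = Nat.card B + 2)
include h hF

theorem even_faceLength_of_planar (f : G.Face i) : Even (G.faceLength f) := by
  have hf := G.faceVec_mem_cycleSpace h.ne₁ f
  exact (G.faceLength_even_iff h f).2 (inter_eq_zero_of_planar h hG.1 hF hf hf)

theorem four_le_faceLength_of_planar (f : G.Face i) : 4 ≤ G.faceLength f := by
  obtain ⟨r, hr⟩ := hG.even_faceLength_of_planar h hF f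
  have := hG.three_le_faceLength h.ne₁ f
  omega

theorem sum_faceLength_sub_four_of_planar [Fintype (G.Face i)] :
    ∑ f : G.Face i, (G.faceLength f - 4) = 2 := by
  have total := sum_faceLength_sub (hG.four_le_faceLength_of_planar h hF)
  have hdeg := (G.degree_eq_three_halves_iff h).1 hG.2.2.2
  omega

theorem faceLength_of_planar (f : G.Face i) : G.faceLength f = 4 ∨ G.faceLength f = 6 := by
  have := Fintype.ofFinite (G.Face i)
  have le_total := Finset.single_le_sum (f := fun f : G.Face i => G.faceLength f - 4)
    (fun _ _ => Nat.zero_le _) (Finset.mem_univ f)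
  rw [hG.sum_faceLength_sub_four_of_planar h hF] at le_total
  have := hG.four_le_faceLength_of_planar h hF f
  obtain ⟨r, hr⟩ := hG.even_faceLength_of_planar h hF f
  omega

theorem eq_of_faceLength_eq_six_of_planar {f g : G.Face i} (hf : G.faceLength f = 6)
    (hg : G.faceLength g = 6) : f = g := by
  classical
  have := Fintype.ofFinite (G.Face i)
  by_contra hfg
  have le_total := Finset.sum_le_sum_of_subset (f := fun f : G.Face i => G.faceLength f - 4)
    (Finset.subset_univ {f, g})
  rw [Finset.sum_pair hfg, hf, hg, hG.sum_faceLength_sub_four_of_planar h hF] at le_total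
  omega

theorem exists_face_flip_eq_of_planar : ∃ v, G.face i (flip j v) = G.face i v := by
  by_contra! hne
  have hdeg := (G.degree_eq_three_halves_iff h).1 hG.2.2.2
  obtain ⟨r, hr⟩ := even_card_of_inter_eq_zero h (fun f g => inter_eq_zero_of_planar h hG.1 hF
    (G.faceVec_mem_cycleSpace h.ne₁ f) (G.faceVec_mem_cycleSpace h.ne₁ g)) hne
  omega

variable {v : B × Fin 4} (hv : G.face i (flip j v) = G.face i v)
include hv

theorem faceLength_eq_six_of_planar :
    G.faceLength (G.face i v) = 6 ∧ ((G.step i)^[3] v).1 = v.1 := by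
  obtain ⟨m, hm, hm', hfst⟩ :=
    (hG.isSimple_of_planar h hF).exists_iterate_of_face_flip_eq h hv
  have hlen := (hG.faceLength_of_planar h hF (G.face i v)).resolve_left (by omega)
  obtain rfl : m = 3 := by omega
  exact ⟨hlen, hfst⟩

theorem face_flip_iterate_ne_of_planar {m : ℕ} (hm : m = 1 ∨ m = 2) :
    G.face i (flip j ((G.step i)^[m] v)) ≠ G.face i v := by
  intro he
  have hs := hG.isSimple_of_planar h hF
  obtain ⟨hlen, hfst⟩ := hG.faceLength_eq_six_of_planar h hF hv
  have hper := G.iterate_faceLength h.ne₁ v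
  rw [hlen] at hper
  have hfst' := (hG.faceLength_eq_six_of_planar h hF (v := (G.step i)^[m] v)
    (by rw [he, face_iterate _ h.ne₁])).2
  rcases hm with rfl | rfl
  · have eq_start : (G.step i)^[3] v = v := hs.2 _ _ hfst hfst'
    exact absurd (iterate_step_injOn h.ne₁ (l := 3) (m := 0) (by omega) (by omega) eq_start)
      (by omega)
  · have hend : (G.step i ((G.step i)^[5] v)).1 = v.1 := (congrArg Prod.fst hper :)
    have eq_second : (G.step i)^[5] v = (G.step i)^[2] v := hs.2 _ _ hfst' (hend.trans hfst.symm)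
    exact absurd (iterate_step_injOn h.ne₁ (by omega) (by omega) eq_second) (by omega)

-- The six steps of the face make two loops of three steps, which every face crosses evenly.
theorem isSquareCrossing_of_planar : G.IsSquareCrossing i j (G.step i v) := by
  have hne := hG.face_flip_iterate_ne_of_planar h hF hv (Or.inl rfl)
  obtain ⟨hlen, hfst⟩ := hG.faceLength_eq_six_of_planar h hF hv
  set f := G.face i (flip j (G.step i v))
  refine ⟨?_, ?_, by rw [face_step _ h.ne₁]; exact hne⟩
  · by_contra hcross
    have zero_at_start : cross k (G.faceVec f) v.1 = 0 := by
      refine cross_faceVec_eq_zero h ?_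
      rw [G.facesAt_eq h, hv, Set.pair_eq_singleton]
      exact hne
    have one_at_first : cross k (G.faceVec f) (G.step i v).1 = 1 :=
      cross_faceVec_eq_one h (by rw [face_step _ h.ne₁]; exact hne.symm) rfl
    have zero_at_second : cross k (G.faceVec f) (G.step i (G.step i v)).1 = 0 := by
      refine cross_faceVec_eq_zero h ?_
      rw [G.facesAt_eq h, face_step _ h.ne₁, face_step _ h.ne₁]
      rintro (he | he)
      · exact hne he
      · exact hcross (Eq.symm he)
    have loop_even := sum_cross_eq_zero h (controlsIntersection_zero_of_planar hG.1 h hF)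
      (a := v) (b := v) (m := 3) (l := 0) (Or.inl ⟨rfl, hfst⟩)
      (fun _ _ => by rw [map_zero]; rfl) (fun _ _ => by rw [map_zero]; rfl)
      (G.faceVec_mem_cycleSpace h.ne₁ f) zero_at_start (by rwa [hfst])
    simp only [Finset.sum_range_succ, Finset.sum_range_zero, zero_add, add_zero, hfst,
      zero_at_start] at loop_even
    exact absurd (loop_even.symm.trans (congrArg₂ (· + ·) one_at_first zero_at_second)) (by decide)
  · exact (hG.faceLength_of_planar h hF f).resolve_right fun h6 =>
      hne (hG.eq_of_faceLength_eq_six_of_planar h hF h6 hlen)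

theorem facesAt_iterate_step_flip_of_planar {r : ℕ} (hr : r < 4) :
    G.facesAt i ((G.step i)^[r] (flip j (G.step i v))).1 =
      {G.face i v, G.face i (flip j (G.step i v))} := by
  have hs := hG.isSimple_of_planar h hF
  have square := hG.isSquareCrossing_of_planar h hF hv
  have ends := square.facesAt_eq h
  rw [face_step _ h.ne₁] at ends
  have sides : ∀ m, m = 1 ∨ m = 3 → G.facesAt i ((G.step i)^[m] (flip j (G.step i v))).1 =
      {G.face i v, G.face i (flip j (G.step i v))} := by
    intro m hm
    rw [G.facesAt_eq h, square.face_flip_iterate hs h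
      (controlsIntersection_zero_of_planar hG.1 h hF) (by rw [map_zero]; rfl)
      (by rw [map_zero]; rfl) hm (by rw [map_zero]; rfl), face_iterate _ h.ne₁, face_step _ h.ne₁,
      Set.pair_comm]
  interval_cases r
  · exact ends.1
  · exact sides 1 (Or.inl rfl)
  · rw [square.opposite h hs]
    exact ends.2
  · exact sides 3 (Or.inr rfl)

theorem iterate_step_flip_fst_of_planar {r : ℕ} (hr : r = 1 ∨ r = 3) :
    ((G.step i)^[4] v).1 = ((G.step i)^[r] (flip j (G.step i v))).1 ∨
      ((G.step i)^[5] v).1 = ((G.step i)^[r] (flip j (G.step i v))).1 := by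
  have square := hG.isSquareCrossing_of_planar h hF hv
  obtain ⟨hlen, hfst⟩ := hG.faceLength_eq_six_of_planar h hF hv
  obtain ⟨off_first, off_second⟩ :=
    square.iterate_fst_ne h (hG.isSimple_of_planar h hF) hr
  have faces_eq := hG.facesAt_iterate_step_flip_of_planar h hF hv (r := r) (by omega)
  have off_start : ((G.step i)^[r] (flip j (G.step i v))).1 ≠ v.1 := by
    intro he
    rw [he, G.facesAt_eq h, hv] at faces_eq
    refine square.face_ne ?_
    rw [face_step _ h.ne₁]
    exact (faces_eq ▸ Set.mem_insert_of_mem _ rfl : _ ∈ ({G.face i v, G.face i v} : Set _)).elim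
      id id
  obtain ⟨m, hm, hmr⟩ := exists_iterate_of_mem_facesAt h.ne₁ (v := v)
    (by rw [faces_eq]; exact Set.mem_insert _ _)
  rw [hlen] at hm
  interval_cases m
  · exact absurd hmr.symm off_start
  · exact absurd hmr.symm off_first
  · exact absurd hmr.symm off_second
  · exact absurd (hmr.symm.trans hfst) off_start
  · exact Or.inl hmr
  · exact Or.inr hmr

theorem facesAt_iterate_subset_of_planar {m : ℕ} (hm : m < 6) :
    G.facesAt i ((G.step i)^[m] v).1 ⊆ {G.face i v, G.face i (flip j (G.step i v))} := by
  have hs := hG.isSimple_of_planar h hF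
  have square := hG.isSquareCrossing_of_planar h hF hv
  have on_square := fun r hr => (hG.facesAt_iterate_step_flip_of_planar h hF hv (r := r) hr).subset
  have at_start : G.facesAt i v.1 ⊆ {G.face i v, G.face i (flip j (G.step i v))} := by
    rw [G.facesAt_eq h, hv, Set.pair_eq_singleton, Set.singleton_subset_iff]
    exact Set.mem_insert _ _
  have sides_ne : ((G.step i)^[3] (flip j (G.step i v))).1 ≠
      ((G.step i)^[1] (flip j (G.step i v))).1 :=
    hs.iterate_iterate_fst_ne h.ne₁ _ (by omega) (by omega)
  interval_cases m
  · exact at_start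
  · exact on_square 0 (by omega)
  · exact square.opposite h hs ▸ on_square 2 (by omega)
  · exact (hG.faceLength_eq_six_of_planar h hF hv).2 ▸ at_start
  all_goals
    rcases hG.iterate_step_flip_fst_of_planar h hF hv (Or.inl rfl) with h1 | h1 <;>
    rcases hG.iterate_step_flip_fst_of_planar h hF hv (Or.inr rfl) with h3 | h3 <;>
    first
    | exact h1 ▸ on_square 1 (by omega)
    | exact h3 ▸ on_square 3 (by omega)
    | exact absurd (h3.symm.trans h1) sides_ne

omit hv in
theorem not_planar : False := by
  obtain ⟨v, hv⟩ := hG.exists_face_flip_eq_of_planar h hF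
  set S : Set (G.Face i) := {G.face i v, G.face i (flip j (G.step i v))}
  have closed : ∀ w, G.face i w ∈ S → G.facesAt i w.1 ⊆ S := by
    rintro w (hw | hw)
    · obtain ⟨m, hm, hmw⟩ := exists_iterate_of_mem_facesAt h.ne₁ (hw ▸ G.face_mem_facesAt i w)
      rw [(hG.faceLength_eq_six_of_planar h hF hv).1] at hm
      exact hmw ▸ hG.facesAt_iterate_subset_of_planar h hF hv hm
    · obtain ⟨m, hm, hmw⟩ := exists_iterate_of_mem_facesAt h.ne₁
        ((hw : G.face i w = _) ▸ G.face_mem_facesAt i w)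
      rw [(hG.isSquareCrossing_of_planar h hF hv).length_eq] at hm
      exact hmw ▸ (hG.facesAt_iterate_step_flip_of_planar h hF hv hm).subset
  have card_le : Nat.card (G.Face i) ≤ 2 := by
    have univ_eq : Set.univ = S :=
      (Set.eq_univ_of_forall (mem_of_facesAt_subset hG.1 closed (Set.mem_insert _ _))).symm
    rw [← Set.ncard_univ, univ_eq]
    exact (Set.ncard_insert_le _ _).trans (by rw [Set.ncard_singleton])
  have hdeg := (G.degree_eq_three_halves_iff h).1 hG.2.2.2
  have := hG.three_mul_card_face_le h.ne₂
  have := hG.three_mul_card_face_le h.ne₃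
  omega

end IsTwoPIDipoleFreeOfDegreeThreeHalves

end ONGraph

/-! ### Odd faces on the projective plane -/

namespace ONGraph

variable {B : Type*} {G : ONGraph B}

theorem facesAt_eq_pair {i j k : Fin 4} (h : IsColorTriple i j k) {b : B} {f g : G.Face i}
    (hf : f ∈ G.facesAt i b) (hg : g ∈ G.facesAt i b) (hfg : f ≠ g) :
    G.facesAt i b = {f, g} := by
  rw [show b = ((b, 0) : B × Fin 4).1 from rfl, G.facesAt_eq h] at hf hg ⊢
  rcases hf with rfl | rfl <;> rcases hg with rfl | rfl
  exacts [absurd rfl hfg, rfl, Set.pair_comm _ _, absurd rfl hfg]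

theorem ncard_bubbles_le [Finite B] {i : Fin 4} (hi : i ≠ 0) (f : G.Face i) :
    {b | f ∈ G.facesAt i b}.ncard ≤ G.faceLength f := by
  obtain ⟨v, rfl⟩ := G.face_surjective i f
  refine (Set.ncard_le_ncard (t := (fun m => ((G.step i)^[m] v).1) '' Set.Iio _) fun b hb =>
    exists_iterate_of_mem_facesAt hi hb).trans ((Set.ncard_image_le (Set.finite_Iio _)).trans ?_)
  rw [Set.ncard_eq_toFinset_card', Set.toFinset_Iio, Nat.card_Iio]

theorem IsSimple.iterate_fst_injOn [Finite B] (hs : G.IsSimple) {i j k : Fin 4}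
    (h : IsColorTriple i j k) {v : B × Fin 4} (hv : G.faceLength (G.face i v) ≤ 5) {l m : ℕ}
    (hl : l < G.faceLength (G.face i v)) (hm : m < G.faceLength (G.face i v))
    (hlm : ((G.step i)^[l] v).1 = ((G.step i)^[m] v).1) : l = m := by
  have flip_face_ne : G.face i (flip j ((G.step i)^[l] v)) ≠ G.face i v := by
    rw [← G.face_iterate h.ne₁ l v]
    exact hs.face_flip_ne h (by rwa [face_iterate _ h.ne₁])
  rcases eq_or_eq_flip_of_fst_eq h hlm.symm with he | he | he | he
  · exact (iterate_step_injOn h.ne₁ hm hl he).symm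
  · exact absurd he (G.iterate_ne_flip h.ne₁ v m l)
  · exact absurd (by rw [← he, face_iterate _ h.ne₁]) flip_face_ne
  · exact absurd (by rw [← G.face_flip h.ne₁, flip_comp h, ← he, face_iterate _ h.ne₁]) flip_face_ne

/-- The set of faces of colour `i` of odd length. -/
noncomputable def oddFaces [Finite B] (G : ONGraph B) (i : Fin 4) : Finset (G.Face i) :=
  (Set.toFinite {f | Odd (G.faceLength f)}).toFinset

theorem mem_oddFaces [Finite B] {i : Fin 4} {f : G.Face i} :
    f ∈ G.oddFaces i ↔ Odd (G.faceLength f) := by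
  simp only [oddFaces, Set.Finite.mem_toFinset, Set.mem_ofPred_eq]

theorem even_card_oddFaces [Finite B] (i : Fin 4) : Even (G.oddFaces i).card := by
  classical
  have := Fintype.ofFinite (G.Face i)
  have : G.oddFaces i = Finset.univ.filter fun f => Odd (G.faceLength f) := by
    ext f
    simp only [mem_oddFaces, Finset.mem_filter_univ]
  rw [this, ← Finset.even_sum_iff_even_card_odd, G.sum_faceLength]
  exact even_two_mul _

theorem ncard_oddFaces_diff [Finite B] {i : Fin 4} {f : G.Face i} (hf : f ∈ G.oddFaces i) :
    (G.oddFaces i \ {f} : Set (G.Face i)).ncard + 1 = (G.oddFaces i).card := by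
  rw [Set.ncard_sdiff_singleton_add_one (Finset.mem_coe.2 hf), Set.ncard_coe_finset]

namespace IsTwoPIDipoleFreeOfDegreeThreeHalves

variable [Finite B] (hG : G.IsTwoPIDipoleFreeOfDegreeThreeHalves)
include hG

theorem card_face_add {i j k : Fin 4} (h : IsColorTriple i j k) :
    Nat.card (G.Face j) + Nat.card (G.Face k) = Nat.card B + 1 := by
  have card_le : ∀ {i j k}, IsColorTriple i j k →
      Nat.card (G.Face j) + Nat.card (G.Face k) ≤ Nat.card B + 1 := fun h =>
    Nat.lt_succ_iff.1 ((card_face_add_le hG.1 h).lt_of_ne (hG.not_planar h))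
  have hdeg := (G.degree_eq_three_halves_iff h).1 hG.2.2.2
  have := card_le h
  have := card_le h.rotate
  have := card_le h.rotate.rotate
  omega

variable {i j k : Fin 4} (h : IsColorTriple i j k)
include h

theorem two_mul_card_face : 2 * Nat.card (G.Face i) = Nat.card B + 1 := by
  have hdeg := (G.degree_eq_three_halves_iff h).1 hG.2.2.2
  have := hG.card_face_add h
  omega

theorem sum_oddFaces_add_two [Fintype (G.Face i)] [DecidableEq (G.Face i)] :
    ∑ f ∈ G.oddFaces i, (G.faceLength f - 3) + ∑ f ∈ (G.oddFaces i)ᶜ, (G.faceLength f - 4) + 2 =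
      (G.oddFaces i).card := by
  have four_le : ∀ f ∈ (G.oddFaces i)ᶜ, 4 ≤ G.faceLength f := by
    intro f hf
    rw [Finset.mem_compl, mem_oddFaces, Nat.not_odd_iff_even] at hf
    obtain ⟨r, hr⟩ := hf
    have := hG.three_le_faceLength h.ne₁ f
    omega
  have even_part : ∑ f ∈ (G.oddFaces i)ᶜ, (G.faceLength f - 3) =
      ∑ f ∈ (G.oddFaces i)ᶜ, (G.faceLength f - 4) + (G.oddFaces i)ᶜ.card := by
    rw [Finset.card_eq_sum_ones, ← Finset.sum_add_distrib]
    exact Finset.sum_congr rfl fun f hf => by have := four_le f hf; omega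
  have total := sum_faceLength_sub fun f => hG.three_le_faceLength h.ne₁ f
  have card_face := hG.two_mul_card_face h
  rw [← Finset.sum_add_sum_compl (G.oddFaces i), even_part] at total
  rw [Nat.card_eq_fintype_card, ← Finset.card_add_card_compl (G.oddFaces i)] at card_face total
  omega

theorem sum_sub_three_add_two_le {S : Finset (G.Face i)} (hS : S ⊆ G.oddFaces i) :
    ∑ f ∈ S, (G.faceLength f - 3) + 2 ≤ (G.oddFaces i).card := by
  classical
  have := Fintype.ofFinite (G.Face i)
  have := hG.sum_oddFaces_add_two h
  have := Finset.sum_le_sum_of_subset (f := fun f => G.faceLength f - 3) hS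
  omega

theorem exists_faceLength_eq_three : ∃ f : G.Face i, G.faceLength f = 3 := by
  by_contra! hne
  have two_le : ∀ f ∈ G.oddFaces i, 2 ≤ G.faceLength f - 3 := by
    intro f hf
    obtain ⟨r, hr⟩ := mem_oddFaces.1 hf
    have := hG.three_le_faceLength h.ne₁ f
    have := hne f
    omega
  have := Finset.card_nsmul_le_sum _ _ _ two_le
  have := hG.sum_sub_three_add_two_le h subset_rfl
  rw [smul_eq_mul] at *
  omega

theorem evenCyclesBound : G.EvenCyclesBound j k := by
  obtain ⟨f, hf⟩ := hG.exists_faceLength_eq_three h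
  exact fun x hx hxx => mem_of_inter_self_eq_zero h hG.1 (hG.card_face_add h)
    (G.faceVec_mem_cycleSpace h.ne₁ f) ((G.faceLength_odd_iff h f).1 (by rw [hf]; decide)) hx hxx

omit h in
theorem isSimple : G.IsSimple :=
  hG.isSimple_of_evenCyclesBound fun _ _ _ h => hG.evenCyclesBound h

theorem inter_eq_mul {x y : B × Fin 4 → ZMod 2} (hx : x ∈ G.cycleSpace) (hy : y ∈ G.cycleSpace) :
    inter j k x y = inter j k x x * inter j k y y :=
  inter_eq_mul_of_projective h hG.1 (hG.card_face_add h) hx hy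

theorem controlsIntersection_faceVec {d : G.Face i} (hd : d ∈ G.oddFaces i) :
    G.ControlsIntersection j k (G.faceVec d) := by
  intro x hx hxd y hy
  have hdd := (G.faceLength_odd_iff h d).1 (mem_oddFaces.1 hd)
  rw [hG.inter_eq_mul h hx (G.faceVec_mem_cycleSpace h.ne₁ d), hdd, mul_one] at hxd
  rw [hG.inter_eq_mul h hx hy, hxd, zero_mul]

theorem inter_faceVec_eq_one_iff {f g : G.Face i} :
    inter j k (G.faceVec f) (G.faceVec g) = 1 ↔ f ∈ G.oddFaces i ∧ g ∈ G.oddFaces i := by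
  have mul_eq_one : ∀ a b : ZMod 2, a * b = 1 ↔ a = 1 ∧ b = 1 := by decide
  rw [hG.inter_eq_mul h (G.faceVec_mem_cycleSpace h.ne₁ f) (G.faceVec_mem_cycleSpace h.ne₁ g),
    mul_eq_one, mem_oddFaces, mem_oddFaces, G.faceLength_odd_iff h, G.faceLength_odd_iff h]

theorem sum_cross_eq_one_iff (v : B × Fin 4) (f : G.Face i) :
    ∑ l ∈ Finset.range (G.faceLength (G.face i v)),
      cross k (G.faceVec f) ((G.step i)^[l] v).1 = 1 ↔
      G.face i v ∈ G.oddFaces i ∧ f ∈ G.oddFaces i := by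
  rw [← G.inter_faceVec_face h, hG.inter_faceVec_eq_one_iff h]

theorem exists_facesAt_eq {f g : G.Face i} (hf : f ∈ G.oddFaces i) (hg : g ∈ G.oddFaces i)
    (hfg : f ≠ g) : ∃ b, G.facesAt i b = {f, g} := by
  by_contra! hne
  refine one_ne_zero (((hG.inter_faceVec_eq_one_iff h).2 ⟨hf, hg⟩).symm.trans ?_)
  refine finsum_eq_zero_of_forall_eq_zero fun b => ?_
  by_cases hfb : f ∈ G.facesAt i b
  · rw [cross_faceVec_eq_zero h fun hgb => hne b (facesAt_eq_pair h hfb hgb hfg), mul_zero]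
  · rw [G.cross_faceVec_swap h, cross_faceVec_eq_zero h hfb, zero_mul]

section OddFace

variable {f : G.Face i} (hf : f ∈ G.oddFaces i)
include hf

theorem exists_injOn_facesAt_eq : ∃ φ : G.Face i → B,
    Set.InjOn φ (G.oddFaces i \ {f}) ∧ ∀ g ∈ (G.oddFaces i \ {f} : Set (G.Face i)),
      G.facesAt i (φ g) = {f, g} := by
  have exists_crossing : ∀ g, ∃ b, g ∈ (G.oddFaces i \ {f} : Set (G.Face i)) →
      G.facesAt i b = {f, g} := by
    intro g
    by_cases hg : g ∈ (G.oddFaces i \ {f} : Set (G.Face i))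
    · obtain ⟨b, hb⟩ := hG.exists_facesAt_eq h hf hg.1 (Ne.symm hg.2)
      exact ⟨b, fun _ => hb⟩
    · obtain ⟨v, -⟩ := G.face_surjective i f
      exact ⟨v.1, fun hg' => absurd hg' hg⟩
  choose φ hφ using exists_crossing
  refine ⟨φ, fun g hg g' hg' he => ?_, hφ⟩
  have mem : g ∈ ({f, g'} : Set (G.Face i)) :=
    hφ g' hg' ▸ he ▸ hφ g hg ▸ Set.mem_insert_of_mem _ rfl
  exact mem.resolve_left hg.2

theorem card_oddFaces_le : (G.oddFaces i).card ≤ G.faceLength f + 1 := by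
  obtain ⟨φ, φ_inj, hφ⟩ := hG.exists_injOn_facesAt_eq h hf
  rw [← ncard_oddFaces_diff hf]
  exact Nat.succ_le_succ ((Set.ncard_le_ncard_of_injOn φ
    (fun g hg => (hφ g hg).symm.subset (Set.mem_insert _ _)) φ_inj).trans
    (ncard_bubbles_le h.ne₁ f))

variable (hcard : (G.oddFaces i).card = G.faceLength f + 1)
include hcard

theorem exists_bijOn_facesAt_eq : ∃ φ : G.Face i → B,
    Set.BijOn φ (G.oddFaces i \ {f}) {b | f ∈ G.facesAt i b} ∧
      ∀ g ∈ (G.oddFaces i \ {f} : Set (G.Face i)), G.facesAt i (φ g) = {f, g} := by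
  obtain ⟨φ, φ_inj, hφ⟩ := hG.exists_injOn_facesAt_eq h hf
  have image_subset : φ '' (G.oddFaces i \ {f}) ⊆ {b | f ∈ G.facesAt i b} := by
    rintro _ ⟨g, hg, rfl⟩
    exact (hφ g hg).symm.subset (Set.mem_insert _ _)
  have image_eq := Set.eq_of_subset_of_ncard_le image_subset <| by
    have := ncard_bubbles_le h.ne₁ f
    have := ncard_oddFaces_diff hf
    rw [φ_inj.ncard_image]
    omega
  exact ⟨φ, image_eq ▸ φ_inj.bijOn_image, hφ⟩

theorem facesAt_subset_oddFaces {b : B} (hb : f ∈ G.facesAt i b) :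
    G.facesAt i b ⊆ G.oddFaces i := by
  obtain ⟨φ, φ_bij, hφ⟩ := hG.exists_bijOn_facesAt_eq h hf hcard
  obtain ⟨g, hg, rfl⟩ := φ_bij.surjOn hb
  rw [hφ g hg]
  exact Set.pair_subset hf hg.1

theorem eq_of_mem_facesAt {g : G.Face i} (hgf : g ≠ f) {b b' : B}
    (hb : f ∈ G.facesAt i b) (hgb : g ∈ G.facesAt i b) (hb' : f ∈ G.facesAt i b')
    (hgb' : g ∈ G.facesAt i b') : b = b' := by
  obtain ⟨φ, φ_bij, hφ⟩ := hG.exists_bijOn_facesAt_eq h hf hcard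
  obtain ⟨d, hd, rfl⟩ := φ_bij.surjOn hb
  obtain ⟨d', hd', rfl⟩ := φ_bij.surjOn hb'
  rw [hφ d hd] at hgb
  rw [hφ d' hd'] at hgb'
  rw [← hgb.resolve_left hgf, ← hgb'.resolve_left hgf]

end OddFace

theorem card_oddFaces_eq_two_or_eq_four : (G.oddFaces i).card = 2 ∨ (G.oddFaces i).card = 4 := by
  obtain ⟨f, hf⟩ := hG.exists_faceLength_eq_three h
  have := hG.sum_sub_three_add_two_le h subset_rfl
  have := hG.card_oddFaces_le h (mem_oddFaces (f := f).2 (by rw [hf]; decide))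
  obtain ⟨r, hr⟩ := G.even_card_oddFaces i
  omega

end IsTwoPIDipoleFreeOfDegreeThreeHalves

end ONGraph

namespace ONGraph

variable {B : Type*} {G : ONGraph B}

theorem facesAt_iterate [Finite B] {i j k : Fin 4} (h : IsColorTriple i j k) (v : B × Fin 4)
    (l : ℕ) : G.facesAt i ((G.step i)^[l] v).1 =
      {G.face i v, G.face i (flip j ((G.step i)^[l] v))} := by
  rw [G.facesAt_eq h, face_iterate _ h.ne₁]

theorem cross_faceVec_iterate_eq_zero [Finite B] {i j k : Fin 4} (h : IsColorTriple i j k)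
    {v : B × Fin 4} {g : G.Face i} (hgv : g ≠ G.face i v) (l : ℕ)
    (hl : G.face i (flip j ((G.step i)^[l] v)) ≠ g) :
    cross k (G.faceVec g) ((G.step i)^[l] v).1 = 0 :=
  cross_faceVec_eq_zero h <| by
    rw [facesAt_iterate h, Set.mem_insert_iff, Set.mem_singleton_iff, not_or]
    exact ⟨hgv, hl.symm⟩

theorem exists_rotation_of_card_eq_three : ∀ T : Finset (Fin 5), T.card = 3 →
    ∃ m, (m ∉ T ∧ m + 1 ∈ T ∧ m + 3 ∈ T ∧ m + 4 ∈ T) ∨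
      (m ∉ T ∧ m + 1 ∉ T ∧ m + 2 ∈ T ∧ m + 3 ∈ T ∧ m + 4 ∈ T) := by
  decide

namespace IsTwoPIDipoleFreeOfDegreeThreeHalves

variable [Finite B] (hG : G.IsTwoPIDipoleFreeOfDegreeThreeHalves) {i j k : Fin 4}
  (h : IsColorTriple i j k) (hcard : (G.oddFaces i).card = 4)
include hG h hcard

section FiveFace

variable {v : B × Fin 4} (hv : G.faceLength (G.face i v) = 5)
include hv

omit hG h hcard in
theorem mem_oddFaces_of_eq_five : G.face i v ∈ G.oddFaces i :=
  mem_oddFaces.2 (by rw [hv]; decide)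

theorem faceLength_eq_three_of_ne {g : G.Face i} (hg : g ∈ G.oddFaces i) (hgv : g ≠ G.face i v) :
    G.faceLength g = 3 := by
  classical
  have := hG.sum_sub_three_add_two_le h
    (Finset.insert_subset hg (Finset.singleton_subset_iff.2 (mem_oddFaces_of_eq_five hv)))
  rw [Finset.sum_pair hgv, hcard, hv] at this
  have := hG.three_le_faceLength h.ne₁ g
  omega

theorem subset_oddFaces_of_ne {g : G.Face i} (hg : g ∈ G.oddFaces i) (hgv : g ≠ G.face i v)
    {b : B} (hgb : g ∈ G.facesAt i b) : G.facesAt i b ⊆ G.oddFaces i :=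
  hG.facesAt_subset_oddFaces h hg
    (by rw [hcard, hG.faceLength_eq_three_of_ne h hcard hv hg hgv]) hgb

omit hcard in
theorem face_flip_iterate_ne (l : ℕ) :
    G.face i (flip j ((G.step i)^[l] v)) ≠ G.face i v := by
  rw [← G.face_iterate h.ne₁ l v]
  exact hG.isSimple.face_flip_ne h (by rw [face_iterate _ h.ne₁, hv])

omit hcard in
theorem face_flip_eq_of_alternating (h0 : G.face i (flip j v) ∉ G.oddFaces i)
    (h1 : G.face i (flip j (G.step i v)) ∈ G.oddFaces i)
    (h3 : G.face i (flip j ((G.step i)^[3] v)) ∈ G.oddFaces i)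
    (h4 : G.face i (flip j ((G.step i)^[4] v)) ∈ G.oddFaces i) :
    G.face i (flip j ((G.step i)^[2] v)) = G.face i (flip j v) := by
  by_contra hne
  have cross_zero := cross_faceVec_iterate_eq_zero h (hG.face_flip_iterate_ne h hv 0)
  have cross_one : cross k (G.faceVec (G.face i (flip j v))) v.1 = 1 :=
    cross_faceVec_eq_one h (hG.face_flip_iterate_ne h hv 0).symm rfl
  refine h0 ((hG.sum_cross_eq_one_iff h v _).1 ?_).2
  rw [hv, Finset.sum_range_succ', Finset.sum_eq_zero, zero_add]
  · exact cross_one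
  · intro l hl
    have hl := Finset.mem_range.1 hl
    interval_cases l
    exacts [cross_zero 1 (ne_of_mem_of_not_mem h1 h0), cross_zero 2 hne,
      cross_zero 3 (ne_of_mem_of_not_mem h3 h0), cross_zero 4 (ne_of_mem_of_not_mem h4 h0)]

/-- The arcs of the faces through `v` and `flip j v` up to the bubble of `(G.step i)^[2] v` close up
to a loop that avoids an odd face `d` but crosses the face through `flip j (G.step i v)` once. -/
theorem false_of_alternating (h0 : G.face i (flip j v) ∉ G.oddFaces i)
    (h1 : G.face i (flip j (G.step i v)) ∈ G.oddFaces i)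
    (h3 : G.face i (flip j ((G.step i)^[3] v)) ∈ G.oddFaces i)
    (h4 : G.face i (flip j ((G.step i)^[4] v)) ∈ G.oddFaces i) : False := by
  classical
  have face_eq := hG.face_flip_eq_of_alternating h hv h0 h1 h3 h4
  set f := G.face i (flip j v)
  set o := G.face i (flip j (G.step i v))
  have o_ne : o ≠ G.face i v := hG.face_flip_iterate_ne h hv 1
  obtain ⟨d, hd, d_notMem⟩ : ∃ d ∈ G.oddFaces i, d ∉ ({G.face i v, o} : Finset (G.Face i)) :=
    Finset.exists_mem_notMem_of_card_lt_card
      (Finset.card_le_two.trans_lt (by rw [hcard]; decide))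
  obtain ⟨d_ne, d_ne'⟩ : d ≠ G.face i v ∧ d ≠ o := by
    simpa only [Finset.mem_insert, Finset.mem_singleton, not_or] using d_notMem
  obtain ⟨r, -, hr⟩ := exists_iterate_of_mem_facesAt (v := flip j v) h.ne₁
    (b := ((G.step i)^[2] v).1) (by rw [facesAt_iterate h]; exact Or.inr face_eq.symm)
  have cross_f : ∀ g ∈ G.oddFaces i, g ≠ G.face i v → ∀ t,
      cross k (G.faceVec g) ((G.step i)^[t] (flip j v)).1 = 0 :=
    fun g hg hgv t => cross_faceVec_eq_zero h fun hmem =>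
      h0 (hG.subset_oddFaces_of_ne h hcard hv hg hgv hmem (by
        rw [facesAt_iterate h]; exact Or.inl rfl))
  have cross_o := cross_faceVec_iterate_eq_zero h o_ne 2
    (face_eq ▸ (ne_of_mem_of_not_mem h1 h0).symm)
  have sum_zero := sum_cross_eq_zero h (hG.controlsIntersection_faceVec h hd) (a := v) (m := 2)
    (b := flip j v) (l := r) (Or.inl ⟨rfl, hr.symm⟩)
    (fun t ht => cross_faceVec_iterate_eq_zero h d_ne t <| by
      interval_cases t
      exacts [(ne_of_mem_of_not_mem hd h0).symm, d_ne'.symm,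
        face_eq ▸ (ne_of_mem_of_not_mem hd h0).symm])
    (fun t _ => cross_f d hd d_ne t) (G.faceVec_mem_cycleSpace h.ne₁ o)
    (cross_faceVec_iterate_eq_zero h o_ne 0 (ne_of_mem_of_not_mem h1 h0).symm)
    cross_o
  rw [Finset.sum_eq_zero fun t _ => cross_f o h1 o_ne (t + 1), Finset.sum_range_succ,
    Finset.sum_range_one, cross_o, add_zero, add_zero] at sum_zero
  refine one_ne_zero (α := ZMod 2) ((cross_faceVec_eq_one h ?_ rfl).symm.trans sum_zero)
  rw [face_step _ h.ne₁]
  exact o_ne.symm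

/-- The two edges of the face of length five that bound the arc between the bubbles of
`(G.step i)^[2] v` and `(G.step i)^[4] v` cut off the bubbles all of whose faces are odd. -/
theorem false_of_consecutive (h0 : G.face i (flip j v) ∉ G.oddFaces i)
    (h1 : G.face i (flip j (G.step i v)) ∉ G.oddFaces i)
    (hmem : ∀ m, 2 ≤ m → m ≤ 4 → G.face i (flip j ((G.step i)^[m] v)) ∈ G.oddFaces i) : False := by
  have subset_iff : ∀ l, G.facesAt i ((G.step i)^[l] v).1 ⊆ G.oddFaces i ↔
      G.face i (flip j ((G.step i)^[l] v)) ∈ G.oddFaces i := by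
    intro l
    rw [facesAt_iterate h, Set.pair_subset_iff]
    exact and_iff_right (mem_oddFaces_of_eq_five hv)
  have step_fst : ∀ l, (G.propagator ((G.step i)^[l] v)).1 = ((G.step i)^[l + 1] v).1 := by
    intro l
    rw [Function.iterate_succ_apply', ONGraph.step_fst]
  refine h0 ((subset_iff 0).1 (hG.2.1.forall_of_cut (v₁ := G.step i v) (v₂ := (G.step i)^[4] v)
    (Q := fun b => G.facesAt i b ⊆ G.oddFaces i) (fun he => ?_)
    (G.iterate_ne_propagator h.ne₁ v 1 4) (fun w hw₁ hw₁' hw₄ hw₄' hw => ?_)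
    ((subset_iff 2).2 (hmem 2 le_rfl (by omega))) v.1))
  · have := iterate_step_injOn h.ne₁ (l := 1) (m := 4) (by omega) (by omega) he
    omega
  by_cases hface : G.face i w = G.face i v
  · obtain ⟨m, hm, rfl | hmw⟩ := exists_iterate_eq_or_eq_propagator h.ne₁ hface.symm
    · have zero_ne : m ≠ 0 := by
        rintro rfl
        exact h0 ((subset_iff 0).1 hw)
      have one_ne : m ≠ 1 := by
        rintro rfl
        exact hw₁ rfl
      have four_ne : m ≠ 4 := by
        rintro rfl
        exact hw₄ rfl
      rw [step_fst]
      exact (subset_iff _).2 (hmem _ (by omega) (by omega))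
    · obtain rfl : w = G.propagator ((G.step i)^[m] v) := by rw [hmw, propagator_propagator]
      have zero_ne : m ≠ 0 := by
        rintro rfl
        exact h1 ((subset_iff 1).1 (step_fst 0 ▸ hw))
      have one_ne : m ≠ 1 := by
        rintro rfl
        exact hw₁' rfl
      rw [propagator_propagator]
      exact (subset_iff _).2 (hmem _ (by omega) (by omega))
  · exact hG.subset_oddFaces_of_ne h hcard hv (hw (G.face_mem_facesAt i w)) hface
      (G.face_propagator i w ▸ G.face_mem_facesAt i (G.propagator w))

open Finset Classical in
theorem card_filter_mem_oddFaces :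
    #{l : Fin 5 | G.face i (flip j ((G.step i)^[l] v)) ∈ G.oddFaces i} = 3 := by
  have hv' := mem_oddFaces_of_eq_five hv
  have face_ne := hG.face_flip_iterate_ne h hv
  suffices #{l : Fin 5 | G.face i (flip j ((G.step i)^[l] v)) ∈ G.oddFaces i} =
      ((G.oddFaces i).erase (G.face i v)).card by
    rw [this, card_erase_of_mem hv', hcard]
  refine card_nbij (fun l : Fin 5 => G.face i (flip j ((G.step i)^[l] v))) ?_ ?_ ?_
  · intro l hl
    exact mem_erase.2 ⟨face_ne l, (mem_filter_univ l).1 hl⟩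
  · intro l hl l' _ hll'
    have hl := (mem_filter_univ l).1 hl
    refine Fin.ext (hG.isSimple.iterate_fst_injOn h hv.le (hv.symm ▸ l.2) (hv.symm ▸ l'.2) ?_)
    refine hG.eq_of_mem_facesAt h hl
      (by rw [hcard, hG.faceLength_eq_three_of_ne h hcard hv hl (face_ne l)]) (face_ne l).symm
      ?_ ?_ ?_ ?_ <;> rw [facesAt_iterate h]
    exacts [Or.inr rfl, Or.inl rfl, Or.inr hll', Or.inl rfl]
  · intro g hg
    obtain ⟨hgv, hg⟩ := mem_erase.1 hg
    obtain ⟨b, hb⟩ := hG.exists_facesAt_eq h hv' hg hgv.symm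
    obtain ⟨l, hl, rfl⟩ := exists_iterate_of_mem_facesAt h.ne₁ (hb ▸ Set.mem_insert _ _)
    rw [hv] at hl
    rw [facesAt_iterate h] at hb
    have hgl : g = G.face i (flip j ((G.step i)^[l] v)) :=
      (hb.symm.subset (Or.inr rfl)).resolve_left hgv
    exact ⟨⟨l, hl⟩, (mem_filter_univ _).2 (hgl ▸ hg), hgl.symm⟩

theorem false_of_faceLength_eq_five : False := by
  obtain ⟨m, hm⟩ := exists_rotation_of_card_eq_three _ (hG.card_filter_mem_oddFaces h hcard hv)
  have iterate_add : ∀ l : Fin 5,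
      (G.step i)^[(m + l : Fin 5)] v = (G.step i)^[l] ((G.step i)^[m] v) := by
    intro l
    have hper := G.iterate_faceLength h.ne₁ v
    rw [hv] at hper
    rw [← Function.iterate_add_apply, Fin.val_add, add_comm (l : ℕ)]
    exact Function.IsPeriodicPt.iterate_mod_apply hper _
  simp only [Finset.mem_filter_univ, iterate_add] at hm
  have hvm : G.faceLength (G.face i ((G.step i)^[m] v)) = 5 := by rw [face_iterate _ h.ne₁, hv]
  rcases hm with ⟨h0, h1, h3, h4⟩ | ⟨h0, h1, h2, h3, h4⟩
  · exact hG.false_of_alternating h hcard hvm h0 h1 h3 h4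
  · refine hG.false_of_consecutive h hcard hvm h0 h1 fun l hl hl' => ?_
    interval_cases l
    exacts [h2, h3, h4]

end FiveFace

theorem false_of_card_eq_four : False := by
  classical
  have := Fintype.ofFinite (G.Face i)
  have all_three : ∀ f ∈ G.oddFaces i, G.faceLength f = 3 := by
    intro f hf
    have := hG.sum_sub_three_add_two_le h (Finset.singleton_subset_iff.2 hf)
    rw [Finset.sum_singleton, hcard] at this
    obtain ⟨v, rfl⟩ := G.face_surjective i f
    have : G.faceLength (G.face i v) ≠ 5 := hG.false_of_faceLength_eq_five h hcard
    have := hG.three_le_faceLength h.ne₁ (G.face i v)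
    obtain ⟨r, hr⟩ := mem_oddFaces.1 hf
    omega
  obtain ⟨f, hf⟩ := hG.exists_faceLength_eq_three h
  have all_odd : ∀ g, g ∈ (G.oddFaces i : Set (G.Face i)) := by
    refine mem_of_facesAt_subset hG.1 (fun v hv => ?_) (mem_oddFaces.2 (by rw [hf]; decide) : f ∈ _)
    exact hG.facesAt_subset_oddFaces h hv (by rw [hcard, all_three _ hv]) (G.face_mem_facesAt i v)
  have sum_eq := hG.sum_oddFaces_add_two h
  rw [Finset.sum_eq_zero fun f hf => by rw [all_three f hf, Nat.sub_self],
    Finset.sum_eq_zero fun f hf => absurd (all_odd f) (Finset.mem_compl.1 hf), hcard] at sum_eq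
  omega

end IsTwoPIDipoleFreeOfDegreeThreeHalves

end ONGraph

namespace ONGraph

variable {B : Type*} {G : ONGraph B}

theorem IsSimple.face_flip_step_ne [Finite B] (hs : G.IsSimple) {i j k : Fin 4}
    (h : IsColorTriple i j k) {v : B × Fin 4} (hv : G.faceLength (G.face i (flip j v)) = 3)
    (hne : G.face i (flip j v) ≠ G.face i v) :
    G.face i (flip j (G.step i v)) ≠ G.face i (flip j v) := by
  intro he
  have hmem : G.face i (flip j v) ∈ G.facesAt i (G.step i v).1 :=
    he ▸ G.face_mem_facesAt i (flip j (G.step i v))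
  obtain ⟨m, hm, hfst⟩ := exists_iterate_of_mem_facesAt h.ne₁ hmem
  have hper := G.iterate_faceLength h.ne₁ (flip j v)
  rw [hv] at hm hper
  interval_cases m
  · exact absurd hfst.symm (hs.step_fst_ne i v)
  · exact absurd (hs.2 (flip j v) v rfl hfst) (flip_ne h.ne₂ v)
  · have hper' : (G.step i ((G.step i)^[2] (flip j v))).1 = v.1 := (congrArg Prod.fst hper :)
    have flip_eq : (G.step i)^[2] (flip j v) = flip i (G.step i v) :=
      hs.2 _ _ hfst (by rwa [propagator_flip_step])
    refine hne ?_
    rw [← G.face_iterate h.ne₁ 2, flip_eq, face_flip _ h.ne₁, face_step _ h.ne₁]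

/-- The faces of colour `i` through `v` and `flip j v` are two faces of length three, and the two
further bubbles of the first of them lie on a common third face, of length four. -/
structure IsTriangleCrossing (G : ONGraph B) (i j : Fin 4) (v : B × Fin 4) : Prop where
  length_eq : G.faceLength (G.face i v) = 3
  length_flip_eq : G.faceLength (G.face i (flip j v)) = 3
  face_ne : G.face i (flip j v) ≠ G.face i v
  square : G.IsSquareCrossing i j (G.step i v)
  square_ne : G.face i (flip j (G.step i v)) ≠ G.face i (flip j v)

namespace IsTriangleCrossing

variable {i j k : Fin 4} {v : B × Fin 4} (hv : G.IsTriangleCrossing i j v)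
  (h : IsColorTriple i j k)
include hv h

theorem square_ne' : G.face i (flip j (G.step i v)) ≠ G.face i v :=
  G.face_step h.ne₁ v ▸ hv.square.face_ne

theorem square_notMem_facesAt : G.face i (flip j (G.step i v)) ∉ G.facesAt i v.1 := by
  rw [G.facesAt_eq h, Set.mem_insert_iff, Set.mem_singleton_iff, not_or]
  exact ⟨hv.square_ne' h, hv.square_ne⟩

theorem cross_eq_zero : cross k (G.faceVec (G.face i (flip j v))) (G.step i v).1 = 0 ∧
    cross k (G.faceVec (G.face i (flip j v))) (G.step i (G.step i v)).1 = 0 := by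
  have notMem : G.face i (flip j v) ∉
      ({G.face i (G.step i v), G.face i (flip j (G.step i v))} : Set _) := by
    rw [face_step _ h.ne₁, Set.mem_insert_iff, Set.mem_singleton_iff, not_or]
    exact ⟨hv.face_ne, hv.square_ne.symm⟩
  constructor <;> refine cross_faceVec_eq_zero h ?_
  · rwa [(hv.square.facesAt_eq h).1]
  · rwa [(hv.square.facesAt_eq h).2]

variable [Finite B] (hs : G.IsSimple)
  (H : G.ControlsIntersection j k (G.faceVec (G.face i (flip j v))))

theorem fst_eq_of_mem_facesAt {b : B} (hb : G.face i v ∈ G.facesAt i b) (hbv : b ≠ v.1) :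
    b = (G.step i v).1 ∨ b = (G.step i (G.step i v)).1 := by
  obtain ⟨m, hm, rfl⟩ := exists_iterate_of_mem_facesAt h.ne₁ hb
  rw [hv.length_eq] at hm
  interval_cases m
  exacts [absurd rfl hbv, Or.inl rfl, Or.inr rfl]

include hs H

theorem face_flip_mem_facesAt {m : ℕ} (hm : m = 1 ∨ m = 3) :
    ((G.step i)^[m] (flip j (G.step i v))).1 ≠ v.1 ∧
      G.face i (flip j v) ∈ G.facesAt i ((G.step i)^[m] (flip j (G.step i v))).1 := by
  have square_mem : G.face i (flip j (G.step i v)) ∈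
      G.facesAt i ((G.step i)^[m] (flip j (G.step i v))).1 := by
    rw [facesAt_iterate h]
    exact Or.inl rfl
  have fst_ne : ((G.step i)^[m] (flip j (G.step i v))).1 ≠ v.1 := fun he =>
    hv.square_notMem_facesAt h (he ▸ square_mem)
  refine ⟨fst_ne, ?_⟩
  by_contra notMem
  have face_eq := hv.square.face_flip_iterate hs h H (hv.cross_eq_zero h).1 (hv.cross_eq_zero h).2
    hm (cross_faceVec_eq_zero h notMem)
  have mem : G.face i v ∈ G.facesAt i ((G.step i)^[m] (flip j (G.step i v))).1 := by
    rw [facesAt_iterate h, face_eq, face_step _ h.ne₁]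
    exact Or.inr rfl
  have off_triangle := hv.square.iterate_fst_ne h hs hm
  rcases hv.fst_eq_of_mem_facesAt h mem fst_ne with he | he
  exacts [off_triangle.1 he, off_triangle.2 he]

theorem fst_eq_of_face_flip_mem_facesAt {b : B} (hb : G.face i (flip j v) ∈ G.facesAt i b)
    (hbv : b ≠ v.1) : b = ((G.step i)^[1] (flip j (G.step i v))).1 ∨
      b = ((G.step i)^[3] (flip j (G.step i v))).1 := by
  have exists_index : ∀ b : B, G.face i (flip j v) ∈ G.facesAt i b → b ≠ v.1 →
      b = ((G.step i)^[1] (flip j v)).1 ∨ b = ((G.step i)^[2] (flip j v)).1 := by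
    intro b hb hbv
    obtain ⟨m, hm, rfl⟩ := exists_iterate_of_mem_facesAt h.ne₁ hb
    rw [hv.length_flip_eq] at hm
    interval_cases m
    exacts [absurd rfl hbv, Or.inl rfl, Or.inr rfl]
  obtain ⟨ne₁, mem₁⟩ := hv.face_flip_mem_facesAt h hs H (m := 1) (Or.inl rfl)
  obtain ⟨ne₃, mem₃⟩ := hv.face_flip_mem_facesAt h hs H (m := 3) (Or.inr rfl)
  have ne₁₃ := hs.iterate_iterate_fst_ne h.ne₁ (flip j (G.step i v)) (l := 1) (m := 3)
    (by omega) le_rfl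
  have := exists_index _ hb hbv
  have := exists_index _ mem₁ ne₁
  have := exists_index _ mem₃ ne₃
  grind

theorem exists_edge {b₁ b₂ : B} (h1 : G.face i v ∈ G.facesAt i b₁) (hb₁ : b₁ ≠ v.1)
    (h2 : G.face i (flip j v) ∈ G.facesAt i b₂) (hb₂ : b₂ ≠ v.1) :
    ∃ g, g.1 = b₁ ∧ (G.propagator g).1 = b₂ ∧ G.face i g = G.face i (flip j (G.step i v)) := by
  set y := flip j (G.step i v)
  have opposite := hv.square.opposite h hs
  have iterate_four := hv.square.iterate_four h
  have face_y := fun m => G.face_iterate h.ne₁ m y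
  rcases hv.fst_eq_of_mem_facesAt h h1 hb₁ with rfl | rfl <;>
    rcases hv.fst_eq_of_face_flip_mem_facesAt h hs H h2 hb₂ with rfl | rfl
  · exact ⟨y, rfl, (G.step_fst i y).symm, rfl⟩
  · refine ⟨flip i y, rfl, ?_, G.face_flip h.ne₁ y⟩
    have step_iterate_three : G.step i ((G.step i)^[3] y) = y := iterate_four
    conv_lhs => rw [← step_iterate_three, propagator_flip_step]
  · refine ⟨flip i ((G.step i)^[2] y), opposite, ?_, ?_⟩
    · exact congrArg Prod.fst (G.propagator_flip_step i (G.step i y))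
    · rw [face_flip _ h.ne₁, face_y]
  · exact ⟨(G.step i)^[2] y, opposite, (G.step_fst i _).symm, face_y 2⟩

end IsTriangleCrossing

end ONGraph

namespace ONGraph

variable {B : Type*} {G : ONGraph B}

namespace IsTwoPIDipoleFreeOfDegreeThreeHalves

variable [Finite B] (hG : G.IsTwoPIDipoleFreeOfDegreeThreeHalves) {i j k : Fin 4}
  (h : IsColorTriple i j k)
include hG h

theorem card_oddFaces : (G.oddFaces i).card = 2 :=
  (hG.card_oddFaces_eq_two_or_eq_four h).resolve_right (hG.false_of_card_eq_four h)

theorem faceLength_eq_three {f : G.Face i} (hf : f ∈ G.oddFaces i) : G.faceLength f = 3 := by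
  have := hG.sum_sub_three_add_two_le h (Finset.singleton_subset_iff.2 hf)
  rw [Finset.sum_singleton, hG.card_oddFaces h] at this
  have := hG.three_le_faceLength h.ne₁ f
  omega

theorem faceLength_eq_four {f : G.Face i} (hf : f ∉ G.oddFaces i) : G.faceLength f = 4 := by
  classical
  have := Fintype.ofFinite (G.Face i)
  have sum_eq := hG.sum_oddFaces_add_two h
  have le_sum := Finset.single_le_sum (f := fun f => G.faceLength f - 4) (fun _ _ => Nat.zero_le _)
    (Finset.mem_compl.2 hf)
  rw [hG.card_oddFaces h] at sum_eq
  obtain ⟨r, hr⟩ := Nat.not_odd_iff_even.1 (mt mem_oddFaces.2 hf)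
  have := hG.three_le_faceLength h.ne₁ f
  omega

theorem exists_oddFaces_eq :
    ∃ v, G.face i (flip j v) ≠ G.face i v ∧ ∀ f, f ∈ G.oddFaces i ↔ f = G.face i v ∨
      f = G.face i (flip j v) := by
  classical
  obtain ⟨c, d, hcd, oddFaces_eq⟩ := Finset.card_eq_two.1 (hG.card_oddFaces h)
  have mem_iff : ∀ f, f ∈ G.oddFaces i ↔ f = c ∨ f = d := fun f => by
    rw [oddFaces_eq, Finset.mem_insert, Finset.mem_singleton]
  obtain ⟨b, hb⟩ := hG.exists_facesAt_eq h ((mem_iff c).2 (Or.inl rfl))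
    ((mem_iff d).2 (Or.inr rfl)) hcd
  obtain ⟨s, rfl⟩ : c ∈ G.facesAt i b := hb ▸ Or.inl rfl
  have mem_pair : d ∈ ({G.face i (b, s), G.face i (flip j (b, s))} : Set _) := by
    rw [← G.facesAt_eq h (b, s), hb]
    exact Or.inr rfl
  obtain rfl := mem_pair.resolve_left hcd.symm
  exact ⟨(b, s), hcd.symm, mem_iff⟩

theorem exists_isTriangleCrossing : ∃ v, G.IsTriangleCrossing i j v := by
  obtain ⟨v, hne, mem_iff⟩ := hG.exists_oddFaces_eq h
  have hs := hG.isSimple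
  have length_eq := hG.faceLength_eq_three h ((mem_iff _).2 (Or.inl rfl))
  have length_flip_eq := hG.faceLength_eq_three h ((mem_iff _).2 (Or.inr rfl))
  set e := G.face i (flip j (G.step i v)) with he
  have face_step₁ : G.face i (G.step i v) = G.face i v := face_step _ h.ne₁ v
  have face_step₂ : G.face i (G.step i (G.step i v)) = G.face i v := by
    rw [face_step _ h.ne₁, face_step₁]
  have square_ne_left : e ≠ G.face i v := by
    have := hs.face_flip_ne h (v := G.step i v) (by rw [face_step₁, length_eq]; decide)
    rwa [face_step₁] at this
  have square_ne := hs.face_flip_step_ne h length_flip_eq hne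
  have notMem_oddFaces : e ∉ G.oddFaces i := fun hmem =>
    ((mem_iff e).1 hmem).elim square_ne_left square_ne
  have face_flip_step : G.face i (flip j (G.step i (G.step i v))) = e := by
    by_contra hne'
    refine mt (hG.sum_cross_eq_one_iff h v e).1 (fun hmem => notMem_oddFaces hmem.2) ?_
    rw [length_eq]
    have cross_zero : cross k (G.faceVec e) v.1 = 0 := cross_faceVec_eq_zero h <| by
      rw [G.facesAt_eq h, Set.mem_insert_iff, Set.mem_singleton_iff, not_or]
      exact ⟨square_ne_left, square_ne⟩
    have cross_one : cross k (G.faceVec e) (G.step i v).1 = 1 :=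
      cross_faceVec_eq_one h (face_step₁ ▸ square_ne_left.symm) he.symm
    have cross_two : cross k (G.faceVec e) (G.step i (G.step i v)).1 = 0 :=
      cross_faceVec_eq_zero h <| by
        rw [G.facesAt_eq h, Set.mem_insert_iff, Set.mem_singleton_iff, not_or, face_step₂]
        exact ⟨square_ne_left, Ne.symm hne'⟩
    simp only [Finset.sum_range_succ, Finset.sum_range_zero, Function.iterate_succ_apply,
      Function.iterate_zero_apply, cross_zero, cross_one, cross_two, zero_add, add_zero]
  exact ⟨v, length_eq, length_flip_eq, hne,
    ⟨face_flip_step, hG.faceLength_eq_four h notMem_oddFaces, by rwa [face_step₁]⟩, square_ne⟩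

end IsTwoPIDipoleFreeOfDegreeThreeHalves

namespace IsTriangleCrossing

variable [Finite B] (hG : G.IsTwoPIDipoleFreeOfDegreeThreeHalves) {i j k : Fin 4}
  {v : B × Fin 4} (hv : G.IsTriangleCrossing i j v) (h : IsColorTriple i j k)
include hG hv h

/-- A propagator in the square closes a path of length two through the crossing to a triangle of
propagators, which bounds a face of colour `l`. -/
theorem faceLength_eq_three {l m : Fin 4} (hl : IsColorTriple i l m) {a : B × Fin 4}
    (ha : a.1 = v.1) (face_eq : G.face i a = G.face i v)
    (face_flip_eq : G.face i (flip l a) = G.face i (flip j v)) :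
    G.faceLength (G.face l a) = 3 := by
  have hd : G.face i (flip j v) ∈ G.oddFaces i := by
    rw [mem_oddFaces, hv.length_flip_eq]
    decide
  have mem_propagator : ∀ w, G.face i w ∈ G.facesAt i (G.propagator w).1 := fun w =>
    G.face_propagator i w ▸ G.face_mem_facesAt i (G.propagator w)
  have propagator_ne : ∀ w : B × Fin 4, w.1 = v.1 → (G.propagator w).1 ≠ v.1 := fun w hw =>
    hw ▸ hG.propagator_fst_ne w
  obtain ⟨g, hg, hpg, face_g⟩ := hv.exists_edge h hG.isSimple (hG.controlsIntersection_faceVec h hd)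
    (by rw [← face_eq]; exact mem_propagator a) (propagator_ne a ha)
    (by rw [← face_flip_eq]; exact mem_propagator (flip l a)) (propagator_ne (flip l a) ha)
  have closes := hG.2.1.step_iterate_three_eq hG.isSimple hl (hG.evenCyclesBound hl) hg hpg
    (by rw [face_g, face_eq]; exact hv.square_ne' h)
    (by rw [face_g, face_flip_eq]; exact hv.square_ne)
  exact (faceLength_le_of_iterate hl.ne₂ three_pos closes).antisymm
    (hG.three_le_faceLength hl.ne₂ _)

theorem forall_faceLength_eq_three (c : Fin 4) (hc : c ≠ 0) (s : Fin 4) :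
    G.faceLength (G.face c (v.1, s)) = 3 := by
  have face_flip_third : G.face i (flip k v) = G.face i (flip j v) := by
    rw [← flip_comp h, face_flip _ h.ne₁]
  have of_facesAt : ∀ {l m : Fin 4}, IsColorTriple l i m → G.faceLength (G.face l v) = 3 →
      G.faceLength (G.face l (flip i v)) = 3 → G.faceLength (G.face l (v.1, s)) = 3 := by
    intro l m hl h1 h2
    rcases G.facesAt_eq hl v ▸ G.face_mem_facesAt l (v.1, s) with he | he <;> rwa [he]
  rcases h.color_cases c with rfl | rfl | rfl | rfl
  · exact absurd rfl hc
  · rcases G.facesAt_eq h v ▸ G.face_mem_facesAt c (v.1, s) with he | he <;> rw [he]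
    exacts [hv.length_eq, hv.length_flip_eq]
  · refine of_facesAt h.swap.rotate.rotate (hv.faceLength_eq_three hG h h rfl rfl rfl)
      (hv.faceLength_eq_three hG h h rfl (face_flip _ h.ne₁ v) ?_)
    rw [flip_comp h.swap.rotate.rotate, face_flip_third]
  · refine of_facesAt h.rotate.rotate
      (hv.faceLength_eq_three hG h h.swap rfl rfl face_flip_third)
      (hv.faceLength_eq_three hG h h.swap rfl (face_flip _ h.ne₁ v) ?_)
    rw [flip_comp h.rotate.rotate]

end IsTriangleCrossing

theorem IsTwoPIDipoleFreeOfDegreeThreeHalves.exists_center [Finite B]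
    (hG : G.IsTwoPIDipoleFreeOfDegreeThreeHalves) :
    ∃ b : B, ∀ c ≠ 0, ∀ s, G.faceLength (G.face c (b, s)) = 3 := by
  have h : IsColorTriple 1 2 3 := by decide
  obtain ⟨v, hv⟩ := hG.exists_isTriangleCrossing h
  exact ⟨v.1, hv.forall_faceLength_eq_three hG h⟩

end ONGraph

/-! ### Recognition of the graph on five bubbles -/

theorem ColoredGraph.isIsomorphic_of_injective {C V W : Type*} {G : ColoredGraph C V}
    {H : ColoredGraph C W} [Nonempty W] (hG : G.IsConnected) {φ : W → V}
    (hφ : Function.Injective φ) (hnbr : ∀ c w, φ (H.nbr c w) = G.nbr c (φ w)) :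
    G.IsIsomorphic H := by
  obtain ⟨w₀⟩ := ‹Nonempty W›
  have nbr_mem_range : ∀ c v, v ∈ Set.range φ → G.nbr c v ∈ Set.range φ := by
    rintro c _ ⟨w, rfl⟩
    exact ⟨H.nbr c w, hnbr c w⟩
  have surjective : Function.Surjective φ := fun v =>
    (apply_eq_of_reachable (f := fun v => v ∈ Set.range φ)
      (fun c _ v => propext ⟨fun hv => by simpa using nbr_mem_range c _ hv, nbr_mem_range c v⟩)
      (hG.preconnected (φ w₀) v)).mp ⟨w₀, rfl⟩
  let ε := Equiv.ofBijective φ ⟨hφ, surjective⟩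
  refine ⟨ε.symm, fun c v => ε.symm_apply_eq.2 ?_⟩
  exact ((hnbr c _).trans (congrArg (G.nbr c) (ε.apply_symm_apply v))).symm

namespace ONGraph

section Flip

variable {B : Type*}

theorem tetrahedron_zero_left : ∀ s, tetrahedron 0 s = s := by decide

theorem flip_zero (v : B × Fin 4) : flip 0 v = v := by
  rw [flip, tetrahedron_zero_left]

theorem flip_tetrahedron (c t : Fin 4) (v : B × Fin 4) :
    flip (tetrahedron c t) v = flip c (flip t v) := by
  have : ∀ c t s, tetrahedron (tetrahedron c t) s = tetrahedron c (tetrahedron t s) := by decide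
  rw [flip, this, flip, flip]

theorem flip_left_injective (v : B × Fin 4) : Function.Injective fun t => flip t v := by
  have : ∀ s t t', tetrahedron t s = tetrahedron t' s → t = t' := by decide
  exact fun t t' h => this _ _ _ (congrArg Prod.snd h)

end Flip

section Center

variable {B : Type*} [Finite B] {G : ONGraph B} {b : B}

theorem propagator_step {i : Fin 4} (hi : i ≠ 0) {v : B × Fin 4}
    (h : G.faceLength (G.face i v) = 3) : G.propagator (G.step i v) = G.step i (flip i v) := by
  have iterate_three : G.step i (G.step i (G.step i v)) = v := by
    have := G.iterate_faceLength hi v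
    rwa [h] at this
  conv_rhs => rw [← iterate_three, step, propagator_flip_step, step, flip_flip]

/-- The map from the vertices of the explicit graph that takes its central bubble to `b`, and its
outer bubble `s` to the bubble at the other end of the propagator at `(b, s)`. -/
def fiveBubbleMap (G : ONGraph B) (b : B) : Option (Fin 4) × Fin 4 → B × Fin 4
  | (none, s) => (b, s)
  | (some s, t) => flip t (G.propagator (b, s))

omit [Finite B] in
theorem fiveBubbleMap_flip {c : Fin 4} (v : Option (Fin 4) × Fin 4) :
    G.fiveBubbleMap b (flip c v) = flip c (G.fiveBubbleMap b v) := by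
  rcases v with ⟨_ | s, t⟩
  exacts [rfl, flip_tetrahedron c t _]

theorem fiveBubbleMap_propagator (hb : ∀ c ≠ 0, ∀ s, G.faceLength (G.face c (b, s)) = 3)
    (v : Option (Fin 4) × Fin 4) :
    G.fiveBubbleMap b (fiveBubbleGraph.propagator v) = G.propagator (G.fiveBubbleMap b v) := by
  rcases v with ⟨_ | s, t⟩
  · exact flip_zero _
  · by_cases ht : t = 0
    · subst ht
      exact ((congrArg G.propagator (flip_zero _)).trans (G.propagator_propagator _)).symm
    · have propagator_eq : fiveBubbleGraph.propagator (some s, t) = (some (tetrahedron t s), t) :=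
        if_neg ht
      rw [propagator_eq]
      exact (propagator_step ht (hb t ht s)).symm

omit [Finite B] in
theorem IsSimple.fiveBubbleMap_injective (hs : G.IsSimple) (b : B) :
    Function.Injective (G.fiveBubbleMap b) := by
  have fst_ne : ∀ s, (G.propagator (b, s)).1 ≠ b := fun s => hs.1 (b, s)
  rintro ⟨_ | s, t⟩ ⟨_ | s', t'⟩ h
  · exact congrArg (Prod.mk none) (congrArg Prod.snd h :)
  · exact absurd (congrArg Prod.fst h).symm (fst_ne s')
  · exact absurd (congrArg Prod.fst h) (fst_ne s)
  · obtain rfl : s = s' := congrArg Prod.snd (hs.2 (b, s) (b, s') rfl (congrArg Prod.fst h :))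
    rw [flip_left_injective (G.propagator (b, s)) h]

theorem isIsomorphic_fiveBubbleGraph (hG : G.graph.IsConnected) (hs : G.IsSimple)
    (hb : ∀ c ≠ 0, ∀ s, G.faceLength (G.face c (b, s)) = 3) :
    G.graph.IsIsomorphic fiveBubbleGraph.graph := by
  refine ColoredGraph.isIsomorphic_of_injective hG (hs.fiveBubbleMap_injective b) fun c v => ?_
  by_cases hc : c = 0
  · rw [hc, graph_nbr_zero, graph_nbr_zero, fiveBubbleMap_propagator hb]
  · rw [graph_nbr _ hc, graph_nbr _ hc, fiveBubbleMap_flip]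

end Center

end ONGraph

namespace ONGraph

/-! ### The graph on five bubbles -/

/-- The number of the face of colour `i` of the explicit graph through a vertex: the faces `0` and
`1` pass through the central bubble, the face `2` does not. -/
def fiveBubbleLabel (i : Fin 4) : Option (Fin 4) × Fin 4 → Fin 3
  | (none, s) => if s = 0 ∨ s = i then 0 else 1
  | (some s, t) => if t = 0 ∨ t = i then (if s = 0 ∨ s = i then 0 else 1) else 2

/-- A vertex on each face of colour `i` of the explicit graph, numbered as in `fiveBubbleLabel`. -/
def fiveBubbleVertex (i : Fin 4) : Fin 3 → Option (Fin 4) × Fin 4 :=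
  ![(none, 0), (none, if i = 1 then 2 else 1), (some 0, if i = 1 then 2 else 1)]

theorem fiveBubbleLabel_fiveBubbleVertex :
    ∀ i : Fin 4, i ≠ 0 → ∀ l, fiveBubbleLabel i (fiveBubbleVertex i l) = l := by decide

theorem face_fiveBubbleVertex {i : Fin 4} (hi : i ≠ 0) (v : Option (Fin 4) × Fin 4) :
    fiveBubbleGraph.face i (fiveBubbleVertex i (fiveBubbleLabel i v)) =
      fiveBubbleGraph.face i v := by
  have exists_iterate : ∀ i : Fin 4, i ≠ 0 → ∀ v, ∃ m : Fin 4,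
      (fiveBubbleGraph.step i)^[m] (fiveBubbleVertex i (fiveBubbleLabel i v)) = v ∨
      (fiveBubbleGraph.step i)^[m] (fiveBubbleVertex i (fiveBubbleLabel i v)) =
        fiveBubbleGraph.propagator v := by decide
  obtain ⟨m, hm⟩ := exists_iterate i hi v
  rw [← fiveBubbleGraph.face_iterate hi m]
  rcases hm with hm | hm <;> rw [hm]
  exact face_propagator _ i v

theorem fiveBubbleLabel_eq_of_face_eq {i : Fin 4} (hi : i ≠ 0) {v w : Option (Fin 4) × Fin 4}
    (h : fiveBubbleGraph.face i v = fiveBubbleGraph.face i w) :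
    fiveBubbleLabel i v = fiveBubbleLabel i w := by
  have label_propagator : ∀ i : Fin 4, i ≠ 0 → ∀ v,
      fiveBubbleLabel i (fiveBubbleGraph.propagator v) = fiveBubbleLabel i v := by decide
  have label_flip : ∀ i : Fin 4, i ≠ 0 → ∀ v,
      fiveBubbleLabel i (flip i v) = fiveBubbleLabel i v := by decide
  exact apply_eq_of_face_eq hi (label_propagator i hi) (label_flip i hi) h

/-- The three faces of colour `i` of the explicit graph, numbered as in `fiveBubbleLabel`. -/
noncomputable def fiveBubbleFaceEquiv {i : Fin 4} (hi : i ≠ 0) :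
    Fin 3 ≃ fiveBubbleGraph.Face i :=
  Equiv.ofBijective (fun l => fiveBubbleGraph.face i (fiveBubbleVertex i l)) <| by
    refine ⟨fun l l' h => ?_, fun f => ?_⟩
    · rw [← fiveBubbleLabel_fiveBubbleVertex i hi l, fiveBubbleLabel_eq_of_face_eq hi h,
        fiveBubbleLabel_fiveBubbleVertex i hi]
    · obtain ⟨v, rfl⟩ := fiveBubbleGraph.face_surjective i f
      exact ⟨fiveBubbleLabel i v, face_fiveBubbleVertex hi v⟩

theorem faceLength_fiveBubbleFaceEquiv {i : Fin 4} (hi : i ≠ 0) (l : Fin 3) :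
    fiveBubbleGraph.faceLength (fiveBubbleFaceEquiv hi l) = if l = 2 then 4 else 3 := by
  have card_label : ∀ i : Fin 4, i ≠ 0 → ∀ l,
      (Finset.univ.filter fun v => fiveBubbleLabel i v = l).card =
        2 * if l = 2 then 4 else 3 := by decide
  have supp_eq : {v | fiveBubbleGraph.face i v = fiveBubbleFaceEquiv hi l} =
      ((Finset.univ.filter fun v => fiveBubbleLabel i v = l : Finset _) : Set _) := by
    ext v
    rw [Finset.coe_filter_univ]
    refine ⟨fun hv => ?_, ?_⟩
    · exact (fiveBubbleLabel_eq_of_face_eq hi hv).trans (fiveBubbleLabel_fiveBubbleVertex i hi l)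
    · rintro rfl
      exact (face_fiveBubbleVertex hi v).symm
  have two_mul_eq := fiveBubbleGraph.two_mul_faceLength (fiveBubbleFaceEquiv hi l)
  rw [supp_eq, Set.ncard_coe_finset, card_label i hi] at two_mul_eq
  exact mul_left_cancel₀ two_ne_zero two_mul_eq

theorem card_face_fiveBubbleGraph {i : Fin 4} (hi : i ≠ 0) :
    Nat.card (fiveBubbleGraph.Face i) = 3 := by
  rw [← Nat.card_congr (fiveBubbleFaceEquiv hi), Nat.card_fin]

theorem faceLength_fiveBubbleGraph {i : Fin 4} (hi : i ≠ 0) (f : fiveBubbleGraph.Face i) :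
    fiveBubbleGraph.faceLength f = 3 ∨ fiveBubbleGraph.faceLength f = 4 := by
  obtain ⟨l, rfl⟩ := (fiveBubbleFaceEquiv hi).surjective f
  rw [faceLength_fiveBubbleFaceEquiv]
  split_ifs
  exacts [Or.inr rfl, Or.inl rfl]

theorem ncard_faceLength_eq_fiveBubbleGraph {i : Fin 4} (hi : i ≠ 0) (n : ℕ) :
    {f : fiveBubbleGraph.Face i | fiveBubbleGraph.faceLength f = n}.ncard =
      (Finset.univ.filter fun l : Fin 3 => (if l = 2 then 4 else 3) = n).card := by
  rw [← Set.ncard_coe_finset, ← Set.ncard_image_of_injective _ (fiveBubbleFaceEquiv hi).injective,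
    Finset.coe_filter_univ, Equiv.image_eq_preimage_symm]
  congr 1
  ext f
  obtain ⟨l, rfl⟩ := (fiveBubbleFaceEquiv hi).surjective f
  simp only [Set.mem_ofPred_eq, Set.mem_preimage, Equiv.symm_apply_apply,
    faceLength_fiveBubbleFaceEquiv]

theorem isDipoleFree_fiveBubbleGraph : fiveBubbleGraph.IsDipoleFree := by
  rintro ⟨i, hi, f, hf, -⟩
  rcases faceLength_fiveBubbleGraph hi f with h | h <;> omega

theorem genus_jacket_fiveBubbleGraph {i : Fin 4} (hi : i ≠ 0) :
    (fiveBubbleGraph.jacket i).genus = 1 / 2 := by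
  obtain ⟨j, k, h⟩ := exists_isColorTriple i hi
  rw [jacket_genus _ h, card_face_fiveBubbleGraph h.ne₂, card_face_fiveBubbleGraph h.ne₃]
  norm_num [Nat.card_eq_fintype_card]

theorem degree_fiveBubbleGraph : fiveBubbleGraph.degree = 3 / 2 := by
  rw [degree, genus_jacket_fiveBubbleGraph (by decide), genus_jacket_fiveBubbleGraph (by decide),
    genus_jacket_fiveBubbleGraph (by decide)]
  norm_num

section Remove

variable {B : Type*} {G : ONGraph B} {E : Set (Sym2 (B × Fin 4))}

theorem reachable_remove_of_fst_eq {v w : B × Fin 4} (hvw : w.1 = v.1) :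
    (G.graph.remove 0 E).Reachable v w := by
  have reachable_flip : ∀ {c}, c ≠ 0 → (G.graph.remove 0 E).Reachable v (flip c v) := fun hc =>
    SimpleGraph.Adj.reachable ⟨_, graph_nbr _ hc v, fun h => hc h.1⟩
  rcases eq_or_eq_flip_of_fst_eq (by decide : IsColorTriple 1 2 3) hvw with
    rfl | rfl | rfl | rfl
  exacts [.refl _, reachable_flip (by decide), reachable_flip (by decide),
    reachable_flip (by decide)]

theorem reachable_remove_propagator {v : B × Fin 4} (hv : s(v, G.propagator v) ∉ E) :
    (G.graph.remove 0 E).Reachable v (G.propagator v) :=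
  SimpleGraph.Adj.reachable ⟨0, graph_nbr_zero _ v, fun h => hv h.2⟩

end Remove

/-- For `s` and `t`, the propagator at the vertex `tetrahedron t s` of the central bubble and, if
`t ≠ 0`, the one at the vertex `t` of the outer bubble `s` join the latter to the central bubble. -/
theorem reachable_remove_fiveBubbleGraph {E : Set (Sym2 (Option (Fin 4) × Fin 4))} {s t : Fin 4}
    (hnone : s((none, tetrahedron t s), fiveBubbleGraph.propagator (none, tetrahedron t s)) ∉ E)
    (hsome : s((some s, t), fiveBubbleGraph.propagator (some s, t)) ∉ E) :
    (fiveBubbleGraph.graph.remove 0 E).Reachable (none, 0) (some s, 0) := by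
  have center : (fiveBubbleGraph.graph.remove 0 E).Reachable (none, 0) (none, tetrahedron t s) :=
    reachable_remove_of_fst_eq rfl
  have to_some : (fiveBubbleGraph.graph.remove 0 E).Reachable (none, 0)
      (some (tetrahedron t s), t) :=
    (center.trans (reachable_remove_propagator hnone)).trans (reachable_remove_of_fst_eq rfl)
  by_cases ht : t = 0
  · subst ht
    rwa [tetrahedron_zero_left] at to_some
  · have propagator_eq : fiveBubbleGraph.propagator (some s, t) = (some (tetrahedron t s), t) :=
      if_neg ht
    have outer := reachable_remove_propagator hsome
    rw [propagator_eq] at outer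
    exact (to_some.trans outer.symm).trans (reachable_remove_of_fst_eq rfl)

theorem isTwoPI_fiveBubbleGraph : fiveBubbleGraph.IsTwoPI := by
  rintro _ ⟨x, rfl⟩ _ ⟨x', rfl⟩ -
  simp only [graph_nbr_zero]
  set p := fiveBubbleGraph.propagator
  have exists_path : ∀ x s, ∃ t₀ : Fin 4, ∀ t ≠ t₀,
      s((none, tetrahedron t s), p (none, tetrahedron t s)) ≠ s(x, p x) ∧
        s((some s, t), p (some s, t)) ≠ s(x, p x) := by decide
  have exists_third : ∀ t₀ t₁ : Fin 4, ∃ t, t ≠ t₀ ∧ t ≠ t₁ := by decide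
  have reachable : ∀ v, (fiveBubbleGraph.graph.remove 0 {s(x, p x), s(x', p x')}).Reachable
      (none, 0) v := by
    rintro ⟨_ | s, r⟩
    · exact reachable_remove_of_fst_eq rfl
    · obtain ⟨t₀, h₀⟩ := exists_path x s
      obtain ⟨t₁, h₁⟩ := exists_path x' s
      obtain ⟨t, ht₀, ht₁⟩ := exists_third t₀ t₁
      refine (reachable_remove_fiveBubbleGraph (t := t) ?_ ?_).trans
        (reachable_remove_of_fst_eq rfl)
      · exact not_or.2 ⟨(h₀ t ht₀).1, (h₁ t ht₁).1⟩
      · exact not_or.2 ⟨(h₀ t ht₀).2, (h₁ t ht₁).2⟩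
  exact ⟨fun v w => (reachable v).symm.trans (reachable w)⟩

theorem isConnected_fiveBubbleGraph : fiveBubbleGraph.graph.IsConnected := by
  have connected_remove := isTwoPI_fiveBubbleGraph s((none, 0), (some 0, 0)) ⟨(none, 0), rfl⟩
    s((none, 1), (some 1, 0)) ⟨(none, 1), rfl⟩ (by decide)
  refine connected_remove.mono ?_
  rintro v w ⟨a, ha, -⟩
  exact ⟨a, Set.mem_univ a, ha⟩

theorem isTwoPIDipoleFreeOfDegreeThreeHalves_fiveBubbleGraph :
    fiveBubbleGraph.IsTwoPIDipoleFreeOfDegreeThreeHalves :=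
  ⟨isConnected_fiveBubbleGraph, isTwoPI_fiveBubbleGraph, isDipoleFree_fiveBubbleGraph,
    degree_fiveBubbleGraph⟩

end ONGraph

/-! ### The real projective plane -/

theorem eq_or_eq_neg_of_forall_mul_eq_mul {ι R : Type*} [CommRing R] [NoZeroDivisors R]
    {x y : ι → R} (h : ∀ a b, x a * x b = y a * y b) : y = x ∨ y = -x := by
  by_cases hx : x = 0
  · left
    ext a
    have sq_eq_zero := h a a
    rw [hx, Pi.zero_apply, mul_zero] at sq_eq_zero
    rw [hx, Pi.zero_apply, mul_self_eq_zero.1 sq_eq_zero.symm]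
  · obtain ⟨a, ha⟩ := Function.ne_iff.1 hx
    refine (mul_self_eq_mul_self_iff.1 (h a a)).imp (fun e => ?_) fun e => ?_ <;> ext b <;>
      refine mul_left_cancel₀ ha ?_
    · rw [h, ← e]
    · rw [Pi.neg_apply, mul_neg, h, e, neg_mul]

namespace RealProjectivePlane

/-- The embedding of the projective plane into the matrices by `x ↦ x xᵀ`. -/
def outerSquare : RealProjectivePlane → Fin 3 → Fin 3 → ℝ :=
  Quot.lift (fun x a b => x.1 a * x.1 b) (by rintro x _ rfl; ext a b; simp)

theorem eq_or_eq_neg_of_outerSquare_eq {x y : Metric.sphere (0 : EuclideanSpace ℝ (Fin 3)) 1}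
    (h : outerSquare (Quot.mk _ x) = outerSquare (Quot.mk _ y)) : y = x ∨ y = -x := by
  have mul_eq_mul : ∀ a b, x.1 a * x.1 b = y.1 a * y.1 b := fun a b =>
    congrFun (congrFun h a) b
  exact (eq_or_eq_neg_of_forall_mul_eq_mul mul_eq_mul).imp
    (fun e => Subtype.ext (PiLp.ext (congrFun e))) fun e => Subtype.ext (PiLp.ext (congrFun e))

instance : T2Space RealProjectivePlane := by
  refine T2Space.of_injective_continuous (f := outerSquare) ?_ ?_
  · rintro ⟨x⟩ ⟨y⟩ h
    rcases eq_or_eq_neg_of_outerSquare_eq h with rfl | e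
    exacts [rfl, Quot.sound e]
  · exact continuous_quot_lift _ (by fun_prop)

/-- The line through a nonzero vector. -/
noncomputable def ofVec (u : EuclideanSpace ℝ (Fin 3)) (hu : u ≠ 0) : RealProjectivePlane :=
  Quot.mk _ ⟨‖u‖⁻¹ • u, mem_sphere_zero_iff_norm.2 (norm_smul_inv_norm (𝕜 := ℝ) hu)⟩

variable {u v : EuclideanSpace ℝ (Fin 3)} {hu : u ≠ 0} {hv : v ≠ 0}

theorem ofVec_smul {r : ℝ} (hr : r ≠ 0) (h : u = r • v) : ofVec u hu = ofVec v hv := by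
  subst h
  have normalize_eq : ‖r • v‖⁻¹ • r • v = (|r|⁻¹ * r) • ‖v‖⁻¹ • v := by
    rw [norm_smul, Real.norm_eq_abs, mul_inv, smul_smul, smul_smul, mul_right_comm]
  rcases abs_choice r with e | e
  · refine congrArg (Quot.mk _) (Subtype.ext ?_)
    rw [e, inv_mul_cancel₀ hr, one_smul] at normalize_eq
    exact normalize_eq
  · symm
    refine Quot.sound (Subtype.ext ?_)
    rw [e, inv_neg, neg_mul, inv_mul_cancel₀ hr, neg_one_smul] at normalize_eq
    exact normalize_eq

theorem exists_eq_smul_of_ofVec_eq (h : ofVec u hu = ofVec v hv) : ∃ r : ℝ, u = r • v := by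
  have hu' := norm_ne_zero_iff.2 hu
  have eq_norm_smul : u = ‖u‖ • ‖u‖⁻¹ • u := (smul_inv_smul₀ hu' u).symm
  rcases eq_or_eq_neg_of_outerSquare_eq (congrArg outerSquare h) with e | e
  · have e' : ‖v‖⁻¹ • v = ‖u‖⁻¹ • u := congrArg Subtype.val e
    exact ⟨‖u‖ * ‖v‖⁻¹, by rw [mul_smul, e', ← eq_norm_smul]⟩
  · have e' : ‖v‖⁻¹ • v = -(‖u‖⁻¹ • u) := congrArg Subtype.val e
    exact ⟨-(‖u‖ * ‖v‖⁻¹), by rw [neg_smul, mul_smul, e', smul_neg, neg_neg, ← eq_norm_smul]⟩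

theorem exists_eq_ofVec (p : RealProjectivePlane) : ∃ u hu, p = ofVec u hu := by
  obtain ⟨x, rfl⟩ := Quot.exists_rep p
  have normalize_eq : ‖x.1‖⁻¹ • x.1 = x.1 := by
    rw [mem_sphere_zero_iff_norm.1 x.2, inv_one, one_smul]
  exact ⟨x.1, ne_zero_of_mem_unit_sphere x, congrArg (Quot.mk _) (Subtype.ext normalize_eq.symm)⟩

theorem continuous_ofVec {X : Type*} [TopologicalSpace X] {f : X → EuclideanSpace ℝ (Fin 3)}
    (hf : Continuous f) (h0 : ∀ x, f x ≠ 0) : Continuous fun x => ofVec (f x) (h0 x) :=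
  continuous_quot_mk.comp
    (Continuous.subtype_mk ((hf.norm.inv₀ fun x => norm_ne_zero_iff.2 (h0 x)).smul hf) _)

end RealProjectivePlane

/-! ### The surfaces of the jackets of the graph on five bubbles -/

/-- The five triangles into which the surface of a jacket of the explicit graph divides an octant of
`ℝ³`, seen as a cone. -/
inductive OctantCell
  | center
  | inner
  | right
  | left
  | outer
  deriving DecidableEq

namespace OctantCell

instance : Fintype OctantCell where
  elems := {center, inner, right, left, outer}
  complete := by rintro (_ | _) <;> decide

/-- The coordinates, up to sign, of the vector with barycentric coordinates `p` in a cell. The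
corners of label `0`, `1` and `2` of the cell are, as vectors of the first octant,
`(0, 0, 1), (1, 0, 1), (0, 1, 1)` for `center` and `(1, 1, 1)`, `(1, 0, 1)` or `(0, 1, 0)`,
`(0, 1, 1)` or `(1, 0, 0)` for the four cells around `(1, 1, 1)`. -/
def coord : OctantCell → (Fin 3 → ℝ) → Fin 3 → ℝ
  | center, p => ![p 1, p 2, p 0 + p 1 + p 2]
  | inner, p => ![p 0 + p 1, p 0 + p 2, p 0 + p 1 + p 2]
  | right, p => ![p 0 + p 1 + p 2, p 0, p 0 + p 1]
  | left, p => ![p 0, p 0 + p 1 + p 2, p 0 + p 2]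
  | outer, p => ![p 0 + p 2, p 0 + p 1, p 0]

/-- What lies across the side of a cell opposite to its corner of label `m`: another cell of the
octant or a coordinate plane, given by the coordinate that vanishes on it. -/
def side : OctantCell → Fin 3 → OctantCell ⊕ Fin 3
  | center => ![.inl inner, .inr 0, .inr 1]
  | inner => ![.inl center, .inl left, .inl right]
  | right => ![.inr 1, .inl outer, .inl inner]
  | left => ![.inr 0, .inl inner, .inl outer]
  | outer => ![.inr 2, .inl right, .inl left]

variable {t t' : OctantCell} {m l : Fin 3} {p p' : Fin 3 → ℝ}

theorem coord_eq_of_side_eq_inl (h : t.side m = .inl t') (hp : p m = 0) :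
    t.coord p = t'.coord p := by
  cases t <;> fin_cases m <;> cases h <;> simp_all [coord]

theorem coord_eq_zero_of_side_eq_inr (h : t.side m = .inr l) (hp : p m = 0) :
    t.coord p l = 0 := by
  cases t <;> fin_cases m <;> cases h <;> exact hp

theorem coord_smul (t : OctantCell) (r : ℝ) (p : Fin 3 → ℝ) :
    t.coord (r • p) = r • t.coord p := by
  cases t <;> simp [coord, mul_add]

theorem coord_nonneg (t : OctantCell) (hp : 0 ≤ p) : 0 ≤ t.coord p := by
  have h0 : 0 ≤ p 0 := hp 0
  have h1 : 0 ≤ p 1 := hp 1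
  have h2 : 0 ≤ p 2 := hp 2
  intro m
  cases t <;> fin_cases m <;>
    simp only [coord, Fin.zero_eta, Fin.mk_one, Fin.reduceFinMk, Matrix.cons_val] <;> positivity

theorem sum_le_sum_coord (t : OctantCell) (hp : 0 ≤ p) : ∑ m, p m ≤ ∑ m, t.coord p m := by
  have h0 : 0 ≤ p 0 := hp 0
  have h1 : 0 ≤ p 1 := hp 1
  have h2 : 0 ≤ p 2 := hp 2
  cases t <;> simp only [Fin.sum_univ_three, coord, Matrix.cons_val] <;> linarith

theorem continuous_coord (t : OctantCell) : Continuous t.coord := by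
  cases t <;> unfold coord <;> fun_prop

theorem eq_of_coord_eq (hp : 0 ≤ p) (hp' : 0 ≤ p') (h : t.coord p = t'.coord p') : p = p' := by
  have h0 := congrFun h 0
  have h1 := congrFun h 1
  have h2 := congrFun h 2
  have nonneg : (0 ≤ p 0 ∧ 0 ≤ p 1 ∧ 0 ≤ p 2) ∧ 0 ≤ p' 0 ∧ 0 ≤ p' 1 ∧ 0 ≤ p' 2 :=
    ⟨⟨hp 0, hp 1, hp 2⟩, hp' 0, hp' 1, hp' 2⟩
  ext m
  cases t <;> cases t' <;> simp only [coord, Matrix.cons_val] at h0 h1 h2 <;>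
    fin_cases m <;> dsimp only [Fin.zero_eta, Fin.mk_one, Fin.reduceFinMk] <;> linarith

theorem exists_coord_eq {w : Fin 3 → ℝ} (hw : 0 ≤ w) :
    ∃ (t : OctantCell) (p : Fin 3 → ℝ), 0 ≤ p ∧ t.coord p = w := by
  suffices ∃ (t : OctantCell) (a b c : ℝ), 0 ≤ a ∧ 0 ≤ b ∧ 0 ≤ c ∧
      t.coord ![a, b, c] = ![w 0, w 1, w 2] by
    obtain ⟨t, a, b, c, ha, hb, hc, h⟩ := this
    refine ⟨t, ![a, b, c], fun m => ?_, h.trans ?_⟩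
    · fin_cases m
      exacts [ha, hb, hc]
    · ext m
      fin_cases m <;> rfl
  have h0 : 0 ≤ w 0 := hw 0
  have h1 : 0 ≤ w 1 := hw 1
  have h2 : 0 ≤ w 2 := hw 2
  rcases le_total (w 0) (w 2) with h02 | h20 <;> rcases le_total (w 1) (w 2) with h12 | h21
  · rcases le_total (w 0 + w 1) (w 2) with h012 | h201
    · exact ⟨center, w 2 - w 0 - w 1, w 0, w 1, by linarith, h0, h1,
        by simp [coord, add_assoc]⟩
    · exact ⟨inner, w 0 + w 1 - w 2, w 2 - w 1, w 2 - w 0, by linarith, by linarith, by linarith,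
        by simp [coord]⟩
  · exact ⟨left, w 0, w 1 - w 2, w 2 - w 0, h0, by linarith, by linarith,
      by simp [coord]; ring⟩
  · exact ⟨right, w 1, w 2 - w 1, w 0 - w 2, h1, by linarith, by linarith, by simp [coord]⟩
  · exact ⟨outer, w 2, w 1 - w 2, w 0 - w 2, h2, by linarith, by linarith, by simp [coord]⟩

end OctantCell

/-- The sign by which the octant of the vertex `s` of the central bubble differs from the octant of
the vertex `0` in the coordinate that belongs to the colour `c`. -/
def octantSign (c s : Fin 4) : ℝ := if s = 0 ∨ s = c then 1 else -1

theorem octantSign_zero (c : Fin 4) : octantSign c 0 = 1 := if_pos (.inl rfl)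

theorem abs_octantSign (c s : Fin 4) : |octantSign c s| = 1 := by
  unfold octantSign
  split_ifs <;> simp

theorem octantSign_tetrahedron_self (c s : Fin 4) :
    octantSign c (tetrahedron c s) = octantSign c s := by
  have mem_iff : ∀ c s : Fin 4,
      (tetrahedron c s = 0 ∨ tetrahedron c s = c) ↔ (s = 0 ∨ s = c) := by decide
  simp only [octantSign, mem_iff]

theorem octantSign_tetrahedron {c d : Fin 4} (hc : c ≠ 0) (hd : d ≠ 0) (hcd : c ≠ d)
    (s : Fin 4) : octantSign c (tetrahedron d s) = -octantSign c s := by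
  have mem_iff : ∀ c d : Fin 4, c ≠ 0 → d ≠ 0 → c ≠ d → ∀ s,
      (tetrahedron d s = 0 ∨ tetrahedron d s = c) ↔ ¬ (s = 0 ∨ s = c) := by decide
  simp only [octantSign, mem_iff c d hc hd hcd]
  split_ifs <;> simp_all

namespace IsColorTriple

variable {i j k : Fin 4}

/-- The colours of the jacket `J_i`, as labels of the corners of an `OctantCell`. -/
noncomputable def cornerEquiv (h : IsColorTriple i j k) : Fin 3 ≃ {c : Fin 4 // c ≠ i} :=
  Equiv.ofBijective (fun m => ⟨![0, j, k] m, by revert m i j k; decide⟩) (by revert i j k; decide)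

/-- The colour of the edges of the central bubble that join two octants exchanged, up to sign, by
the reflection of the coordinate `m`. -/
def mirrorColor (_ : IsColorTriple i j k) : Fin 3 → Fin 4 := ![j, k, i]

theorem mirrorColor_ne_zero (h : IsColorTriple i j k) (m : Fin 3) : h.mirrorColor m ≠ 0 := by
  fin_cases m
  exacts [h.ne₂, h.ne₃, h.ne₁]

theorem mirrorColor_injective : ∀ {i j k : Fin 4} (h : IsColorTriple i j k),
    Function.Injective h.mirrorColor := by
  decide

theorem octantSign_mirrorColor_mirrorColor (h : IsColorTriple i j k) (m l : Fin 3) :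
    octantSign (h.mirrorColor m) (h.mirrorColor l) = if l = m then 1 else -1 := by
  simp only [octantSign, h.mirrorColor_ne_zero, false_or, h.mirrorColor_injective.eq_iff]

/-- The vertex of the explicit graph dual to a cell of the octant of `s`. -/
noncomputable def cellEquiv (h : IsColorTriple i j k) :
    OctantCell × Fin 4 ≃ Option (Fin 4) × Fin 4 :=
  Equiv.ofBijective (fun
    | (.center, s) => (none, s)
    | (.inner, s) => (some s, 0)
    | (.right, s) => (some s, k)
    | (.left, s) => (some s, j)
    | (.outer, s) => (some s, i)) (by revert i j k; decide)

end IsColorTriple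

namespace IsColorTriple

variable {i j k : Fin 4}

theorem tetrahedron_mirrorColor (h : IsColorTriple i j k) (m : Fin 3) (s : Fin 4) :
    tetrahedron (h.mirrorColor (m + 1)) (tetrahedron (h.mirrorColor (m + 2)) s) =
      tetrahedron (h.mirrorColor m) s := by
  revert m s h i j k
  decide

theorem eq_or_exists_eq_tetrahedron_mirrorColor (h : IsColorTriple i j k) (s s' : Fin 4) :
    s' = s ∨ ∃ m, s' = tetrahedron (h.mirrorColor m) s := by
  revert s s' h i j k
  decide

/-- The cell across the side opposite to the corner of label `m`. -/
def adjacentCell (h : IsColorTriple i j k) (m : Fin 3) (x : OctantCell × Fin 4) :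
    OctantCell × Fin 4 :=
  (x.1.side m).elim (fun t => (t, x.2)) fun l => (x.1, tetrahedron (h.mirrorColor l) x.2)

theorem nbr_cellEquiv (h : IsColorTriple i j k) (m : Fin 3) (x : OctantCell × Fin 4) :
    fiveBubbleGraph.graph.nbr (h.cornerEquiv m) (h.cellEquiv x) =
      h.cellEquiv (h.adjacentCell m x) := by
  have nbr_eq : ∀ {i j k : Fin 4} (h : IsColorTriple i j k), ∀ m t s,
      fiveBubbleGraph.graph.nbr (h.cornerEquiv m) (h.cellEquiv (t, s)) =
        h.cellEquiv (h.adjacentCell m (t, s)) := by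
    decide
  exact nbr_eq h m x.1 x.2

section Barycentric

variable (h : IsColorTriple i j k) (p : stdSimplex ℝ {c : Fin 4 // c ≠ i})

/-- The barycentric coordinates of `p`, indexed by the labels of the corners. -/
noncomputable def barycentric (m : Fin 3) : ℝ := p.1 (h.cornerEquiv m)

theorem barycentric_nonneg : 0 ≤ h.barycentric p := fun _ => p.2.1 _

theorem sum_barycentric : ∑ m, h.barycentric p m = 1 :=
  (h.cornerEquiv.sum_comp _).trans p.2.2

theorem continuous_barycentric : Continuous h.barycentric :=
  continuous_pi fun _ => (continuous_apply _).comp continuous_subtype_val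

theorem barycentric_injective : Function.Injective h.barycentric := fun _ _ e =>
  Subtype.ext (h.cornerEquiv.surjective.injective_comp_right e)

theorem exists_barycentric_eq {w : Fin 3 → ℝ} (hw : w ∈ stdSimplex ℝ (Fin 3)) :
    ∃ p, h.barycentric p = w := by
  refine ⟨⟨w ∘ h.cornerEquiv.symm, fun _ => hw.1 _, ?_⟩, ?_⟩
  · exact (h.cornerEquiv.symm.sum_comp _).trans hw.2
  · ext m
    exact congrArg w (h.cornerEquiv.symm_apply_apply m)

end Barycentric

/-- The point with barycentric coordinates `p` in a cell. -/
noncomputable def surfacePoint (h : IsColorTriple i j k) (p : stdSimplex ℝ {c : Fin 4 // c ≠ i})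
    (x : OctantCell × Fin 4) : (fiveBubbleGraph.jacket i).Surface :=
  Quot.mk _ ⟨h.cellEquiv x, p⟩

theorem exists_surfacePoint_eq (h : IsColorTriple i j k)
    (x : (fiveBubbleGraph.jacket i).Surface) : ∃ p a, h.surfacePoint p a = x := by
  obtain ⟨⟨v, p⟩, rfl⟩ := Quot.exists_rep x
  obtain ⟨a, rfl⟩ := h.cellEquiv.surjective v
  exact ⟨p, a, rfl⟩

section Glue

variable {h : IsColorTriple i j k} {p : stdSimplex ℝ {c : Fin 4 // c ≠ i}} {t t' : OctantCell}

theorem surfacePoint_adjacentCell {m : Fin 3} (hp : h.barycentric p m = 0)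
    (x : OctantCell × Fin 4) : h.surfacePoint p (h.adjacentCell m x) = h.surfacePoint p x :=
  (Quot.sound ⟨h.cornerEquiv m, (h.nbr_cellEquiv m x).symm, rfl, hp⟩).symm

theorem surfacePoint_eq_of_side_eq_inl {m : Fin 3} (hm : t.side m = .inl t')
    (hp : h.barycentric p m = 0) (s : Fin 4) :
    h.surfacePoint p (t, s) = h.surfacePoint p (t', s) := by
  rw [← surfacePoint_adjacentCell hp (t, s), adjacentCell, hm, Sum.elim_inl]

theorem surfacePoint_eq_of_side_eq_inr {m l : Fin 3} (hm : t.side m = .inr l)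
    (hp : h.barycentric p m = 0) (s : Fin 4) :
    h.surfacePoint p (t, tetrahedron (h.mirrorColor l) s) = h.surfacePoint p (t, s) := by
  rw [← surfacePoint_adjacentCell hp (t, s), adjacentCell, hm, Sum.elim_inr]

theorem surfacePoint_eq_of_barycentric_zero (hp : h.barycentric p 0 = 0) (s : Fin 4) :
    h.surfacePoint p (.center, s) = h.surfacePoint p (.inner, s) :=
  surfacePoint_eq_of_side_eq_inl rfl hp s

theorem surfacePoint_eq_of_barycentric_one (hp : h.barycentric p 1 = 0) (s : Fin 4) :
    h.surfacePoint p (.inner, s) = h.surfacePoint p (.left, s) ∧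
      h.surfacePoint p (.right, s) = h.surfacePoint p (.outer, s) :=
  ⟨surfacePoint_eq_of_side_eq_inl rfl hp s, surfacePoint_eq_of_side_eq_inl rfl hp s⟩

theorem surfacePoint_eq_of_barycentric_two (hp : h.barycentric p 2 = 0) (s : Fin 4) :
    h.surfacePoint p (.inner, s) = h.surfacePoint p (.right, s) ∧
      h.surfacePoint p (.left, s) = h.surfacePoint p (.outer, s) :=
  ⟨surfacePoint_eq_of_side_eq_inl rfl hp s, surfacePoint_eq_of_side_eq_inl rfl hp s⟩

theorem surfacePoint_eq_of_coord_eq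
    (ht : t.coord (h.barycentric p) = t'.coord (h.barycentric p)) (s : Fin 4) :
    h.surfacePoint p (t, s) = h.surfacePoint p (t', s) := by
  have h0 := congrFun ht 0
  have h1 := congrFun ht 1
  have h2 := congrFun ht 2
  have sum_eq := h.sum_barycentric p
  have nonneg : 0 ≤ h.barycentric p 0 ∧ 0 ≤ h.barycentric p 1 ∧ 0 ≤ h.barycentric p 2 :=
    ⟨h.barycentric_nonneg p 0, h.barycentric_nonneg p 1, h.barycentric_nonneg p 2⟩
  have across_zero := fun hp => surfacePoint_eq_of_barycentric_zero (h := h) (p := p) hp s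
  have across_one := fun hp => surfacePoint_eq_of_barycentric_one (h := h) (p := p) hp s
  have across_two := fun hp => surfacePoint_eq_of_barycentric_two (h := h) (p := p) hp s
  rw [Fin.sum_univ_three] at sum_eq
  cases t <;> cases t' <;> simp only [OctantCell.coord, Matrix.cons_val] at h0 h1 h2 <;> grind

theorem surfacePoint_eq_of_coord_eq_zero {l : Fin 3} (hl : t.coord (h.barycentric p) l = 0)
    (s : Fin 4) :
    h.surfacePoint p (t, tetrahedron (h.mirrorColor l) s) = h.surfacePoint p (t, s) := by
  have sum_eq := h.sum_barycentric p
  have nonneg : 0 ≤ h.barycentric p 0 ∧ 0 ≤ h.barycentric p 1 ∧ 0 ≤ h.barycentric p 2 :=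
    ⟨h.barycentric_nonneg p 0, h.barycentric_nonneg p 1, h.barycentric_nonneg p 2⟩
  have across_zero := surfacePoint_eq_of_barycentric_zero (h := h) (p := p)
  have across_one := surfacePoint_eq_of_barycentric_one (h := h) (p := p)
  have across_two := surfacePoint_eq_of_barycentric_two (h := h) (p := p)
  have reflect : ∀ (t : OctantCell) m, t.side m = .inr l → h.barycentric p m = 0 →
      h.surfacePoint p (t, tetrahedron (h.mirrorColor l) s) = h.surfacePoint p (t, s) :=
    fun _ _ hm hp => surfacePoint_eq_of_side_eq_inr hm hp s
  rw [Fin.sum_univ_three] at sum_eq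
  obtain rfl | rfl | rfl : l = 0 ∨ l = 1 ∨ l = 2 := by lia
  · have center := reflect .center 1 rfl
    have left := reflect .left 0 rfl
    cases t <;> simp only [OctantCell.coord, Matrix.cons_val] at hl <;> grind
  · have center := reflect .center 2 rfl
    have right := reflect .right 0 rfl
    cases t <;> simp only [OctantCell.coord, Matrix.cons_val] at hl <;> grind
  · have outer := reflect .outer 0 rfl
    cases t <;> simp only [OctantCell.coord, Matrix.cons_val] at hl <;> grind

end Glue
end IsColorTriple

namespace IsColorTriple

variable {i j k : Fin 4}

theorem octantSign_mirrorColor {h : IsColorTriple i j k} {l m : Fin 3} (hlm : l ≠ m)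
    (s : Fin 4) : octantSign (h.mirrorColor m) (tetrahedron (h.mirrorColor l) s) =
      -octantSign (h.mirrorColor m) s :=
  octantSign_tetrahedron (h.mirrorColor_ne_zero m) (h.mirrorColor_ne_zero l)
    (h.mirrorColor_injective.ne hlm.symm) s

theorem exists_octantSign_mul_abs_eq (h : IsColorTriple i j k) (u : Fin 3 → ℝ) :
    ∃ s, ∃ r : ℝ, r ≠ 0 ∧ ∀ m, octantSign (h.mirrorColor m) s * |u m| = r * u m := by
  rcases le_total 0 (u 0) with h0 | h0 <;> rcases le_total 0 (u 1) with h1 | h1 <;>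
    rcases le_total 0 (u 2) with h2 | h2
  -- The signs of an octant have product one, so that `r` is the product of the signs of `u`.
  on_goal 1 => refine ⟨0, 1, one_ne_zero, ?_⟩
  on_goal 2 => refine ⟨h.mirrorColor 2, -1, neg_ne_zero.2 one_ne_zero, ?_⟩
  on_goal 3 => refine ⟨h.mirrorColor 1, -1, neg_ne_zero.2 one_ne_zero, ?_⟩
  on_goal 4 => refine ⟨h.mirrorColor 0, 1, one_ne_zero, ?_⟩
  on_goal 5 => refine ⟨h.mirrorColor 0, -1, neg_ne_zero.2 one_ne_zero, ?_⟩
  on_goal 6 => refine ⟨h.mirrorColor 1, 1, one_ne_zero, ?_⟩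
  on_goal 7 => refine ⟨h.mirrorColor 2, 1, one_ne_zero, ?_⟩
  on_goal 8 => refine ⟨0, -1, neg_ne_zero.2 one_ne_zero, ?_⟩
  all_goals
    simp [Fin.forall_fin_succ, octantSign_zero, octantSign_mirrorColor_mirrorColor,
      abs_of_nonneg, abs_of_nonpos, h0, h1, h2]

section OctantVec

variable (h : IsColorTriple i j k) (p : stdSimplex ℝ {c : Fin 4 // c ≠ i})

/-- The vector with barycentric coordinates `p` in a cell. -/
noncomputable def octantVec (x : OctantCell × Fin 4) : EuclideanSpace ℝ (Fin 3) :=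
  .toLp 2 fun m => octantSign (h.mirrorColor m) x.2 * x.1.coord (h.barycentric p) m

theorem abs_octantVec (x : OctantCell × Fin 4) (m : Fin 3) :
    |h.octantVec p x m| = x.1.coord (h.barycentric p) m := by
  rw [octantVec, abs_mul, abs_octantSign, one_mul,
    abs_of_nonneg (x.1.coord_nonneg (h.barycentric_nonneg p) m)]

theorem octantVec_ne_zero (x : OctantCell × Fin 4) : h.octantVec p x ≠ 0 := by
  intro h0
  have sum_le := x.1.sum_le_sum_coord (h.barycentric_nonneg p)
  simp only [← abs_octantVec, h0, h.sum_barycentric, PiLp.zero_apply, abs_zero,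
    Finset.sum_const_zero] at sum_le
  exact zero_lt_one.not_ge sum_le

theorem continuous_octantVec (x : OctantCell × Fin 4) : Continuous (h.octantVec · x) :=
  (PiLp.continuous_toLp 2 _).comp <| continuous_pi fun m => continuous_const.mul <|
    (continuous_apply m).comp (x.1.continuous_coord.comp h.continuous_barycentric)

end OctantVec

variable {h : IsColorTriple i j k} {p q : stdSimplex ℝ {c : Fin 4 // c ≠ i}}

theorem octantVec_adjacentCell {m : Fin 3} (hp : h.barycentric p m = 0)
    (x : OctantCell × Fin 4) :
    h.octantVec p (h.adjacentCell m x) = h.octantVec p x ∨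
      h.octantVec p (h.adjacentCell m x) = -h.octantVec p x := by
  obtain ⟨t, s⟩ := x
  rcases hm : t.side m with t' | l
  · left
    rw [adjacentCell, hm, Sum.elim_inl, octantVec, octantVec,
      OctantCell.coord_eq_of_side_eq_inl hm hp]
  · right
    ext n
    simp only [adjacentCell, hm, Sum.elim_inr, octantVec, PiLp.neg_apply]
    rcases eq_or_ne l n with rfl | hln
    · rw [OctantCell.coord_eq_zero_of_side_eq_inr hm hp, mul_zero, mul_zero, neg_zero]
    · rw [octantSign_mirrorColor hln, neg_mul]

theorem surfacePoint_eq_of_octantVec_eq {t : OctantCell} {s s' : Fin 4}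
    (he : h.octantVec p (t, s) = h.octantVec p (t, s') ∨
      h.octantVec p (t, s) = -h.octantVec p (t, s')) :
    h.surfacePoint p (t, s) = h.surfacePoint p (t, s') := by
  rcases h.eq_or_exists_eq_tetrahedron_mirrorColor s' s with rfl | ⟨m, rfl⟩
  · rfl
  rcases he with he | he
  · have coord_eq_zero : ∀ l, m ≠ l → t.coord (h.barycentric p) l = 0 := fun l hml => by
      have hl : octantSign (h.mirrorColor l) (tetrahedron (h.mirrorColor m) s') * _ =
        octantSign (h.mirrorColor l) s' * _ := congrArg (· l) he
      rw [octantSign_mirrorColor hml, neg_mul, neg_eq_self] at hl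
      exact (mul_eq_zero.1 hl).resolve_left (abs_pos.1 (by simp [abs_octantSign]))
    rw [← h.tetrahedron_mirrorColor,
      surfacePoint_eq_of_coord_eq_zero (coord_eq_zero _ (by simp)),
      surfacePoint_eq_of_coord_eq_zero (coord_eq_zero _ (by simp))]
  · refine surfacePoint_eq_of_coord_eq_zero ?_ _
    have hm : octantSign (h.mirrorColor m) (tetrahedron (h.mirrorColor m) s') * _ =
      -(octantSign (h.mirrorColor m) s' * _) := congrArg (· m) he
    rw [octantSign_tetrahedron_self, self_eq_neg] at hm
    exact (mul_eq_zero.1 hm).resolve_left (abs_pos.1 (by simp [abs_octantSign]))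

theorem abs_eq_one_and_eq_of_octantVec_eq_smul {x y : OctantCell × Fin 4} {r : ℝ}
    (he : h.octantVec p x = r • h.octantVec q y) : |r| = 1 ∧ p = q := by
  have coord_eq : x.1.coord (h.barycentric p) = y.1.coord (|r| • h.barycentric q) := by
    ext m
    rw [← abs_octantVec, he, PiLp.smul_apply, smul_eq_mul, abs_mul, abs_octantVec,
      OctantCell.coord_smul, Pi.smul_apply, smul_eq_mul]
  have bary_eq : h.barycentric p = |r| • h.barycentric q :=
    OctantCell.eq_of_coord_eq (h.barycentric_nonneg p)
      (smul_nonneg (abs_nonneg r) (h.barycentric_nonneg q)) coord_eq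
  have abs_eq : |r| = 1 := by
    have sum_eq := h.sum_barycentric p
    simpa only [bary_eq, Pi.smul_apply, smul_eq_mul, ← Finset.mul_sum, h.sum_barycentric,
      mul_one] using sum_eq
  rw [abs_eq, one_smul] at bary_eq
  exact ⟨abs_eq, h.barycentric_injective bary_eq⟩

theorem surfacePoint_eq_of_octantVec_eq_smul {x y : OctantCell × Fin 4} {r : ℝ}
    (he : h.octantVec p x = r • h.octantVec q y) : h.surfacePoint p x = h.surfacePoint q y := by
  obtain ⟨abs_eq, rfl⟩ := abs_eq_one_and_eq_of_octantVec_eq_smul he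
  obtain ⟨t, s⟩ := x
  obtain ⟨t', s'⟩ := y
  have coord_eq : t.coord (h.barycentric p) = t'.coord (h.barycentric p) := by
    ext m
    rw [← h.abs_octantVec p (t, s), ← h.abs_octantVec p (t', s'), he, PiLp.smul_apply,
      smul_eq_mul, abs_mul, abs_eq, one_mul]
  have vec_eq : h.octantVec p (t', s') = h.octantVec p (t, s') := by
    rw [octantVec, octantVec, coord_eq]
  rw [← surfacePoint_eq_of_coord_eq coord_eq]
  rw [vec_eq] at he
  refine surfacePoint_eq_of_octantVec_eq ?_
  rcases eq_or_eq_neg_of_abs_eq abs_eq with rfl | rfl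
  · exact .inl (by rwa [one_smul] at he)
  · exact .inr (by rwa [neg_one_smul] at he)

theorem exists_octantVec_eq_smul (h : IsColorTriple i j k) {u : EuclideanSpace ℝ (Fin 3)}
    (hu : u ≠ 0) : ∃ p x, ∃ r : ℝ, r ≠ 0 ∧ h.octantVec p x = r • u := by
  obtain ⟨t, w, w_nonneg, hw⟩ := OctantCell.exists_coord_eq (w := fun m => |u m|)
    fun _ => abs_nonneg _
  obtain ⟨s, r, hr, hs⟩ := h.exists_octantSign_mul_abs_eq u
  have sum_ne_zero : ∑ m, w m ≠ 0 := fun sum_eq => hu <| by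
    have w_eq : w = (0 : ℝ) • w := by
      rw [zero_smul]
      exact (Fintype.sum_eq_zero_iff_of_nonneg w_nonneg).1 sum_eq
    ext m
    rw [w_eq, OctantCell.coord_smul, zero_smul] at hw
    exact abs_eq_zero.1 (congrFun hw m).symm
  obtain ⟨p, hp⟩ := h.exists_barycentric_eq (w := (∑ m, w m)⁻¹ • w)
    ⟨fun m => mul_nonneg (inv_nonneg.2 (Finset.sum_nonneg fun l _ => w_nonneg l)) (w_nonneg m), by
      simp only [Pi.smul_apply, smul_eq_mul, ← Finset.mul_sum, inv_mul_cancel₀ sum_ne_zero]⟩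
  refine ⟨p, (t, s), (∑ m, w m)⁻¹ * r, mul_ne_zero (inv_ne_zero sum_ne_zero) hr, ?_⟩
  ext m
  simp only [octantVec, hp, OctantCell.coord_smul, hw, Pi.smul_apply, PiLp.smul_apply, smul_eq_mul]
  rw [mul_left_comm, hs, mul_assoc]

/-- The map from the surface of `J_i` to the projective plane that sends a point of a cell to the
line through the corresponding vector. -/
noncomputable def toProjectivePlane (h : IsColorTriple i j k) :
    (fiveBubbleGraph.jacket i).Surface → RealProjectivePlane :=
  Quot.lift (fun a => .ofVec _ (h.octantVec_ne_zero a.2 (h.cellEquiv.symm a.1))) <| by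
    rintro ⟨v, p⟩ ⟨w, q⟩ ⟨c, hw, hq, hp⟩
    obtain rfl : q = p := hq
    obtain rfl : w = (fiveBubbleGraph.jacket i).nbr c v := hw
    obtain ⟨x, rfl⟩ := h.cellEquiv.surjective v
    obtain ⟨m, rfl⟩ := h.cornerEquiv.surjective c
    have symm_nbr : h.cellEquiv.symm ((fiveBubbleGraph.jacket i).nbr (h.cornerEquiv m)
        (h.cellEquiv x)) = h.adjacentCell m x :=
      h.cellEquiv.symm_apply_eq.2 (h.nbr_cellEquiv m x)
    rcases octantVec_adjacentCell hp x with e | e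
    · refine RealProjectivePlane.ofVec_smul one_ne_zero ?_
      rw [symm_nbr, h.cellEquiv.symm_apply_apply, e, one_smul]
    · refine RealProjectivePlane.ofVec_smul (neg_ne_zero.2 one_ne_zero) ?_
      rw [symm_nbr, h.cellEquiv.symm_apply_apply, e, neg_one_smul, neg_neg]

theorem toProjectivePlane_surfacePoint (x : OctantCell × Fin 4) :
    h.toProjectivePlane (h.surfacePoint p x) = .ofVec _ (h.octantVec_ne_zero p x) := by
  simp only [toProjectivePlane, surfacePoint, Equiv.symm_apply_apply]

theorem toProjectivePlane_injective (h : IsColorTriple i j k) :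
    Function.Injective h.toProjectivePlane := by
  intro a b hab
  obtain ⟨p, x, rfl⟩ := h.exists_surfacePoint_eq a
  obtain ⟨q, y, rfl⟩ := h.exists_surfacePoint_eq b
  rw [toProjectivePlane_surfacePoint, toProjectivePlane_surfacePoint] at hab
  obtain ⟨r, hr⟩ := RealProjectivePlane.exists_eq_smul_of_ofVec_eq hab
  exact surfacePoint_eq_of_octantVec_eq_smul hr

theorem toProjectivePlane_surjective (h : IsColorTriple i j k) :
    Function.Surjective h.toProjectivePlane := by
  intro a
  obtain ⟨u, hu, rfl⟩ := RealProjectivePlane.exists_eq_ofVec a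
  obtain ⟨p, x, r, hr, he⟩ := h.exists_octantVec_eq_smul hu
  refine ⟨h.surfacePoint p x, ?_⟩
  rw [toProjectivePlane_surfacePoint]
  exact RealProjectivePlane.ofVec_smul hr he

theorem continuous_toProjectivePlane (h : IsColorTriple i j k) :
    Continuous h.toProjectivePlane :=
  continuous_quot_lift _ <| continuous_sigma fun v =>
    RealProjectivePlane.continuous_ofVec (h.continuous_octantVec (h.cellEquiv.symm v))
      fun p => h.octantVec_ne_zero p _

theorem nonempty_surface_homeomorph (h : IsColorTriple i j k) :
    Nonempty ((fiveBubbleGraph.jacket i).Surface ≃ₜ RealProjectivePlane) :=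
  ⟨Continuous.homeoOfEquivCompactToT2
    (f := Equiv.ofBijective _ ⟨h.toProjectivePlane_injective, h.toProjectivePlane_surjective⟩)
    h.continuous_toProjectivePlane⟩

end IsColorTriple

theorem theorem7p1 :
    fiveBubbleGraph.IsTwoPIDipoleFreeOfDegreeThreeHalves ∧
    (∀ (B : Type*) [Finite B] (G : ONGraph B),
      G.IsTwoPIDipoleFreeOfDegreeThreeHalves → G.graph.IsIsomorphic fiveBubbleGraph.graph) ∧
    (∀ i : Fin 4, i ≠ 0 →
      (fiveBubbleGraph.jacket i).genus = 1 / 2 ∧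
      Nonempty ((fiveBubbleGraph.jacket i).Surface ≃ₜ RealProjectivePlane) ∧
      {f : fiveBubbleGraph.Face i | fiveBubbleGraph.faceLength f = 3}.ncard = 2 ∧
      {f : fiveBubbleGraph.Face i | fiveBubbleGraph.faceLength f = 4}.ncard = 1 ∧
      ∀ f : fiveBubbleGraph.Face i,
        fiveBubbleGraph.faceLength f = 3 ∨ fiveBubbleGraph.faceLength f = 4) := by
  refine ⟨ONGraph.isTwoPIDipoleFreeOfDegreeThreeHalves_fiveBubbleGraph, fun B _ G hG => ?_,
    fun i hi => ⟨ONGraph.genus_jacket_fiveBubbleGraph hi, ?_, ?_, ?_,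
      ONGraph.faceLength_fiveBubbleGraph hi⟩⟩
  · obtain ⟨b, hb⟩ := hG.exists_center
    exact ONGraph.isIsomorphic_fiveBubbleGraph hG.1 hG.isSimple hb
  · obtain ⟨j, k, h⟩ := exists_isColorTriple i hi
    exact h.nonempty_surface_homeomorph
  · rw [ONGraph.ncard_faceLength_eq_fiveBubbleGraph hi]
    decide
  · rw [ONGraph.ncard_faceLength_eq_fiveBubbleGraph hi]
    decide
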